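/- Let $n\ge 1$, $p>1$, and let $\phi:\mathbb{R}^n\to[0,\infty)$ be bounded and continuous. For $\alpha>0$ put $$D(\alpha)=\limsup_{r\to+\infty}\frac{|\{x:\phi(x)\ge\alpha\}\cap B(0,r)|}{|B(0,r)|},$$ where $|\cdot|$ is Lebesgue measure and $B(0,r)$ is the ball of radius $r$ centred at the origin. Suppose that $\infty$ is not a rarefaction point of $\phi$, that is, it is not the case that for every $\alpha>0$ $$\lim_{r\to+\infty}\frac{|\{x:\phi(x)\ge\alpha\}\cap B(0,r)|}{|B(0,r)|}=0.$$ Then the solution $u$ of the Cauchy problem $$u_t=\Delta u+|u|^{p-1}u\ \text{ in } \mathbb{R}^n\times(0,T^*),\qquad u(\cdot,0)=\phi \ \text{ in } \mathbb{R}^n,$$ blows up in finite time: there are $T^*\in(0,\infty)$ and a unique maximal classical solution $u$, defined on $\mathbb{R}^n\times[0,T^*)$, such that $$\lim_{t\to T^{*}-}\|u(\cdot,t)\|_{L^\infty(\mathbb{R}^n)}=\infty,$$ and its life span satisfies $$T^*\le\frac1{p-1}\inf_{\alpha>0}\bigl(\alpha D(\alpha)\bigr)^{1-p},$$ where $0^{1-p}=+\infty$.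 Here a classical solution on $\mathbb{R}^n\times[0,T)$, with $0<T<\infty$, is a function $u$ that is continuous on $\mathbb{R}^n\times[0,T)$, bounded on $\mathbb{R}^n\times[0,S]$ for every $S<T$, has continuous derivatives $u_t$, $D_xu$, $D_x^2u$ on $\mathbb{R}^n\times(0,T)$, and satisfies the equation and the initial condition pointwise; "unique maximal" means that every classical solution $v$ on some $\mathbb{R}^n\times[0,S)$ with the same initial datum satisfies $S\le T^*$ and $v=u$ on $\mathbb{R}^n\times[0,S)$. -/

import Mathlib

open Set Filter Topology MeasureTheory
open scoped ENNReal

noncomputable section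

namespace NonRarefied

/-- The density `mes (E ∩ B(0, r)) / mes B(0, r)` of a set `E ⊆ ℝⁿ` in the ball of radius `r`
centred at the origin. -/
def ballDensity {n : ℕ} (E : Set (EuclideanSpace ℝ (Fin n))) (r : ℝ) : ℝ≥0∞ :=
  volume (E ∩ Metric.ball 0 r) / volume (Metric.ball (0 : EuclideanSpace ℝ (Fin n)) r)

/-- `∞` is a point of rarefaction of the set `E`. -/
def IsRarefactionSetAtInfty {n : ℕ} (E : Set (EuclideanSpace ℝ (Fin n))) : Prop :=
  Tendsto (fun r : ℝ => ballDensity E r) atTop (𝓝 0)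

/-- `∞` is a rarefaction point of the function `φ`: for every `α > 0` it is a point of
rarefaction of the superlevel set `{φ ≥ α}`. -/
def IsRarefactionFunAtInfty {n : ℕ} (φ : EuclideanSpace ℝ (Fin n) → ℝ) : Prop :=
  ∀ α : ℝ, 0 < α → IsRarefactionSetAtInfty {x | α ≤ φ x}

/-- The upper density at infinity `D(α)` of the superlevel set `{φ ≥ α}`. -/
def upperDensity {n : ℕ} (φ : EuclideanSpace ℝ (Fin n) → ℝ) (α : ℝ) : ℝ≥0∞ :=
  limsup (fun r : ℝ => ballDensity {x | α ≤ φ x} r) atTop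

/-- `u` is a classical solution on `ℝⁿ × [0, T)`, bounded on `ℝⁿ × [0, S]` for each `S < T`, of
`u_t = Δ u + |u|^(p-1) u`, `u(·, 0) = φ`.  The function is written `u t x`; its values for
`t` outside `[0, T)` play no role. -/
structure IsClassicalSolution {n : ℕ} (p : ℝ) (φ : EuclideanSpace ℝ (Fin n) → ℝ) (T : ℝ)
    (u : ℝ → EuclideanSpace ℝ (Fin n) → ℝ) : Prop where
  pos : 0 < T
  continuousOn : ContinuousOn (fun z : ℝ × EuclideanSpace ℝ (Fin n) => u z.1 z.2)
    (Ico 0 T ×ˢ univ)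
  differentiableAt_time : ∀ t ∈ Ioo 0 T, ∀ x, DifferentiableAt ℝ (fun s => u s x) t
  contDiff_space : ∀ t ∈ Ioo 0 T, ContDiff ℝ 2 (u t)
  continuousOn_deriv_time : ContinuousOn
    (fun z : ℝ × EuclideanSpace ℝ (Fin n) => deriv (fun s => u s z.2) z.1) (Ioo 0 T ×ˢ univ)
  continuousOn_fderiv_space : ContinuousOn
    (fun z : ℝ × EuclideanSpace ℝ (Fin n) => fderiv ℝ (u z.1) z.2) (Ioo 0 T ×ˢ univ)
  continuousOn_fderiv2_space : ContinuousOn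
    (fun z : ℝ × EuclideanSpace ℝ (Fin n) => iteratedFDeriv ℝ 2 (u z.1) z.2) (Ioo 0 T ×ˢ univ)
  equation : ∀ t ∈ Ioo 0 T, ∀ x,
    deriv (fun s => u s x) t = Laplacian.laplacian (u t) x + |u t x| ^ (p - 1) * u t x
  initial : ∀ x, u 0 x = φ x
  bounded : ∀ S ∈ Ico 0 T, ∃ M : ℝ, ∀ t ∈ Icc 0 S, ∀ x, |u t x| ≤ M

/-- `u`, on the time interval `[0, T)`, is the (unique, maximal) classical solution: every
classical solution with the same initial datum lives on a time interval contained in `[0, T)`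
and coincides with `u` there. -/
structure IsMaximalSolution {n : ℕ} (p : ℝ) (φ : EuclideanSpace ℝ (Fin n) → ℝ) (T : ℝ)
    (u : ℝ → EuclideanSpace ℝ (Fin n) → ℝ) : Prop where
  isClassicalSolution : IsClassicalSolution p φ T u
  maximal : ∀ (S : ℝ) (v : ℝ → EuclideanSpace ℝ (Fin n) → ℝ), IsClassicalSolution p φ S v →
    S ≤ T ∧ ∀ t ∈ Ico 0 S, ∀ x, v t x = u t x

/-- `u` blows up at time `T`: the norm `‖u(·, t)‖` in `L^∞(ℝⁿ)` tends to infinity as `t → T⁻`. -/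
def BlowsUpAt {n : ℕ} (u : ℝ → EuclideanSpace ℝ (Fin n) → ℝ) (T : ℝ) : Prop :=
  Tendsto (fun t : ℝ => eLpNorm (u t) ∞ volume) (𝓝[<] T) (𝓝 ∞)

end NonRarefied

end

/-! Diffusion is compared with the ODE `y' = y ^ p`. Let Φ(t, s) (`odeInverse`) be the value at time
0 of the ODE solution that equals s at time t, and let H be the heat flow of φ. Φ is constant along
ODE trajectories, and Φ(t, ·) is concave. In the equation for Φ(t, u) the reaction term therefore
cancels and the gradient term has the favourable sign, so Φ(t, u) is a supersolution of the heat
equation. The comparison principle gives H ≤ Φ(t, u). Moreover Φ(t, s) ≤ ((p - 1) t) ^ (-1/(p - 1))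
for all s ≥ 0, since ODE solutions starting at or above that value have blown up by time t. Thus, as
long as the solution exists, H obeys a bound S(t) that no longer involves u
(`gaussAvg_le_of_solution`).

The heat flow in turn sees densities. Integrating H(t, ·) ≤ S over a large ball and exchanging
integrals bounds α |{φ ≥ α} ∩ B(0, r)|, times the Gaussian mass of B(0, R), by S |B(0, r + aR)| with
a = √(2t). Letting r → ∞ and then R → ∞ gives α D(α) ≤ S (`ofReal_mul_upperDensity_le`). With S =
S(t) this reads t ≤ (α D(α)) ^ (1 - p) / (p - 1). Non-rarefaction supplies an α with D(α) > 0, so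
existence times are bounded.

What remains is the classical theory of the Cauchy problem: local existence by contraction on a time
interval depending only on the size of the datum (`exists_local_solution`), smoothness of mild
solutions from gradient bounds of order s^(-1/2) (`hasParabolicDerivs_duhamel`), and a maximum
principle with a growing barrier (`nonpos_of_parabolic_inequality`), which yields uniqueness. The
union of all solutions is then maximal. A solution bounded by m at some time lives for a further
time depending only on m, which forces the norm to tend to infinity. -/

namespace NonRarefied

set_option linter.unusedSectionVars false

/-! ### Gaussian averages: density, gradient, semigroup property. -/

section Gaussian

open ProbabilityTheory
open scoped RealInnerProductSpace

variable {E : Type*} [NormedAddCommGroup E] [InnerProductSpace ℝ E] [FiniteDimensional ℝ E]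
  [MeasurableSpace E] [BorelSpace E]

variable (E) in
/-- The Lebesgue density of the standard Gaussian measure. -/
noncomputable def gaussianDensity (z : E) : ℝ :=
  ((2 * Real.pi) ^ ((Module.finrank ℝ E : ℝ) / 2))⁻¹ * Real.exp (-(1 / 2) * ‖z‖ ^ 2)

lemma gaussianDensity_pos (z : E) : 0 < gaussianDensity E z := by
  unfold gaussianDensity; positivity

lemma continuous_gaussianDensity : Continuous (gaussianDensity E) := by
  unfold gaussianDensity; fun_prop

lemma integral_gaussianDensity : ∫ z, gaussianDensity E z = 1 := by
  unfold gaussianDensity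
  rw [integral_const_mul, GaussianFourier.integral_rexp_neg_mul_sq_norm (by norm_num)]
  rw [show Real.pi / (1 / 2) = 2 * Real.pi by ring]
  exact inv_mul_cancel₀ (by positivity)

lemma integrable_gaussianDensity : Integrable (gaussianDensity E) := by
  -- A non-integrable function has Bochner integral `0`, whereas this integral is `1`.
  by_contra h
  have := integral_gaussianDensity (E := E)
  rw [integral_undef h] at this
  norm_num at this

/-- Both finite measures have characteristic function exp(-‖t‖² / 2). The abstract measure brings
exponential integrability; the density makes translations computable. -/
lemma stdGaussian_eq_withDensity :
    stdGaussian E = volume.withDensity (fun z => ENNReal.ofReal (gaussianDensity E z)) := by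
  have hfin : IsFiniteMeasure
      (volume.withDensity (fun z => ENNReal.ofReal (gaussianDensity E z))) :=
    isFiniteMeasure_withDensity_ofReal integrable_gaussianDensity.2
  refine Measure.ext_of_charFun ?_
  ext t
  rw [charFun_stdGaussian, charFun_apply, integral_withDensity_eq_integral_toReal_smul
    (by exact continuous_gaussianDensity.measurable.ennreal_ofReal) (by simp)]
  have h := GaussianFourier.integral_cexp_neg_mul_sq_norm_add (V := E) (b := 1 / 2) (by norm_num)
    Complex.I t
  have h2 : ∀ x : E, (ENNReal.ofReal (gaussianDensity E x)).toReal •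
      Complex.exp (⟪x, t⟫ * Complex.I) =
      (((2 * Real.pi) ^ ((Module.finrank ℝ E : ℝ) / 2))⁻¹ : ℝ) *
        Complex.exp (-(1 / 2) * ‖x‖ ^ 2 + Complex.I * ⟪t, x⟫) := by
    intro x
    rw [ENNReal.toReal_ofReal (gaussianDensity_pos x).le, gaussianDensity, Complex.exp_add,
      real_inner_comm, Complex.real_smul]
    push_cast
    ring_nf
  simp_rw [h2]
  rw [integral_const_mul, h]
  have h3 : ((Real.pi : ℂ) / (1 / 2)) ^ ((Module.finrank ℝ E : ℂ) / 2) =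
      (((2 * Real.pi) ^ ((Module.finrank ℝ E : ℝ) / 2) : ℝ) : ℂ) := by
    rw [Complex.ofReal_cpow (by positivity)]
    push_cast
    congr 1
    ring
  rw [h3, ← mul_assoc, ← Complex.ofReal_mul, inv_mul_cancel₀ (by positivity)]
  simp only [Complex.ofReal_one, one_mul, Complex.I_sq]
  congr 1
  ring

lemma integral_stdGaussian_eq {F : Type*} [NormedAddCommGroup F] [NormedSpace ℝ F] (f : E → F) :
    ∫ z, f z ∂(stdGaussian E) = ∫ z, gaussianDensity E z • f z := by
  rw [stdGaussian_eq_withDensity, integral_withDensity_eq_integral_toReal_smul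
    (by exact continuous_gaussianDensity.measurable.ennreal_ofReal) (by simp)]
  simp_rw [ENNReal.toReal_ofReal (gaussianDensity_pos _).le]

/-- Cameron–Martin: translating the standard Gaussian measure. -/
lemma integral_stdGaussian_add {F : Type*} [NormedAddCommGroup F] [NormedSpace ℝ F] (f : E → F)
    (h : E) : ∫ z, f (z + h) ∂(stdGaussian E) =
      ∫ z, Real.exp (⟪h, z⟫ - ‖h‖ ^ 2 / 2) • f z ∂(stdGaussian E) := by
  rw [integral_stdGaussian_eq, integral_stdGaussian_eq,
    ← integral_add_right_eq_self (μ := volume)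
      (fun z => gaussianDensity E z • Real.exp (⟪h, z⟫ - ‖h‖ ^ 2 / 2) • f z) h]
  congr 1
  ext z
  rw [smul_smul]
  congr 1
  unfold gaussianDensity
  rw [mul_assoc, ← Real.exp_add]
  congr 2
  rw [norm_add_sq_real, inner_add_right, real_inner_self_eq_norm_sq, real_inner_comm]
  ring

lemma integrable_exp_mul_norm (c : ℝ) :
    Integrable (fun z : E => Real.exp (c * ‖z‖)) (stdGaussian E) := by
  obtain ⟨C, hC, hi⟩ := IsGaussian.exists_integrable_exp_sq (stdGaussian E)
  refine (hi.const_mul (Real.exp (c ^ 2 / (4 * C)))).mono' (by fun_prop) (ae_of_all _ fun z => ?_)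
  rw [Real.norm_eq_abs, abs_of_pos (Real.exp_pos _), ← Real.exp_add]
  refine Real.exp_le_exp.2 ?_
  -- Completing the square bounds c‖z‖ by C‖z‖² + c²/(4C), and exp(C‖z‖²) is integrable by
  -- Fernique's theorem.
  have : 0 ≤ C * (‖z‖ - c / (2 * C)) ^ 2 := by positivity
  have e : C * (‖z‖ - c / (2 * C)) ^ 2 = c ^ 2 / (4 * C) + C * ‖z‖ ^ 2 - c * ‖z‖ := by
    field_simp; ring
  linarith

lemma integrable_norm_stdGaussian : Integrable (fun z : E => ‖z‖) (stdGaussian E) :=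
  (IsGaussian.integrable_id (μ := stdGaussian E)).norm

variable (E) in
/-- The mean norm of a standard Gaussian vector. -/
noncomputable def gaussianMeanNorm : ℝ := ∫ z : E, ‖z‖ ∂(stdGaussian E)

lemma gaussianMeanNorm_nonneg : 0 ≤ gaussianMeanNorm E := integral_nonneg fun _ => norm_nonneg _

/-- Gaussian average of `φ` at scale `a`; the heat semigroup is `gaussAvg √(2t)`. -/
noncomputable def gaussAvg (a : ℝ) (φ : E → ℝ) (x : E) : ℝ := ∫ z, φ (x + a • z) ∂(stdGaussian E)

/-- Gaussian average of `φ` against the weight `z`. -/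
noncomputable def gaussMoment (a : ℝ) (φ : E → ℝ) (x : E) : E :=
  ∫ z, φ (x + a • z) • z ∂(stdGaussian E)

lemma integrable_smul_id {φ : E → ℝ} {M : ℝ} (hφ : Continuous φ) (hM : ∀ x, ‖φ x‖ ≤ M)
    (a : ℝ) (x : E) : Integrable (fun z => φ (x + a • z) • z) (stdGaussian E) := by
  refine (integrable_norm_stdGaussian.const_mul M).mono'
    (Continuous.aestronglyMeasurable (by fun_prop)) (ae_of_all _ fun z => ?_)
  rw [norm_smul]
  gcongr
  exact hM _

lemma aestronglyMeasurable_comp_affine {F : Type*} [NormedAddCommGroup F] {φ : E → F}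
    (hφ : Continuous φ) (x : E) (a : ℝ) {μ : Measure E} :
    AEStronglyMeasurable (fun z => φ (x + a • z)) μ :=
  (hφ.comp (by fun_prop : Continuous fun z : E => x + a • z)).aestronglyMeasurable

lemma integrable_comp_affine {F : Type*} [NormedAddCommGroup F] {φ : E → F} {M : ℝ}
    (hφ : Continuous φ) (hM : ∀ x, ‖φ x‖ ≤ M) (x : E) (a : ℝ) :
    Integrable (fun z => φ (x + a • z)) (stdGaussian E) :=
  (integrable_const M).mono' (aestronglyMeasurable_comp_affine hφ x a) (ae_of_all _ fun _ => hM _)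

/-- Cameron–Martin moves the dependence on the point `y` from `φ` into a smooth exponential weight,
so that a merely continuous `φ` can be differentiated under the integral. -/
lemma gaussAvg_add (a : ℝ) {φ : E → ℝ} (ha : a ≠ 0) (x y : E) :
    gaussAvg a φ y = ∫ z, Real.exp (⟪a⁻¹ • (y - x), z⟫ - ‖a⁻¹ • (y - x)‖ ^ 2 / 2) *
      φ (x + a • z) ∂(stdGaussian E) := by
  have := integral_stdGaussian_add (fun z => φ (x + a • z)) (a⁻¹ • (y - x))
  simp only [smul_eq_mul] at this
  rw [← this, gaussAvg]
  congr 1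
  ext z
  congr 1
  rw [smul_add, smul_inv_smul₀ ha]
  abel

/-- The gradient of a Gaussian average of a bounded continuous function. -/
lemma hasFDerivAt_gaussAvg {a : ℝ} (ha : a ≠ 0) {φ : E → ℝ} {M : ℝ} (hφ : Continuous φ)
    (hM : ∀ x, ‖φ x‖ ≤ M) (x : E) :
    HasFDerivAt (gaussAvg a φ) (innerSL ℝ (a⁻¹ • gaussMoment a φ x)) x := by
  have hM0 : 0 ≤ M := (norm_nonneg _).trans (hM x)
  have hb : 0 < |a|⁻¹ := by positivity
  set w : E → E → ℝ := fun y z => ⟪a⁻¹ • (y - x), z⟫ - ‖a⁻¹ • (y - x)‖ ^ 2 / 2 with hw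
  set w' : E → E → (E →L[ℝ] ℝ) := fun y z =>
    a⁻¹ • innerSL ℝ z - (a⁻¹ * a⁻¹) • innerSL ℝ (y - x) with hw'
  have hdw : ∀ z y, HasFDerivAt (fun y => w y z) (w' y z) y := by
    intro z y
    have h1 : HasFDerivAt (fun y => y - x) (ContinuousLinearMap.id ℝ E) y :=
      (hasFDerivAt_id y).sub_const x
    have h2 := ((innerSL ℝ z).hasFDerivAt.comp y (h1.const_smul a⁻¹))
    have h3 := (h1.norm_sq).const_mul (a⁻¹ * a⁻¹ / 2)
    have h4 := h2.sub h3
    have e1 : (fun y => w y z) = (fun y => (innerSL ℝ z) (a⁻¹ • (y - x)) -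
        a⁻¹ * a⁻¹ / 2 * ‖y - x‖ ^ 2) := by
      ext y
      simp only [hw, innerSL_apply_apply, norm_smul, real_inner_comm z, mul_pow, Real.norm_eq_abs,
        sq_abs]
      ring
    rw [e1]
    refine h4.congr_fderiv ?_
    ext v
    simp [hw']
    ring
  have key : HasFDerivAt (fun y => ∫ z, Real.exp (w y z) * φ (x + a • z) ∂(stdGaussian E))
      (∫ z, φ (x + a • z) • (Real.exp (w x z) • w' x z) ∂(stdGaussian E)) x := by
    -- On the ball of radius `|a|` the shift `a⁻¹ • (y - x)` has norm at most 1. Hence the weight is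
    -- at most exp ‖z‖ and its logarithmic derivative at most |a|⁻¹ (‖z‖ + 1) ≤ |a|⁻¹ exp ‖z‖, which
    -- explains the factor 2 in the majorant.
    refine hasFDerivAt_integral_of_dominated_of_fderiv_le (s := Metric.ball x |a|)
      (bound := fun z => M * |a|⁻¹ * Real.exp (2 * ‖z‖))
      (F' := fun y z => φ (x + a • z) • (Real.exp (w y z) • w' y z))
      (Metric.ball_mem_nhds _ (abs_pos.2 ha)) (Eventually.of_forall fun y => ?_) ?_ ?_
      (ae_of_all _ fun z y hy => ?_) ((integrable_exp_mul_norm 2).const_mul _)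
      (ae_of_all _ fun z y hy => ?_)
    · exact (Continuous.aestronglyMeasurable (by fun_prop)).mul
        (aestronglyMeasurable_comp_affine hφ x a)
    · have : ∀ z, w x z = 0 := fun z => by simp [hw]
      simpa [this] using integrable_comp_affine hφ hM x a
    · exact (aestronglyMeasurable_comp_affine hφ x a).smul
        (Continuous.aestronglyMeasurable (by fun_prop))
    · have hy' : ‖y - x‖ ≤ |a| := by
        rw [← dist_eq_norm]; exact (Metric.mem_ball.1 hy).le
      have hn : ‖a⁻¹ • (y - x)‖ ≤ 1 := by
        rw [norm_smul, Real.norm_eq_abs, abs_inv]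
        exact (mul_le_mul_of_nonneg_left hy' hb.le).trans
          (inv_mul_cancel₀ (abs_pos.2 ha).ne').le
      have h1 : w y z ≤ ‖z‖ := by
        have := real_inner_le_norm (a⁻¹ • (y - x)) z
        have h2 : ‖a⁻¹ • (y - x)‖ * ‖z‖ ≤ 1 * ‖z‖ := by gcongr
        have : 0 ≤ ‖a⁻¹ • (y - x)‖ ^ 2 / 2 := by positivity
        simp only [hw]; linarith
      have h2 : ‖w' y z‖ ≤ |a|⁻¹ * (‖z‖ + 1) := by
        have e : w' y z = a⁻¹ • innerSL ℝ z - a⁻¹ • innerSL ℝ (a⁻¹ • (y - x)) := by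
          simp only [hw', map_smul, smul_smul]
        rw [e, ← smul_sub, norm_smul, Real.norm_eq_abs, abs_inv, ← map_sub, innerSL_apply_norm]
        gcongr
        exact (norm_sub_le _ _).trans (by gcongr)
      rw [norm_smul, norm_smul, Real.norm_eq_abs (Real.exp _), abs_of_pos (Real.exp_pos _)]
      calc ‖φ (x + a • z)‖ * (Real.exp (w y z) * ‖w' y z‖)
          ≤ M * (Real.exp ‖z‖ * (|a|⁻¹ * Real.exp ‖z‖)) := by
            gcongr
            · exact hM _
            · exact h2.trans (by gcongr; exact Real.add_one_le_exp _)
        _ = M * |a|⁻¹ * Real.exp (2 * ‖z‖) := by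
            rw [two_mul, Real.exp_add]; ring
    · exact ((hdw z y).exp).mul_const _
  have e : gaussAvg a φ = fun y => ∫ z, Real.exp (w y z) * φ (x + a • z) ∂(stdGaussian E) := by
    ext y; exact gaussAvg_add a ha x y
  rw [e]
  refine key.congr_fderiv ?_
  have hint : Integrable (fun z => a⁻¹ • φ (x + a • z) • z) (stdGaussian E) :=
    (integrable_smul_id hφ hM a x).smul a⁻¹
  rw [gaussMoment, ← integral_smul, ← ContinuousLinearMap.integral_comp_comm (innerSL ℝ) hint]
  refine integral_congr_ae (ae_of_all _ fun z => ?_)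
  ext v
  simp [hw, hw', inner_smul_left]
  ring_nf
  rfl

/-- Variances of independent centred Gaussians add, as seen on characteristic functions. -/
lemma stdGaussian_conv (a b c : ℝ) (h : a ^ 2 + b ^ 2 = c ^ 2) :
    ((stdGaussian E).map (fun z => a • z)) ∗ ((stdGaussian E).map (fun z => b • z)) =
      (stdGaussian E).map (fun z => c • z) := by
  have i : ∀ r : ℝ, IsProbabilityMeasure ((stdGaussian E).map (fun z => r • z)) := fun r =>
    Measure.isProbabilityMeasure_map (by fun_prop)
  have := i a; have := i b; have := i c
  refine Measure.ext_of_charFun ?_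
  ext t
  rw [charFun_conv]
  simp_rw [charFun_map_smul, charFun_stdGaussian]
  rw [← Complex.exp_add]
  congr 1
  simp only [norm_smul, mul_pow, Real.norm_eq_abs, Complex.ofReal_mul]
  simp only [← Complex.ofReal_pow, sq_abs, ← h]
  push_cast
  ring

lemma continuous_gaussAvg {φ : E → ℝ} {M : ℝ} (hφ : Continuous φ) (hM : ∀ x, ‖φ x‖ ≤ M) :
    Continuous (fun q : ℝ × E => gaussAvg q.1 φ q.2) := by
  refine continuous_of_dominated (bound := fun _ => M)
    (fun q => aestronglyMeasurable_comp_affine hφ _ _) (fun q => ae_of_all _ fun z => hM _)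
    (integrable_const M) (ae_of_all _ fun z => ?_)
  exact hφ.comp (by fun_prop)

lemma norm_gaussAvg_le {φ : E → ℝ} {M : ℝ} (a : ℝ) (hM : ∀ x, ‖φ x‖ ≤ M) (x : E) :
    ‖gaussAvg a φ x‖ ≤ M := by
  have := norm_integral_le_of_norm_le_const (μ := stdGaussian E)
    (ae_of_all _ fun z => hM (x + a • z))
  simpa [gaussAvg] using this

/-- Semigroup property of Gaussian averages. -/
lemma gaussAvg_gaussAvg {φ : E → ℝ} {M : ℝ} (hφ : Continuous φ) (hM : ∀ x, ‖φ x‖ ≤ M)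
    {a b c : ℝ} (h : a ^ 2 + b ^ 2 = c ^ 2) (x : E) :
    gaussAvg a (gaussAvg b φ) x = gaussAvg c φ x := by
  have hc : Continuous fun v : E => φ (x + v) := by fun_prop
  have i : ∀ r : ℝ, IsProbabilityMeasure ((stdGaussian E).map (fun z => r • z)) := fun r =>
    Measure.isProbabilityMeasure_map (by fun_prop)
  have := i a; have := i b; have := i c
  have h1 : ∫ v, φ (x + v) ∂((stdGaussian E).map (fun z => c • z)) = gaussAvg c φ x := by
    rw [integral_map (by fun_prop) hc.aestronglyMeasurable]; rfl
  rw [← h1, ← stdGaussian_conv a b c h, integral_conv]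
  · rw [integral_map (by fun_prop)]
    · refine integral_congr_ae (ae_of_all _ fun z => ?_)
      simp only
      rw [integral_map (by fun_prop)]
      · simp only [gaussAvg, add_assoc]
      · exact Continuous.aestronglyMeasurable (by fun_prop)
    · have : Continuous (fun y : E => gaussAvg b φ (x + y)) :=
        (continuous_gaussAvg hφ hM).comp (by fun_prop : Continuous fun y : E => (b, x + y))
      refine this.aestronglyMeasurable.congr (ae_of_all _ fun y => ?_)
      simp only
      rw [integral_map (by fun_prop)]
      · simp only [gaussAvg, add_assoc]
      · exact Continuous.aestronglyMeasurable (by fun_prop)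
  · rw [stdGaussian_conv a b c h]
    exact (integrable_const M).mono' hc.aestronglyMeasurable (ae_of_all _ fun _ => hM _)

end Gaussian

/-! ### The heat equation for Gaussian averages. -/

section Parabolic

open ProbabilityTheory
open scoped RealInnerProductSpace

variable {E : Type*} [NormedAddCommGroup E] [InnerProductSpace ℝ E] [FiniteDimensional ℝ E]
  [MeasurableSpace E] [BorelSpace E]

/-- `A`, `B`, `C` are the (continuous) derivatives of `u` on `I × E`: time derivative, spatial
gradient, and derivative of the spatial gradient. -/
structure HasParabolicDerivs (I : Set ℝ) (u A : ℝ → E → ℝ) (B : ℝ → E → E)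
    (C : ℝ → E → E →L[ℝ] E) : Prop where
  time : ∀ t ∈ I, ∀ x, HasDerivAt (fun s => u s x) (A t x) t
  space : ∀ t ∈ I, ∀ x, HasFDerivAt (u t) (innerSL ℝ (B t x)) x
  space_two : ∀ t ∈ I, ∀ x, HasFDerivAt (B t) (C t x) x
  continuousOn_time : ContinuousOn (fun z : ℝ × E => A z.1 z.2) (I ×ˢ univ)
  continuousOn_space : ContinuousOn (fun z : ℝ × E => B z.1 z.2) (I ×ˢ univ)
  continuousOn_space_two : ContinuousOn (fun z : ℝ × E => C z.1 z.2) (I ×ˢ univ)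

namespace HasParabolicDerivs

variable {I J : Set ℝ} {u u' A A' : ℝ → E → ℝ} {B B' : ℝ → E → E}
  {C C' : ℝ → E → E →L[ℝ] E}

lemma mono (h : HasParabolicDerivs I u A B C) (hJ : J ⊆ I) : HasParabolicDerivs J u A B C where
  time t ht := h.time t (hJ ht)
  space t ht := h.space t (hJ ht)
  space_two t ht := h.space_two t (hJ ht)
  continuousOn_time := h.continuousOn_time.mono (prod_mono_left hJ)
  continuousOn_space := h.continuousOn_space.mono (prod_mono_left hJ)
  continuousOn_space_two := h.continuousOn_space_two.mono (prod_mono_left hJ)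

lemma add (h : HasParabolicDerivs I u A B C) (h' : HasParabolicDerivs I u' A' B' C') :
    HasParabolicDerivs I (fun t x => u t x + u' t x) (fun t x => A t x + A' t x)
      (fun t x => B t x + B' t x) (fun t x => C t x + C' t x) where
  time t ht x := (h.time t ht x).add (h'.time t ht x)
  space t ht x := by
    rw [map_add]
    exact (h.space t ht x).add (h'.space t ht x)
  space_two t ht x := (h.space_two t ht x).add (h'.space_two t ht x)
  continuousOn_time := h.continuousOn_time.add h'.continuousOn_time
  continuousOn_space := h.continuousOn_space.add h'.continuousOn_space
  continuousOn_space_two := h.continuousOn_space_two.add h'.continuousOn_space_two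

lemma congr (h : HasParabolicDerivs I u A B C) (hI : IsOpen I) (hu : ∀ t ∈ I, ∀ x, u' t x = u t x) :
    HasParabolicDerivs I u' A B C where
  time t ht x := (h.time t ht x).congr_of_eventuallyEq
    ((hI.eventually_mem ht).mono fun s hs => hu s hs x)
  space t ht x := by
    rw [show u' t = u t from funext (hu t ht)]
    exact h.space t ht x
  space_two := h.space_two
  continuousOn_time := h.continuousOn_time
  continuousOn_space := h.continuousOn_space
  continuousOn_space_two := h.continuousOn_space_two

lemma shift (h : HasParabolicDerivs I u A B C) (a : ℝ) :
    HasParabolicDerivs ((fun t => t - a) ⁻¹' I) (fun t x => u (t - a) x) (fun t x => A (t - a) x)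
      (fun t x => B (t - a) x) (fun t x => C (t - a) x) := by
  have hc : ContinuousOn (fun z : ℝ × E => (z.1 - a, z.2)) (((fun t => t - a) ⁻¹' I) ×ˢ univ) := by
    fun_prop
  have hm : MapsTo (fun z : ℝ × E => (z.1 - a, z.2)) (((fun t => t - a) ⁻¹' I) ×ˢ univ)
      (I ×ˢ univ) := fun z hz => ⟨hz.1, mem_univ _⟩
  exact
  { time := fun t ht x => (h.time (t - a) ht x).comp_sub_const t a
    space := fun t ht x => h.space (t - a) ht x
    space_two := fun t ht x => h.space_two (t - a) ht x
    continuousOn_time := h.continuousOn_time.comp hc hm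
    continuousOn_space := h.continuousOn_space.comp hc hm
    continuousOn_space_two := h.continuousOn_space_two.comp hc hm }

end HasParabolicDerivs

variable (E) in
/-- The trace of an endomorphism. -/
noncomputable def endTrace : (E →L[ℝ] E) →L[ℝ] ℝ :=
  ∑ i, (innerSL ℝ (stdOrthonormalBasis ℝ E i)).comp
    (ContinuousLinearMap.apply ℝ E (stdOrthonormalBasis ℝ E i))

lemma endTrace_apply (C : E →L[ℝ] E) :
    endTrace E C = ∑ i, ⟪stdOrthonormalBasis ℝ E i, C (stdOrthonormalBasis ℝ E i)⟫ := by
  simp [endTrace]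

lemma endTrace_smulRight (c z : E) :
    endTrace E ((innerSL ℝ c).smulRight z) = ⟪c, z⟫ := by
  rw [endTrace_apply, ← (stdOrthonormalBasis ℝ E).sum_inner_mul_inner c z]
  refine Finset.sum_congr rfl fun i _ => ?_
  simp [inner_smul_right]

section Operators

variable {F H : Type*} [NormedAddCommGroup F] [NormedAddCommGroup H] [NormedSpace ℝ H]

/-- Joint continuity of Gaussian integrals with at most linear weight. -/
lemma continuousOn_integral_gaussian {Λ : F → E → H} (hΛ : Continuous fun q : F × E => Λ q.1 q.2)
    (hΛb : ∀ f z, ‖Λ f z‖ ≤ ‖f‖ * (1 + ‖z‖)) {G : ℝ → E → F} {I : Set ℝ} (hI : IsOpen I)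
    (hG : ContinuousOn (fun q : ℝ × E => G q.1 q.2) (I ×ˢ univ)) {m : ℝ → ℝ}
    (hm : ContinuousOn m I) (hGm : ∀ s ∈ I, ∀ y, ‖G s y‖ ≤ m s) :
    ContinuousOn (fun q : ℝ × ℝ × E => ∫ z, Λ (G q.2.1 (q.2.2 + q.1 • z)) z ∂(stdGaussian E))
      {q | q.2.1 ∈ I} := by
  have hGs : ∀ s ∈ I, Continuous (G s) := fun s hs =>
    continuousOn_univ.1 (hG.comp (by fun_prop : ContinuousOn (fun y : E => (s, y)) univ)
      (fun y _ => ⟨hs, mem_univ _⟩))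
  intro q hq
  refine ContinuousAt.continuousWithinAt ?_
  have hev : ∀ᶠ q' : ℝ × ℝ × E in 𝓝 q, q'.2.1 ∈ I :=
    (hI.preimage (by fun_prop : Continuous fun q' : ℝ × ℝ × E => q'.2.1)).eventually_mem hq
  have hmc : ContinuousAt (fun q' : ℝ × ℝ × E => m q'.2.1) q :=
    ContinuousAt.comp (f := fun q' : ℝ × ℝ × E => q'.2.1) (hm.continuousAt (hI.mem_nhds hq))
      (by fun_prop)
  -- The bound `m` varies with time because it is later applied to gradients of size s^(-1/2); its
  -- continuity supplies a locally uniform constant for dominated convergence.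
  have hev2 : ∀ᶠ q' : ℝ × ℝ × E in 𝓝 q, m q'.2.1 < m q.2.1 + 1 :=
    hmc.eventually (gt_mem_nhds (lt_add_one _))
  refine continuousAt_of_dominated (bound := fun z => (m q.2.1 + 1) * (1 + ‖z‖)) ?_ ?_ ?_ ?_
  · filter_upwards [hev] with q' hq'
    have := hGs _ hq'
    exact (hΛ.comp (by fun_prop : Continuous fun z : E =>
      (G q'.2.1 (q'.2.2 + q'.1 • z), z))).aestronglyMeasurable
  · filter_upwards [hev, hev2] with q' hq' hq2
    refine ae_of_all _ fun z => (hΛb _ _).trans ?_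
    gcongr
    exact (hGm _ hq' _).trans hq2.le
  · exact ((integrable_const 1).add integrable_norm_stdGaussian).const_mul _
  · refine ae_of_all _ fun z => ?_
    have h1 : ContinuousAt (fun q : ℝ × E => G q.1 q.2) (q.2.1, q.2.2 + q.1 • z) :=
      hG.continuousAt ((hI.prod isOpen_univ).mem_nhds ⟨hq, mem_univ _⟩)
    have h2 : ContinuousAt (fun q' : ℝ × ℝ × E => G q'.2.1 (q'.2.2 + q'.1 • z)) q :=
      ContinuousAt.comp (f := fun q' : ℝ × ℝ × E => (q'.2.1, q'.2.2 + q'.1 • z))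
        (g := fun q : ℝ × E => G q.1 q.2) h1 (by fun_prop)
    exact ContinuousAt.comp (f := fun q' : ℝ × ℝ × E => (G q'.2.1 (q'.2.2 + q'.1 • z), z))
      (g := fun q : F × E => Λ q.1 q.2) hΛ.continuousAt (h2.prodMk continuousAt_const)

lemma norm_integral_gaussian_le {Λ : F → E → H} (hΛb : ∀ f z, ‖Λ f z‖ ≤ ‖f‖ * ‖z‖) {G : E → F}
    {M : ℝ} (hM : ∀ y, ‖G y‖ ≤ M) (a : ℝ) (x : E) :
    ‖∫ z, Λ (G (x + a • z)) z ∂(stdGaussian E)‖ ≤ M * gaussianMeanNorm E := by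
  rw [gaussianMeanNorm, ← integral_const_mul]
  refine norm_integral_le_of_norm_le (integrable_norm_stdGaussian.const_mul M)
    (ae_of_all _ fun z => (hΛb _ _).trans ?_)
  gcongr
  exact hM _

end Operators

/-- The derivative in `x` of `gaussMoment a φ`, in terms of `G = ∇φ`. -/
noncomputable def gaussMomentDeriv (a : ℝ) (G : E → E) (x : E) : E →L[ℝ] E :=
  ∫ z, (innerSL ℝ (G (x + a • z))).smulRight z ∂(stdGaussian E)

/-- The trace of `gaussMomentDeriv a G`. -/
noncomputable def gaussDiv (a : ℝ) (G : E → E) (x : E) : ℝ :=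
  ∫ z, ⟪G (x + a • z), z⟫ ∂(stdGaussian E)

lemma continuous_smulRight_innerSL :
    Continuous fun q : E × E => (innerSL ℝ q.1).smulRight q.2 := by
  have : Continuous fun q : E × E =>
      ContinuousLinearMap.smulRightL ℝ E E (innerSL ℝ q.1) q.2 := by fun_prop
  exact this

lemma norm_smulRight_innerSL (c : E) (z : E) :
    ‖(innerSL ℝ c).smulRight z‖ = ‖c‖ * ‖z‖ := by
  rw [ContinuousLinearMap.norm_smulRight_apply, innerSL_apply_norm]

lemma norm_gaussMoment_le {φ : E → ℝ} {M : ℝ} (hM : ∀ y, ‖φ y‖ ≤ M) (a : ℝ) (x : E) :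
    ‖gaussMoment a φ x‖ ≤ M * gaussianMeanNorm E :=
  norm_integral_gaussian_le (Λ := fun (c : ℝ) (z : E) => c • z)
    (fun c z => (norm_smul c z).le) hM a x

lemma norm_gaussMomentDeriv_le {G : E → E} {M : ℝ} (hM : ∀ y, ‖G y‖ ≤ M) (a : ℝ) (x : E) :
    ‖gaussMomentDeriv a G x‖ ≤ M * gaussianMeanNorm E :=
  norm_integral_gaussian_le (Λ := fun c z : E => (innerSL ℝ c).smulRight z)
    (fun c z => (norm_smulRight_innerSL c z).le) hM a x

lemma norm_gaussDiv_le {G : E → E} {M : ℝ} (hM : ∀ y, ‖G y‖ ≤ M) (a : ℝ) (x : E) :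
    ‖gaussDiv a G x‖ ≤ M * gaussianMeanNorm E :=
  norm_integral_gaussian_le (Λ := fun c z : E => ⟪c, z⟫)
    (fun c z => norm_inner_le_norm c z) hM a x

lemma le_mul_one_add {a b : ℝ} (ha : 0 ≤ a) : a * b ≤ a * (1 + b) := by
  gcongr; linarith

section JointContinuity

variable {I : Set ℝ} {m : ℝ → ℝ} (hI : IsOpen I) (hm : ContinuousOn m I)
include hI hm

lemma continuousOn_gaussAvg {g : ℝ → E → ℝ}
    (hg : ContinuousOn (fun q : ℝ × E => g q.1 q.2) (I ×ˢ univ)) (hgm : ∀ s ∈ I, ∀ y, ‖g s y‖ ≤ m s) :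
    ContinuousOn (fun q : ℝ × ℝ × E => gaussAvg q.1 (g q.2.1) q.2.2) {q | q.2.1 ∈ I} :=
  continuousOn_integral_gaussian (Λ := fun c (_ : E) => c) (by fun_prop)
    (fun c z => le_mul_of_one_le_right (norm_nonneg _) (by simp)) hI hg hm hgm

lemma continuousOn_gaussMoment {g : ℝ → E → ℝ}
    (hg : ContinuousOn (fun q : ℝ × E => g q.1 q.2) (I ×ˢ univ)) (hgm : ∀ s ∈ I, ∀ y, ‖g s y‖ ≤ m s) :
    ContinuousOn (fun q : ℝ × ℝ × E => gaussMoment q.1 (g q.2.1) q.2.2) {q | q.2.1 ∈ I} :=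
  continuousOn_integral_gaussian (Λ := fun (c : ℝ) (z : E) => c • z) (by fun_prop)
    (fun c z => (norm_smul c z).le.trans (le_mul_one_add (norm_nonneg _))) hI hg hm hgm

lemma continuousOn_gaussMomentDeriv {G : ℝ → E → E}
    (hg : ContinuousOn (fun q : ℝ × E => G q.1 q.2) (I ×ˢ univ)) (hgm : ∀ s ∈ I, ∀ y, ‖G s y‖ ≤ m s) :
    ContinuousOn (fun q : ℝ × ℝ × E => gaussMomentDeriv q.1 (G q.2.1) q.2.2) {q | q.2.1 ∈ I} :=
  continuousOn_integral_gaussian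
    (Λ := fun c z : E => (innerSL ℝ c).smulRight z)
    continuous_smulRight_innerSL
    (fun c z => (norm_smulRight_innerSL c z).le.trans (le_mul_one_add (norm_nonneg _))) hI hg hm hgm

lemma continuousOn_gaussDiv {G : ℝ → E → E}
    (hg : ContinuousOn (fun q : ℝ × E => G q.1 q.2) (I ×ˢ univ)) (hgm : ∀ s ∈ I, ∀ y, ‖G s y‖ ≤ m s) :
    ContinuousOn (fun q : ℝ × ℝ × E => gaussDiv q.1 (G q.2.1) q.2.2) {q | q.2.1 ∈ I} :=
  continuousOn_integral_gaussian
    (Λ := fun c z : E => ⟪c, z⟫) (by fun_prop)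
    (fun c z => (norm_inner_le_norm c z).trans (le_mul_one_add (norm_nonneg _))) hI hg hm hgm

end JointContinuity

lemma continuous_gaussMoment {φ : E → ℝ} {M : ℝ} (hφ : Continuous φ) (hM : ∀ x, ‖φ x‖ ≤ M) :
    Continuous (fun q : ℝ × E => gaussMoment q.1 φ q.2) := by
  have h := continuousOn_gaussMoment (g := fun _ => φ) (m := fun _ => M) (I := univ) isOpen_univ
    continuousOn_const (hφ.comp continuous_snd).continuousOn (fun _ _ => hM)
  simp only [mem_univ, ofPred_true] at h
  exact (continuousOn_univ.1 h).comp (g := fun q : ℝ × ℝ × E => gaussMoment q.1 φ q.2.2)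
    (by fun_prop : Continuous fun q : ℝ × E => (q.1, (0 : ℝ), q.2))

lemma continuous_gaussMomentDeriv {G : E → E} {L : ℝ} (hG : Continuous G) (hL : ∀ x, ‖G x‖ ≤ L) :
    Continuous (fun q : ℝ × E => gaussMomentDeriv q.1 G q.2) := by
  have h := continuousOn_gaussMomentDeriv (G := fun _ => G) (m := fun _ => L) (I := univ)
    isOpen_univ continuousOn_const (hG.comp continuous_snd).continuousOn (fun _ _ => hL)
  simp only [mem_univ, ofPred_true] at h
  exact (continuousOn_univ.1 h).comp (g := fun q : ℝ × ℝ × E => gaussMomentDeriv q.1 G q.2.2)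
    (by fun_prop : Continuous fun q : ℝ × E => (q.1, (0 : ℝ), q.2))

section SmoothData

variable {φ : E → ℝ} {G : E → E} {L : ℝ}

lemma integrable_smulRight (hG : Continuous G) (hL : ∀ x, ‖G x‖ ≤ L) (a : ℝ) (x : E) :
    Integrable (fun z => (innerSL ℝ (G (x + a • z))).smulRight z) (stdGaussian E) := by
  refine (integrable_norm_stdGaussian.const_mul L).mono' ?_ (ae_of_all _ fun z => ?_)
  · exact (continuous_smulRight_innerSL.comp
      (by fun_prop : Continuous fun z : E => (G (x + a • z), z))).aestronglyMeasurable
  · rw [norm_smulRight_innerSL]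
    gcongr
    exact hL _

lemma endTrace_gaussMomentDeriv (hG : Continuous G) (hL : ∀ x, ‖G x‖ ≤ L) (a : ℝ) (x : E) :
    endTrace E (gaussMomentDeriv a G x) = gaussDiv a G x := by
  rw [gaussMomentDeriv, ← ContinuousLinearMap.integral_comp_comm _ (integrable_smulRight hG hL a x)]
  simp_rw [endTrace_smulRight]
  rfl

/-- The derivative falls on `φ` rather than on the Gaussian, so no second factor `a⁻¹` appears. The
Hessian of the heat flow then costs only one power of `a⁻¹`, which keeps it integrable in time. -/
lemma hasFDerivAt_gaussMoment {M : ℝ} (hφ : Continuous φ) (hM : ∀ x, ‖φ x‖ ≤ M)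
    (hφG : ∀ x, HasFDerivAt φ (innerSL ℝ (G x)) x) (hG : Continuous G) (hL : ∀ x, ‖G x‖ ≤ L) (a : ℝ) (x : E) :
    HasFDerivAt (gaussMoment a φ) (gaussMomentDeriv a G x) x := by
  refine hasFDerivAt_integral_of_dominated_of_fderiv_le (s := univ)
    (bound := fun z => L * ‖z‖)
    (F' := fun y z => (innerSL ℝ (G (y + a • z))).smulRight z)
    univ_mem (Eventually.of_forall fun y => ?_) ?_ ?_
    (ae_of_all _ fun z y _ => ?_) (integrable_norm_stdGaussian.const_mul _)
    (ae_of_all _ fun z y _ => ?_)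
  · exact Continuous.aestronglyMeasurable (by fun_prop)
  · exact integrable_smul_id hφ hM a x
  · exact (integrable_smulRight hG hL a x).aestronglyMeasurable
  · rw [norm_smulRight_innerSL]
    gcongr
    exact hL _
  · have h1 : HasFDerivAt (fun y => φ (y + a • z)) (innerSL ℝ (G (y + a • z))) y :=
      (hasFDerivAt_comp_add_right (a • z)).2 (hφG (y + a • z))
    exact h1.smul_const z

lemma hasDerivAt_sqrt_two_mul {t : ℝ} (ht : 0 < t) :
    HasDerivAt (fun t => √(2 * t)) (√(2 * t))⁻¹ t := by
  have h := ((hasDerivAt_id t).const_mul 2).sqrt (by simpa using ht.ne')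
  refine h.congr_deriv ?_
  simp only [id, mul_one]
  have : √(2 * t) ≠ 0 := by positivity
  field_simp

/-- Time derivative of the heat semigroup on bounded `C¹` data. -/
lemma hasDerivAt_gaussAvg_sqrt {M : ℝ} (hφ : Continuous φ) (hM : ∀ x, ‖φ x‖ ≤ M)
    (hφG : ∀ x, HasFDerivAt φ (innerSL ℝ (G x)) x) (hG : Continuous G) (hL : ∀ x, ‖G x‖ ≤ L) (x : E)
    {t : ℝ} (ht : 0 < t) :
    HasDerivAt (fun t => gaussAvg √(2 * t) φ x) ((√(2 * t))⁻¹ * gaussDiv √(2 * t) G x) t := by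
  -- For `s > t / 2` the factor `(√(2 * s))⁻¹` stays below `(√t)⁻¹`.
  have hpos : ∀ s ∈ Ioi (t / 2), 0 < s := fun s hs => (half_pos ht).trans hs
  have key := hasDerivAt_integral_of_dominated_loc_of_deriv_le (μ := stdGaussian E) (s := Ioi (t / 2))
    (F := fun s z => φ (x + √(2 * s) • z))
    (F' := fun s z => (√(2 * s))⁻¹ * ⟪G (x + √(2 * s) • z), z⟫) (x₀ := t)
    (bound := fun z => (√t)⁻¹ * (L * ‖z‖)) (Ioi_mem_nhds (half_lt_self ht))
    (Eventually.of_forall fun s => aestronglyMeasurable_comp_affine hφ _ _)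
    (integrable_comp_affine hφ hM _ _) (Continuous.aestronglyMeasurable (by fun_prop))
    (ae_of_all _ fun z s hs => ?_)
    ((integrable_norm_stdGaussian.const_mul L).const_mul _) (ae_of_all _ fun z s hs => ?_)
  · have := key.2
    rw [integral_const_mul] at this
    exact this
  · have h0 := hpos s hs
    rw [norm_mul, norm_inv, Real.norm_eq_abs, abs_of_nonneg (Real.sqrt_nonneg _)]
    have : t ≤ 2 * s := by have := mem_Ioi.1 hs; linarith
    gcongr
    exact (norm_inner_le_norm _ z).trans (by gcongr; exact hL _)
  · have h1 : HasDerivAt (fun s => x + √(2 * s) • z) ((√(2 * s))⁻¹ • z) s :=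
      ((hasDerivAt_sqrt_two_mul (hpos s hs)).smul_const z).const_add x
    have h2 := (hφG (x + √(2 * s) • z)).comp_hasDerivAt s h1
    refine h2.congr_deriv ?_
    simp

/-- The heat equation for bounded `C¹` data. -/
lemma hasParabolicDerivs_gaussAvg_of_smooth {M : ℝ} (hφ : Continuous φ) (hM : ∀ x, ‖φ x‖ ≤ M)
    (hφG : ∀ x, HasFDerivAt φ (innerSL ℝ (G x)) x) (hG : Continuous G) (hL : ∀ x, ‖G x‖ ≤ L) :
    HasParabolicDerivs (Ioi 0) (fun t => gaussAvg √(2 * t) φ)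
      (fun t x => endTrace E ((√(2 * t))⁻¹ • gaussMomentDeriv √(2 * t) G x))
      (fun t x => (√(2 * t))⁻¹ • gaussMoment √(2 * t) φ x)
      (fun t x => (√(2 * t))⁻¹ • gaussMomentDeriv √(2 * t) G x) := by
  have hs : ContinuousOn (fun z : ℝ × E => (√(2 * z.1))⁻¹) (Ioi 0 ×ˢ univ) := by
    refine ContinuousOn.inv₀ (by fun_prop) fun z hz => ?_
    have : 0 < z.1 := hz.1
    positivity
  have hc : Continuous (fun z : ℝ × E => (√(2 * z.1), z.2)) := by fun_prop
  have h1 : ContinuousOn (fun z : ℝ × E => gaussMoment √(2 * z.1) φ z.2) (Ioi 0 ×ˢ univ) :=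
    ((continuous_gaussMoment hφ hM).comp hc).continuousOn
  have h2 : ContinuousOn (fun z : ℝ × E => gaussMomentDeriv √(2 * z.1) G z.2) (Ioi 0 ×ˢ univ) :=
    ((continuous_gaussMomentDeriv hG hL).comp hc).continuousOn
  refine ⟨fun t ht x => ?_, fun t ht x => ?_, fun t ht x => ?_, ?_, hs.smul h1, hs.smul h2⟩
  · rw [map_smul, endTrace_gaussMomentDeriv hG hL, smul_eq_mul]
    exact hasDerivAt_gaussAvg_sqrt hφ hM hφG hG hL x ht
  · have : 0 < t := ht
    exact hasFDerivAt_gaussAvg (by positivity) hφ hM x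
  · exact (hasFDerivAt_gaussMoment hφ hM hφG hG hL √(2 * t) x).fun_const_smul _
  · exact (endTrace E).continuous.comp_continuousOn (hs.smul h2)

end SmoothData

/-- The heat equation for bounded continuous data, away from the initial time. -/
lemma exists_hasParabolicDerivs_gaussAvg {φ : E → ℝ} {M : ℝ} (hφ : Continuous φ)
    (hM : ∀ x, ‖φ x‖ ≤ M) {ε : ℝ} (hε : 0 < ε) :
    ∃ B C, HasParabolicDerivs (Ioi ε) (fun t => gaussAvg √(2 * t) φ)
      (fun t x => endTrace E (C t x)) B C := by
  have hε' : √(2 * ε) ≠ 0 := by positivity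
  -- After time `ε` the flow is C¹ with bounded gradient. The smooth case applies to it as a new
  -- datum, and the semigroup property identifies the restarted flow with the original one.
  have hψ : Continuous (gaussAvg √(2 * ε) φ) :=
    (continuous_gaussAvg hφ hM).comp (by fun_prop : Continuous fun x : E => (√(2 * ε), x))
  have hG : Continuous fun x => (√(2 * ε))⁻¹ • gaussMoment √(2 * ε) φ x := by
    have h1 : Continuous (gaussMoment √(2 * ε) φ) :=
      (continuous_gaussMoment hφ hM).comp (by fun_prop : Continuous fun x : E => (√(2 * ε), x))
    exact h1.fun_const_smul _
  have hL : ∀ x, ‖(√(2 * ε))⁻¹ • gaussMoment √(2 * ε) φ x‖ ≤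
      ‖(√(2 * ε))⁻¹‖ * (M * gaussianMeanNorm E) := fun x => by
    rw [norm_smul]
    gcongr
    exact norm_gaussMoment_le hM _ _
  have h := (hasParabolicDerivs_gaussAvg_of_smooth hψ (norm_gaussAvg_le _ hM)
    (fun x => hasFDerivAt_gaussAvg hε' hφ hM x) hG hL).shift ε
  have hI : (fun t => t - ε) ⁻¹' Ioi 0 = Ioi ε := by ext; simp
  rw [hI] at h
  refine ⟨_, _, h.congr isOpen_Ioi fun t ht x => ?_⟩
  have : 0 < t - ε := sub_pos.2 ht
  exact (gaussAvg_gaussAvg hφ hM (by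
    rw [Real.sq_sqrt (by linarith), Real.sq_sqrt (by linarith), Real.sq_sqrt (by linarith)]
    ring) x).symm

end Parabolic

/-! ### Duhamel integrals: bounds and spatial derivatives. -/

section Duhamel

open ProbabilityTheory
open scoped RealInnerProductSpace

variable {E : Type*} [NormedAddCommGroup E] [InnerProductSpace ℝ E] [FiniteDimensional ℝ E]
  [MeasurableSpace E] [BorelSpace E]

lemma integrableOn_inv_sqrt (a : ℝ) : IntegrableOn (fun σ : ℝ => (√σ)⁻¹) (Ioo 0 a) := by
  rcases le_total a 0 with h | h
  · simp [Ioo_eq_empty_of_le h]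
  have h1 : IntervalIntegrable (fun σ : ℝ => σ ^ (-(1 / 2) : ℝ)) volume 0 a :=
    intervalIntegral.intervalIntegrable_rpow' (by norm_num)
  have h2 := ((intervalIntegrable_iff_integrableOn_Ioc_of_le h).1 h1).mono_set Ioo_subset_Ioc_self
  refine h2.congr_fun (fun σ hσ => ?_) measurableSet_Ioo
  simp only
  rw [Real.rpow_neg hσ.1.le, Real.sqrt_eq_rpow]

lemma integrableOn_inv_sqrt_sub (s t : ℝ) : IntegrableOn (fun τ : ℝ => (√(τ - s))⁻¹) (Ioo s t) := by
  have h := (integrableOn_inv_sqrt (t - s)).integrable_indicator measurableSet_Ioo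
  have h2 := h.comp_sub_right s
  rw [← integrable_indicator_iff measurableSet_Ioo]
  refine h2.congr (ae_of_all _ fun τ => ?_)
  simp only [indicator, mem_Ioo, sub_pos, sub_lt_sub_iff_right]

/-- An integrable majorant of the time singularities in Duhamel integrals. -/
noncomputable def timeKernel (σ : ℝ) : ℝ := (√σ)⁻¹ + (√(1 - σ))⁻¹

lemma timeKernel_nonneg (σ : ℝ) : 0 ≤ timeKernel σ := by unfold timeKernel; positivity

lemma integrableOn_timeKernel : IntegrableOn timeKernel (Ioo 0 1) := by
  refine (integrableOn_inv_sqrt 1).add ?_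
  have h := ((integrableOn_inv_sqrt 1).integrable_indicator measurableSet_Ioo).comp_sub_left 1
  rw [← integrable_indicator_iff measurableSet_Ioo]
  refine h.congr (ae_of_all _ fun τ => ?_)
  simp only [indicator, mem_Ioo, sub_pos, sub_lt_self_iff]
  simp only [and_comm]

/-- The total mass of `timeKernel`. -/
noncomputable def timeKernelMass : ℝ := ∫ σ in Ioo (0 : ℝ) 1, timeKernel σ

lemma timeKernelMass_nonneg : 0 ≤ timeKernelMass := integral_nonneg fun _ => timeKernel_nonneg _

lemma inv_sqrt_le_timeKernel {t σ : ℝ} (ht : 0 < t) (hσ : σ ∈ Ioo (0 : ℝ) 1) :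
    (√(2 * (t * (1 - σ))))⁻¹ ≤ (√t)⁻¹ * timeKernel σ := by
  have h1 : 0 < 1 - σ := sub_pos.2 hσ.2
  have h2 : (√(2 * (t * (1 - σ))))⁻¹ ≤ (√t)⁻¹ * (√(1 - σ))⁻¹ := by
    rw [← mul_inv, ← Real.sqrt_mul ht.le]
    have : 0 < t * (1 - σ) := by positivity
    exact inv_anti₀ (by positivity) (Real.sqrt_le_sqrt (by linarith))
  refine h2.trans ?_
  gcongr
  unfold timeKernel
  have : 0 ≤ (√σ)⁻¹ := by positivity
  linarith

lemma inv_sqrt_mul_inv_sqrt_le_timeKernel {t σ : ℝ} (ht : 0 < t) (hσ : σ ∈ Ioo (0 : ℝ) 1) :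
    (√(2 * (t * (1 - σ))))⁻¹ * (√(t * σ))⁻¹ ≤ t⁻¹ * timeKernel σ := by
  have h1 : 0 < 1 - σ := sub_pos.2 hσ.2
  have h0 : 0 < σ := hσ.1
  have e1 : (√(2 * (t * (1 - σ))))⁻¹ ≤ (√t)⁻¹ * (√(1 - σ))⁻¹ := by
    rw [← mul_inv, ← Real.sqrt_mul ht.le]
    have : 0 < t * (1 - σ) := by positivity
    exact inv_anti₀ (by positivity) (Real.sqrt_le_sqrt (by linarith))
  have e2 : (√(t * σ))⁻¹ = (√t)⁻¹ * (√σ)⁻¹ := by rw [Real.sqrt_mul ht.le, mul_inv]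
  have e3 : (√(1 - σ))⁻¹ * (√σ)⁻¹ ≤ timeKernel σ := by
    have ha : 0 < √σ := Real.sqrt_pos.2 h0
    have hb : 0 < √(1 - σ) := Real.sqrt_pos.2 h1
    have ha2 := Real.sq_sqrt h0.le
    have hb2 := Real.sq_sqrt h1.le
    -- The last factor is at least 1, because the squares of its two terms sum to 1.
    have : timeKernel σ = (√(1 - σ))⁻¹ * (√σ)⁻¹ * (√σ + √(1 - σ)) := by
      unfold timeKernel; field_simp; ring
    rw [this]
    refine le_mul_of_one_le_right (by positivity) ?_
    nlinarith [mul_pos ha hb]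
  rw [e2]
  calc (√(2 * (t * (1 - σ))))⁻¹ * ((√t)⁻¹ * (√σ)⁻¹)
      ≤ ((√t)⁻¹ * (√(1 - σ))⁻¹) * ((√t)⁻¹ * (√σ)⁻¹) := by gcongr
    _ = ((√t) * √t)⁻¹ * ((√(1 - σ))⁻¹ * (√σ)⁻¹) := by rw [mul_inv]; ring
    _ ≤ t⁻¹ * timeKernel σ := by
      rw [Real.mul_self_sqrt ht.le]; gcongr

/-- The Duhamel integral `∫₀ᵗ e^{(t-s)Δ} g(s) ds`, rescaled to the unit interval. -/
noncomputable def duhamel (g : ℝ → E → ℝ) (t : ℝ) (x : E) : ℝ :=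
  t * ∫ σ in Ioo (0 : ℝ) 1, gaussAvg √(2 * (t * (1 - σ))) (g (t * σ)) x

/-- The spatial gradient of `duhamel g`. -/
noncomputable def duhamelGrad (g : ℝ → E → ℝ) (t : ℝ) (x : E) : E :=
  t • ∫ σ in Ioo (0 : ℝ) 1, (√(2 * (t * (1 - σ))))⁻¹ •
    gaussMoment √(2 * (t * (1 - σ))) (g (t * σ)) x

/-- The spatial Hessian of `duhamel g`, in terms of `G = ∇g`. -/
noncomputable def duhamelHess (G : ℝ → E → E) (t : ℝ) (x : E) : E →L[ℝ] E :=
  t • ∫ σ in Ioo (0 : ℝ) 1, (√(2 * (t * (1 - σ))))⁻¹ •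
    gaussMomentDeriv √(2 * (t * (1 - σ))) (G (t * σ)) x

lemma norm_duhamel_le {g : ℝ → E → ℝ} {M : ℝ} (hM : ∀ s x, ‖g s x‖ ≤ M) {t : ℝ} (ht : 0 ≤ t) (x : E) :
    ‖duhamel g t x‖ ≤ t * M := by
  rw [duhamel, norm_mul, Real.norm_of_nonneg ht]
  gcongr
  have := norm_setIntegral_le_of_norm_le_const (μ := volume) (s := Ioo (0 : ℝ) 1)
    (f := fun σ => gaussAvg √(2 * (t * (1 - σ))) (g (t * σ)) x) (C := M) (by simp)
    (fun σ _ => norm_gaussAvg_le _ (hM _) _)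
  simpa using this

section BoundedSource

variable {g : ℝ → E → ℝ} {M : ℝ} (hg : Continuous fun q : ℝ × E => g q.1 q.2)
  (hM : ∀ s x, ‖g s x‖ ≤ M)
include hg hM

lemma continuous_gaussAvg_family :
    Continuous fun q : ℝ × ℝ × E => gaussAvg q.1 (g q.2.1) q.2.2 := by
  have h := continuousOn_gaussAvg (g := g) (m := fun _ => M) (I := univ) isOpen_univ
    continuousOn_const hg.continuousOn (fun s _ => hM s)
  simp only [mem_univ, ofPred_true] at h
  exact continuousOn_univ.1 h

lemma continuous_gaussMoment_family :
    Continuous fun q : ℝ × ℝ × E => gaussMoment q.1 (g q.2.1) q.2.2 := by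
  have h := continuousOn_gaussMoment (g := g) (m := fun _ => M) (I := univ) isOpen_univ
    continuousOn_const hg.continuousOn (fun s _ => hM s)
  simp only [mem_univ, ofPred_true] at h
  exact continuousOn_univ.1 h

lemma continuous_duhamel_integrand :
    Continuous fun q : ℝ × ℝ × E => gaussAvg √(2 * (q.2.1 * (1 - q.1))) (g (q.2.1 * q.1)) q.2.2 :=
  (continuous_gaussAvg_family hg hM).comp (by fun_prop : Continuous fun q : ℝ × ℝ × E =>
    (√(2 * (q.2.1 * (1 - q.1))), q.2.1 * q.1, q.2.2))

lemma integrableOn_duhamel_integrand (t : ℝ) (x : E) :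
    IntegrableOn (fun σ => gaussAvg √(2 * (t * (1 - σ))) (g (t * σ)) x) (Ioo (0 : ℝ) 1) := by
  refine (integrable_const M).mono' (Continuous.aestronglyMeasurable ?_)
    (ae_of_all _ fun σ => norm_gaussAvg_le _ (hM _) _)
  exact (continuous_duhamel_integrand hg hM).comp (by fun_prop : Continuous fun σ : ℝ => (σ, t, x))

/-- Rescaling to the fixed interval (0, 1) removes the moving endpoint: the integrand is jointly
continuous in (t, x) and bounded by `M`. -/
lemma continuous_duhamel : Continuous fun q : ℝ × E => duhamel g q.1 q.2 := by
  refine continuous_fst.mul (continuous_of_dominated (bound := fun _ => M) (fun q => ?_)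
    (fun q => ae_of_all _ fun σ => norm_gaussAvg_le _ (hM _) _) (integrable_const M)
    (ae_of_all _ fun σ => ?_))
  · exact (integrableOn_duhamel_integrand hg hM q.1 q.2).aestronglyMeasurable
  · exact (continuous_duhamel_integrand hg hM).comp
      (by fun_prop : Continuous fun q : ℝ × E => (σ, q.1, q.2))

lemma gaussAvg_sub {g' : ℝ → E → ℝ} {M' : ℝ} (hg' : Continuous fun q : ℝ × E => g' q.1 q.2)
    (hM' : ∀ s x, ‖g' s x‖ ≤ M') (a s : ℝ) (x : E) :
    gaussAvg a (g s) x - gaussAvg a (g' s) x = gaussAvg a (fun y => g s y - g' s y) x := by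
  refine (integral_sub (integrable_comp_affine ?_ (hM s) x a)
    (integrable_comp_affine ?_ (hM' s) x a)).symm
  · exact hg.comp (by fun_prop : Continuous fun y : E => (s, y))
  · exact hg'.comp (by fun_prop : Continuous fun y : E => (s, y))

lemma norm_duhamel_sub_le {g' : ℝ → E → ℝ} {M' D : ℝ}
    (hg' : Continuous fun q : ℝ × E => g' q.1 q.2)
    (hM' : ∀ s x, ‖g' s x‖ ≤ M') (hD : ∀ s x, ‖g s x - g' s x‖ ≤ D) {t : ℝ} (ht : 0 ≤ t) (x : E) :
    ‖duhamel g t x - duhamel g' t x‖ ≤ t * D := by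
  have : duhamel g t x - duhamel g' t x = duhamel (fun s y => g s y - g' s y) t x := by
    unfold duhamel
    rw [← mul_sub, ← integral_sub (integrableOn_duhamel_integrand hg hM t x)
      (integrableOn_duhamel_integrand hg' hM' t x)]
    simp_rw [gaussAvg_sub hg hM hg' hM']
  rw [this]
  exact norm_duhamel_le hD ht x

/-- A spatial derivative costs one inverse power of the Gaussian scale √(2t(1 - σ)), an integrable
singularity at σ = 1. -/
lemma norm_grad_integrand_le {t σ : ℝ} (ht : 0 < t) (hσ : σ ∈ Ioo (0 : ℝ) 1) (x : E) :
    ‖(√(2 * (t * (1 - σ))))⁻¹ • gaussMoment √(2 * (t * (1 - σ))) (g (t * σ)) x‖ ≤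
      (√t)⁻¹ * timeKernel σ * (M * gaussianMeanNorm E) := by
  rw [norm_smul, norm_inv, Real.norm_of_nonneg (Real.sqrt_nonneg _)]
  have := timeKernel_nonneg σ
  exact mul_le_mul (inv_sqrt_le_timeKernel ht hσ) (norm_gaussMoment_le (hM _) _ _) (norm_nonneg _)
    (by positivity)

lemma continuousOn_grad_integrand :
    ContinuousOn (fun q : ℝ × ℝ × E => (√(2 * (q.2.1 * (1 - q.1))))⁻¹ •
      gaussMoment √(2 * (q.2.1 * (1 - q.1))) (g (q.2.1 * q.1)) q.2.2)
      (Ioo 0 1 ×ˢ (Ioi 0 ×ˢ univ)) := by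
  refine ContinuousOn.smul (ContinuousOn.inv₀ (by fun_prop) fun q hq => ?_) ?_
  · have h1 : 0 < 1 - q.1 := sub_pos.2 hq.1.2
    have h2 : 0 < q.2.1 := hq.2.1
    positivity
  · exact ((continuous_gaussMoment_family hg hM).comp (by fun_prop : Continuous fun q : ℝ × ℝ × E =>
      (√(2 * (q.2.1 * (1 - q.1))), q.2.1 * q.1, q.2.2))).continuousOn

lemma aestronglyMeasurable_grad_integrand {t : ℝ} (ht : 0 < t) (x : E) :
    AEStronglyMeasurable (fun σ => (√(2 * (t * (1 - σ))))⁻¹ •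
      gaussMoment √(2 * (t * (1 - σ))) (g (t * σ)) x) (volume.restrict (Ioo 0 1)) :=
  ((continuousOn_grad_integrand hg hM).comp
    (by fun_prop : ContinuousOn (fun σ : ℝ => (σ, t, x)) (Ioo 0 1))
    (fun _ hσ => ⟨hσ, ht, mem_univ _⟩)).aestronglyMeasurable measurableSet_Ioo

lemma integrableOn_grad_integrand {t : ℝ} (ht : 0 < t) (x : E) :
    IntegrableOn (fun σ => (√(2 * (t * (1 - σ))))⁻¹ •
      gaussMoment √(2 * (t * (1 - σ))) (g (t * σ)) x) (Ioo 0 1) :=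
  ((integrableOn_timeKernel.const_mul (√t)⁻¹).mul_const (M * gaussianMeanNorm E)).mono'
    (aestronglyMeasurable_grad_integrand hg hM ht x)
    ((ae_restrict_iff' measurableSet_Ioo).2
      (ae_of_all _ fun _ hσ => norm_grad_integrand_le hg hM ht hσ x))

lemma norm_duhamelGrad_le {t : ℝ} (ht : 0 < t) (x : E) :
    ‖duhamelGrad g t x‖ ≤ √t * timeKernelMass * (M * gaussianMeanNorm E) := by
  have h := norm_integral_le_of_norm_le
    ((integrableOn_timeKernel.const_mul (√t)⁻¹).mul_const (M * gaussianMeanNorm E))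
    ((ae_restrict_iff' measurableSet_Ioo).2
      (ae_of_all _ fun _ hσ => norm_grad_integrand_le hg hM ht hσ x))
  rw [integral_mul_const, integral_const_mul] at h
  rw [duhamelGrad, norm_smul, Real.norm_of_nonneg ht.le]
  refine (mul_le_mul_of_nonneg_left h ht.le).trans (le_of_eq ?_)
  have : t * (√t)⁻¹ = √t := by rw [← div_eq_mul_inv, Real.div_sqrt]
  rw [timeKernelMass]
  linear_combination (∫ σ in Ioo (0 : ℝ) 1, timeKernel σ) * (M * gaussianMeanNorm E) * this

lemma hasFDerivAt_duhamel {t : ℝ} (ht : 0 < t) (x : E) :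
    HasFDerivAt (duhamel g t) (innerSL ℝ (duhamelGrad g t x)) x := by
  have hgs : ∀ s, Continuous (g s) := fun s =>
    hg.comp (by fun_prop : Continuous fun y : E => (s, y))
  have key := hasFDerivAt_integral_of_dominated_of_fderiv_le (μ := volume.restrict (Ioo (0 : ℝ) 1))
    (F := fun y σ => gaussAvg √(2 * (t * (1 - σ))) (g (t * σ)) y)
    (F' := fun y σ => innerSL ℝ ((√(2 * (t * (1 - σ))))⁻¹ •
      gaussMoment √(2 * (t * (1 - σ))) (g (t * σ)) y)) (x₀ := x) (s := univ)
    (bound := fun σ => (√t)⁻¹ * timeKernel σ * (M * gaussianMeanNorm E)) univ_mem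
    (Eventually.of_forall fun y => (integrableOn_duhamel_integrand hg hM t y).aestronglyMeasurable)
    (integrableOn_duhamel_integrand hg hM t x)
    ((innerSL ℝ).continuous.comp_aestronglyMeasurable
      (aestronglyMeasurable_grad_integrand hg hM ht x))
    ((ae_restrict_iff' measurableSet_Ioo).2 (ae_of_all _ fun σ hσ y _ => by
      rw [innerSL_apply_norm]
      exact norm_grad_integrand_le hg hM ht hσ y))
    ((integrableOn_timeKernel.const_mul (√t)⁻¹).mul_const (M * gaussianMeanNorm E))
    ((ae_restrict_iff' measurableSet_Ioo).2 (ae_of_all _ fun σ hσ y _ => by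
      have h1 : 0 < 1 - σ := sub_pos.2 hσ.2
      exact hasFDerivAt_gaussAvg (by positivity) (hgs _) (hM _) y))
  refine (key.const_mul t).congr_fderiv ?_
  have hint := integrableOn_grad_integrand hg hM ht x
  rw [duhamelGrad, ContinuousLinearMap.integral_comp_comm (innerSL ℝ) hint]
  exact (map_smul (innerSL ℝ (E := E)) t _).symm

lemma continuousOn_duhamelGrad :
    ContinuousOn (fun q : ℝ × E => duhamelGrad g q.1 q.2) (Ioi 0 ×ˢ univ) := by
  intro q hq
  have hq1 : 0 < q.1 := hq.1
  refine ContinuousAt.continuousWithinAt ?_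
  have hev : ∀ᶠ q' : ℝ × E in 𝓝 q, q.1 / 2 < q'.1 :=
    continuous_fst.continuousAt.eventually (lt_mem_nhds (half_lt_self hq1))
  refine continuousAt_fst.smul (continuousAt_of_dominated
    (bound := fun σ => (√(q.1 / 2))⁻¹ * timeKernel σ * (M * gaussianMeanNorm E)) ?_ ?_
    ((integrableOn_timeKernel.const_mul _).mul_const _) ?_)
  · filter_upwards [hev] with q' hq'
    exact aestronglyMeasurable_grad_integrand hg hM ((half_pos hq1).trans hq') q'.2
  · filter_upwards [hev] with q' hq'
    refine (ae_restrict_iff' measurableSet_Ioo).2 (ae_of_all _ fun σ hσ => ?_)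
    refine (norm_grad_integrand_le hg hM ((half_pos hq1).trans hq') hσ q'.2).trans ?_
    have := timeKernel_nonneg σ
    have := gaussianMeanNorm_nonneg (E := E)
    have : 0 ≤ M := (norm_nonneg _).trans (hM 0 q.2)
    gcongr
  · refine (ae_restrict_iff' measurableSet_Ioo).2 (ae_of_all _ fun σ hσ => ?_)
    have h := (continuousOn_grad_integrand hg hM).continuousAt (x := (σ, q.1, q.2))
      ((isOpen_Ioo.prod (isOpen_Ioi.prod isOpen_univ)).mem_nhds ⟨hσ, hq1, mem_univ _⟩)
    exact ContinuousAt.comp (f := fun q : ℝ × E => (σ, q.1, q.2)) h (by fun_prop)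

end BoundedSource

section SmoothSource

variable {g : ℝ → E → ℝ} {M : ℝ} (hg : Continuous fun q : ℝ × E => g q.1 q.2)
  (hM : ∀ s x, ‖g s x‖ ≤ M)
  {G : ℝ → E → E} {δ L : ℝ} (hG : ContinuousOn (fun q : ℝ × E => G q.1 q.2) (Ioo 0 δ ×ˢ univ))
  (hgG : ∀ s ∈ Ioo 0 δ, ∀ x, HasFDerivAt (g s) (innerSL ℝ (G s x)) x)
  (hL : ∀ s ∈ Ioo 0 δ, ∀ x, ‖G s x‖ ≤ L * (√s)⁻¹)

lemma mul_mem_Ioo {t σ δ : ℝ} (ht : t ∈ Ioo 0 δ) (hσ : σ ∈ Ioo (0 : ℝ) 1) : t * σ ∈ Ioo 0 δ :=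
  ⟨mul_pos ht.1 hσ.1, (mul_lt_of_lt_one_right ht.1 hσ.2).trans ht.2⟩

include hL in
lemma nonneg_of_bound_inv_sqrt {t : ℝ} (ht : t ∈ Ioo 0 δ) (x : E) : 0 ≤ L := by
  have h := (norm_nonneg _).trans (hL t ht x)
  have h2 : 0 < (√t)⁻¹ := inv_pos.2 (Real.sqrt_pos.2 ht.1)
  exact nonneg_of_mul_nonneg_left h h2

include hG in
lemma continuous_slice {s : ℝ} (hs : s ∈ Ioo 0 δ) : Continuous (G s) :=
  continuousOn_univ.1 (hG.comp (by fun_prop : ContinuousOn (fun y : E => (s, y)) univ)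
    (fun y _ => ⟨hs, mem_univ _⟩))

include hL in
-- Two half-power singularities meet here, (t(1 - σ))^(-1/2) from the Gaussian and (tσ)^(-1/2) from
-- the gradient of the source. They sit at opposite endpoints, so the product is integrable, and the
-- resulting t⁻¹ cancels the prefactor `t` of `duhamelHess`.
lemma norm_hess_integrand_le {t σ : ℝ} (ht : t ∈ Ioo 0 δ) (hσ : σ ∈ Ioo (0 : ℝ) 1) (x : E) :
    ‖(√(2 * (t * (1 - σ))))⁻¹ • gaussMomentDeriv √(2 * (t * (1 - σ))) (G (t * σ)) x‖ ≤
      t⁻¹ * timeKernel σ * (L * gaussianMeanNorm E) := by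
  have hL0 := nonneg_of_bound_inv_sqrt hL ht x
  have hm := gaussianMeanNorm_nonneg (E := E)
  rw [norm_smul, norm_inv, Real.norm_of_nonneg (Real.sqrt_nonneg _)]
  have h1 := norm_gaussMomentDeriv_le (hL _ (mul_mem_Ioo ht hσ)) √(2 * (t * (1 - σ))) x
  calc _ ≤ (√(2 * (t * (1 - σ))))⁻¹ * (L * (√(t * σ))⁻¹ * gaussianMeanNorm E) := by gcongr
    _ = (√(2 * (t * (1 - σ))))⁻¹ * (√(t * σ))⁻¹ * (L * gaussianMeanNorm E) := by ring
    _ ≤ _ := mul_le_mul_of_nonneg_right (inv_sqrt_mul_inv_sqrt_le_timeKernel ht.1 hσ)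
      (by positivity)

include hG hL

lemma continuousOn_gaussMomentDeriv_family :
    ContinuousOn (fun q : ℝ × ℝ × E => gaussMomentDeriv q.1 (G q.2.1) q.2.2)
      {q | q.2.1 ∈ Ioo 0 δ} := by
  refine continuousOn_gaussMomentDeriv isOpen_Ioo (m := fun s => L * (√s)⁻¹) ?_ hG hL
  have h : ContinuousOn (fun s : ℝ => (√s)⁻¹) (Ioo 0 δ) :=
    ContinuousOn.inv₀ Real.continuous_sqrt.continuousOn fun s hs => (Real.sqrt_pos.2 hs.1).ne'
  exact continuousOn_const.mul h

lemma continuousOn_hess_integrand :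
    ContinuousOn (fun q : ℝ × ℝ × E => (√(2 * (q.2.1 * (1 - q.1))))⁻¹ •
      gaussMomentDeriv √(2 * (q.2.1 * (1 - q.1))) (G (q.2.1 * q.1)) q.2.2)
      (Ioo 0 1 ×ˢ (Ioo 0 δ ×ˢ univ)) := by
  have h1 : ContinuousOn (fun q : ℝ × ℝ × E => (√(2 * (q.2.1 * (1 - q.1))))⁻¹)
      (Ioo 0 1 ×ˢ (Ioo 0 δ ×ˢ univ)) := by
    refine ContinuousOn.inv₀ (by fun_prop) fun q hq => ?_
    have h1 : 0 < 1 - q.1 := sub_pos.2 hq.1.2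
    have h2 : 0 < q.2.1 := hq.2.1.1
    positivity
  exact h1.smul ((continuousOn_gaussMomentDeriv_family hG hL).comp
    (by fun_prop : Continuous fun q : ℝ × ℝ × E =>
      (√(2 * (q.2.1 * (1 - q.1))), q.2.1 * q.1, q.2.2)).continuousOn
    (fun q hq => mul_mem_Ioo hq.2.1 hq.1))

lemma aestronglyMeasurable_hess_integrand {t : ℝ} (ht : t ∈ Ioo 0 δ) (x : E) :
    AEStronglyMeasurable (fun σ => (√(2 * (t * (1 - σ))))⁻¹ •
      gaussMomentDeriv √(2 * (t * (1 - σ))) (G (t * σ)) x) (volume.restrict (Ioo 0 1)) :=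
  ((continuousOn_hess_integrand hG hL).comp
    (by fun_prop : ContinuousOn (fun σ : ℝ => (σ, t, x)) (Ioo 0 1))
    (fun _ hσ => ⟨hσ, ht, mem_univ _⟩)).aestronglyMeasurable measurableSet_Ioo

lemma integrableOn_hess_integrand {t : ℝ} (ht : t ∈ Ioo 0 δ) (x : E) :
    IntegrableOn (fun σ => (√(2 * (t * (1 - σ))))⁻¹ •
      gaussMomentDeriv √(2 * (t * (1 - σ))) (G (t * σ)) x) (Ioo 0 1) :=
  ((integrableOn_timeKernel.const_mul t⁻¹).mul_const (L * gaussianMeanNorm E)).mono'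
    (aestronglyMeasurable_hess_integrand hG hL ht x)
    ((ae_restrict_iff' measurableSet_Ioo).2
      (ae_of_all _ fun _ hσ => norm_hess_integrand_le hL ht hσ x))

lemma norm_duhamelHess_le {t : ℝ} (ht : t ∈ Ioo 0 δ) (x : E) :
    ‖duhamelHess G t x‖ ≤ timeKernelMass * (L * gaussianMeanNorm E) := by
  have h := norm_integral_le_of_norm_le
    ((integrableOn_timeKernel.const_mul t⁻¹).mul_const (L * gaussianMeanNorm E))
    ((ae_restrict_iff' measurableSet_Ioo).2
      (ae_of_all _ fun _ hσ => norm_hess_integrand_le hL ht hσ x))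
  rw [integral_mul_const, integral_const_mul] at h
  rw [duhamelHess, norm_smul, Real.norm_of_nonneg ht.1.le]
  refine (mul_le_mul_of_nonneg_left h ht.1.le).trans (le_of_eq ?_)
  have := ht.1.ne'
  rw [timeKernelMass]
  field_simp

lemma continuousOn_duhamelHess :
    ContinuousOn (fun q : ℝ × E => duhamelHess G q.1 q.2) (Ioo 0 δ ×ˢ univ) := by
  intro q hq
  have hq1 : 0 < q.1 := hq.1.1
  refine ContinuousAt.continuousWithinAt ?_
  have hL0 := nonneg_of_bound_inv_sqrt hL hq.1 q.2
  have hev : ∀ᶠ q' : ℝ × E in 𝓝 q, q'.1 ∈ Ioo (q.1 / 2) δ :=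
    continuous_fst.continuousAt.eventually (Ioo_mem_nhds (half_lt_self hq1) hq.1.2)
  have hsub : ∀ s ∈ Ioo (q.1 / 2) δ, s ∈ Ioo 0 δ := fun s hs => ⟨(half_pos hq1).trans hs.1, hs.2⟩
  refine continuousAt_fst.smul (continuousAt_of_dominated
    (bound := fun σ => (q.1 / 2)⁻¹ * timeKernel σ * (L * gaussianMeanNorm E)) ?_ ?_
    ((integrableOn_timeKernel.const_mul _).mul_const _) ?_)
  · filter_upwards [hev] with q' hq'
    exact aestronglyMeasurable_hess_integrand hG hL (hsub _ hq') q'.2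
  · filter_upwards [hev] with q' hq'
    refine (ae_restrict_iff' measurableSet_Ioo).2 (ae_of_all _ fun σ hσ => ?_)
    refine (norm_hess_integrand_le hL (hsub _ hq') hσ q'.2).trans ?_
    have := timeKernel_nonneg σ
    have := gaussianMeanNorm_nonneg (E := E)
    have := hq'.1.le
    gcongr
  · refine (ae_restrict_iff' measurableSet_Ioo).2 (ae_of_all _ fun σ hσ => ?_)
    have h := (continuousOn_hess_integrand hG hL).continuousAt (x := (σ, q.1, q.2))
      ((isOpen_Ioo.prod (isOpen_Ioo.prod isOpen_univ)).mem_nhds ⟨hσ, hq.1, mem_univ _⟩)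
    exact ContinuousAt.comp (f := fun q : ℝ × E => (σ, q.1, q.2)) h (by fun_prop)

include hg hM hgG

lemma hasFDerivAt_duhamelGrad {t : ℝ} (ht : t ∈ Ioo 0 δ) (x : E) :
    HasFDerivAt (duhamelGrad g t) (duhamelHess G t x) x := by
  have hgs : ∀ s, Continuous (g s) := fun s =>
    hg.comp (by fun_prop : Continuous fun y : E => (s, y))
  have key := hasFDerivAt_integral_of_dominated_of_fderiv_le (μ := volume.restrict (Ioo (0 : ℝ) 1))
    (F := fun y σ => (√(2 * (t * (1 - σ))))⁻¹ • gaussMoment √(2 * (t * (1 - σ))) (g (t * σ)) y)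
    (F' := fun y σ => (√(2 * (t * (1 - σ))))⁻¹ •
      gaussMomentDeriv √(2 * (t * (1 - σ))) (G (t * σ)) y) (x₀ := x) (s := univ)
    (bound := fun σ => t⁻¹ * timeKernel σ * (L * gaussianMeanNorm E)) univ_mem
    (Eventually.of_forall fun y => aestronglyMeasurable_grad_integrand hg hM ht.1 y)
    (integrableOn_grad_integrand hg hM ht.1 x)
    (aestronglyMeasurable_hess_integrand hG hL ht x)
    ((ae_restrict_iff' measurableSet_Ioo).2 (ae_of_all _ fun σ hσ y _ =>
      norm_hess_integrand_le hL ht hσ y))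
    ((integrableOn_timeKernel.const_mul _).mul_const (L * gaussianMeanNorm E))
    ((ae_restrict_iff' measurableSet_Ioo).2 (ae_of_all _ fun σ hσ y _ =>
      (hasFDerivAt_gaussMoment (hgs _) (hM _) (hgG _ (mul_mem_Ioo ht hσ))
        (continuous_slice hG (mul_mem_Ioo ht hσ)) (hL _ (mul_mem_Ioo ht hσ)) _ y).fun_const_smul _))
  exact key.fun_const_smul t

end SmoothSource

end Duhamel

/-! ### Time derivative of Duhamel integrals. -/

section DuhamelTime

open ProbabilityTheory
open scoped RealInnerProductSpace

variable {E : Type*} [NormedAddCommGroup E] [InnerProductSpace ℝ E] [FiniteDimensional ℝ E]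
  [MeasurableSpace E] [BorelSpace E]

lemma mul_setIntegral_Ioo_comp_mul {f : ℝ → ℝ} {t : ℝ} (ht : 0 ≤ t) :
    t * ∫ σ in Ioo (0 : ℝ) 1, f (t * σ) = ∫ s in Ioo 0 t, f s := by
  have h := intervalIntegral.mul_integral_comp_mul_left (a := 0) (b := 1) (f := f) t
  rw [mul_zero, mul_one, intervalIntegral.integral_of_le zero_le_one,
    intervalIntegral.integral_of_le ht, integral_Ioc_eq_integral_Ioo,
    integral_Ioc_eq_integral_Ioo] at h
  exact h

lemma duhamel_eq_setIntegral (g : ℝ → E → ℝ) {t : ℝ} (ht : 0 ≤ t) (x : E) :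
    duhamel g t x = ∫ s in Ioo 0 t, gaussAvg √(2 * (t - s)) (g s) x := by
  rw [← mul_setIntegral_Ioo_comp_mul ht, duhamel]
  simp_rw [mul_sub, mul_one]

variable {g : ℝ → E → ℝ} {M : ℝ} (hg : Continuous fun q : ℝ × E => g q.1 q.2)
  (hM : ∀ s x, ‖g s x‖ ≤ M)
  {G : ℝ → E → E} {δ L : ℝ} (hG : ContinuousOn (fun q : ℝ × E => G q.1 q.2) (Ioo 0 δ ×ˢ univ))
  (hgG : ∀ s ∈ Ioo 0 δ, ∀ x, HasFDerivAt (g s) (innerSL ℝ (G s x)) x)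
  (hL : ∀ s ∈ Ioo 0 δ, ∀ x, ‖G s x‖ ≤ L * (√s)⁻¹)

/-- The Laplacian at time `τ` of the heat flow started at time `s` from `g s`, with `G = ∇g`. -/
noncomputable def laplacianKernel (G : ℝ → E → E) (x : E) (τ s : ℝ) : ℝ :=
  (√(2 * (τ - s)))⁻¹ * gaussDiv √(2 * (τ - s)) (G s) x

include hL in
lemma norm_laplacianKernel_le {τ s : ℝ} (hs : s ∈ Ioo 0 δ) (hτ : s < τ) (x : E) :
    ‖laplacianKernel G x τ s‖ ≤ (L * gaussianMeanNorm E) * ((√s)⁻¹ * (√(τ - s))⁻¹) := by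
  have h0 : 0 < τ - s := sub_pos.2 hτ
  have hL0 := nonneg_of_bound_inv_sqrt hL hs x
  have hm := gaussianMeanNorm_nonneg (E := E)
  have h1 : (√(2 * (τ - s)))⁻¹ ≤ (√(τ - s))⁻¹ :=
    inv_anti₀ (by positivity) (Real.sqrt_le_sqrt (by linarith))
  rw [laplacianKernel, norm_mul, norm_inv, Real.norm_of_nonneg (Real.sqrt_nonneg _)]
  have h2 := norm_gaussDiv_le (hL s hs) √(2 * (τ - s)) x
  calc _ ≤ (√(τ - s))⁻¹ * (L * (√s)⁻¹ * gaussianMeanNorm E) := by gcongr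
    _ = _ := by ring

include hG hL

lemma endTrace_duhamelHess {τ : ℝ} (hτ : τ ∈ Ioo 0 δ) (x : E) :
    endTrace E (duhamelHess G τ x) = ∫ s in Ioo 0 τ, laplacianKernel G x τ s := by
  rw [← mul_setIntegral_Ioo_comp_mul hτ.1.le, duhamelHess, map_smul,
    ← ContinuousLinearMap.integral_comp_comm _ (integrableOn_hess_integrand hG hL hτ x), smul_eq_mul]
  congr 1
  refine setIntegral_congr_fun measurableSet_Ioo fun σ hσ => ?_
  simp only [map_smul, smul_eq_mul, laplacianKernel]
  rw [endTrace_gaussMomentDeriv (continuous_slice hG (mul_mem_Ioo hτ hσ))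
    (hL _ (mul_mem_Ioo hτ hσ))]
  rw [mul_sub, mul_one]

lemma continuousOn_laplacianKernel (x : E) :
    ContinuousOn (fun q : ℝ × ℝ => laplacianKernel G x q.1 q.2)
      {q | 0 < q.2 ∧ q.2 < q.1 ∧ q.2 < δ} := by
  have hm : ContinuousOn (fun s : ℝ => L * (√s)⁻¹) (Ioo 0 δ) := by
    have h : ContinuousOn (fun s : ℝ => (√s)⁻¹) (Ioo 0 δ) :=
      ContinuousOn.inv₀ Real.continuous_sqrt.continuousOn fun s hs => (Real.sqrt_pos.2 hs.1).ne'
    exact continuousOn_const.mul h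
  have h1 := continuousOn_gaussDiv isOpen_Ioo hm hG hL
  refine ContinuousOn.mul (ContinuousOn.inv₀ (by fun_prop) fun q hq => ?_) ?_
  · have : 0 < q.1 - q.2 := sub_pos.2 hq.2.1
    positivity
  · exact h1.comp (f := fun q : ℝ × ℝ => (√(2 * (q.1 - q.2)), q.2, x)) (by fun_prop)
      (fun q hq => ⟨hq.1, hq.2.2⟩)

lemma integrableOn_laplacianKernel {s : ℝ} (hs : s ∈ Ioo 0 δ) (t : ℝ) (x : E) :
    IntegrableOn (fun τ => laplacianKernel G x τ s) (Ioo s t) := by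
  refine (((integrableOn_inv_sqrt_sub s t).const_mul (√s)⁻¹).const_mul
    (L * gaussianMeanNorm E)).mono' ?_ ((ae_restrict_iff' measurableSet_Ioo).2
      (ae_of_all _ fun τ hτ => norm_laplacianKernel_le hL hs hτ.1 x))
  exact ((continuousOn_laplacianKernel hG hL x).comp
    (by fun_prop : ContinuousOn (fun τ : ℝ => (τ, s)) (Ioo s t))
    (fun τ hτ => ⟨hs.1, hτ.1, hs.2⟩)).aestronglyMeasurable measurableSet_Ioo

/-- Fubini on the triangle 0 < s < τ < t. Both iterated integrals are written over the plane with
the indicator of the triangle. -/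
lemma integral_integral_laplacianKernel {t : ℝ} (ht : t ∈ Ioo 0 δ) (x : E) :
    ∫ s in Ioo 0 t, ∫ τ in Ioo s t, laplacianKernel G x τ s =
      ∫ τ in Ioo 0 t, ∫ s in Ioo 0 τ, laplacianKernel G x τ s := by
  set S : Set (ℝ × ℝ) := {q | 0 < q.2 ∧ q.2 < q.1 ∧ q.1 < t} with hS
  have hSo : IsOpen S := by
    refine (isOpen_lt continuous_const continuous_snd).inter
      ((isOpen_lt continuous_snd continuous_fst).inter (isOpen_lt continuous_fst continuous_const))
  set F : ℝ → ℝ → ℝ := fun τ s => S.indicator (fun q => laplacianKernel G x q.1 q.2) (τ, s) with hF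
  have hL0 := nonneg_of_bound_inv_sqrt hL ht x
  have hm := gaussianMeanNorm_nonneg (E := E)
  have hFi : Integrable (Function.uncurry F) (volume.prod volume) := by
    set f : ℝ → ℝ := (Ioo 0 t).indicator fun s => (√s)⁻¹ with hf
    have hfi : Integrable f := (integrableOn_inv_sqrt t).integrable_indicator measurableSet_Ioo
    -- The majorant s^(-1/2) (τ - s)^(-1/2) is the convolution integrand of an integrable function
    -- with itself, hence integrable on the plane.
    have hconv := (hfi.convolution_integrand (ContinuousLinearMap.mul ℝ ℝ) hfi).const_mul
      (L * gaussianMeanNorm E)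
    have hFS : Function.uncurry F = S.indicator (fun q => laplacianKernel G x q.1 q.2) := by
      ext q; rfl
    refine hconv.mono' ?_ (ae_of_all _ fun q => ?_)
    · rw [hFS, aestronglyMeasurable_indicator_iff hSo.measurableSet]
      exact ((continuousOn_laplacianKernel hG hL x).mono fun q hq =>
        ⟨hq.1, hq.2.1, hq.2.1.trans (hq.2.2.trans ht.2)⟩).aestronglyMeasurable hSo.measurableSet
    · have hf0 : ∀ s, 0 ≤ f s := fun s => indicator_nonneg (fun _ _ => by positivity) _
      rw [hFS]
      by_cases hq : q ∈ S
      · rw [indicator_of_mem hq]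
        have hs : q.2 ∈ Ioo 0 t := ⟨hq.1, hq.2.1.trans hq.2.2⟩
        have hr : q.1 - q.2 ∈ Ioo 0 t := ⟨sub_pos.2 hq.2.1, by linarith [hq.1, hq.2.2]⟩
        have := norm_laplacianKernel_le hL ⟨hs.1, hs.2.trans ht.2⟩ hq.2.1 x
        simpa [hf, indicator_of_mem hs, indicator_of_mem hr] using this
      · rw [indicator_of_notMem hq, norm_zero]
        have := mul_nonneg (hf0 q.2) (hf0 (q.1 - q.2))
        simp only [ContinuousLinearMap.mul_apply']
        positivity
  have h1 : ∫ s in Ioo 0 t, ∫ τ in Ioo s t, laplacianKernel G x τ s = ∫ s, ∫ τ, F τ s := by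
    rw [← integral_indicator measurableSet_Ioo]
    congr 1
    ext s
    by_cases hs : s ∈ Ioo 0 t
    · rw [indicator_of_mem hs, ← integral_indicator measurableSet_Ioo]
      congr 1
      ext τ
      simp only [hF, indicator, hS, mem_Ioo, mem_ofPred_eq, hs.1, true_and]
    · rw [indicator_of_notMem hs]
      have : ∀ τ, F τ s = 0 := fun τ => indicator_of_notMem
        (fun hq : (τ, s) ∈ S => hs ⟨hq.1, hq.2.1.trans hq.2.2⟩) _
      simp [this]
  have h2 : ∫ τ in Ioo 0 t, ∫ s in Ioo 0 τ, laplacianKernel G x τ s = ∫ τ, ∫ s, F τ s := by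
    rw [← integral_indicator measurableSet_Ioo]
    congr 1
    ext τ
    by_cases hτ : τ ∈ Ioo 0 t
    · rw [indicator_of_mem hτ, ← integral_indicator measurableSet_Ioo]
      congr 1
      ext s
      simp only [hF, indicator, hS, mem_Ioo, mem_ofPred_eq, hτ.2, and_true]
    · rw [indicator_of_notMem hτ]
      have : ∀ s, F τ s = 0 := fun s => indicator_of_notMem
        (fun hq : (τ, s) ∈ S => hτ ⟨hq.1.trans hq.2.1, hq.2.2⟩) _
      simp [this]
  rw [h1, h2]
  exact (integral_integral_swap hFi).symm

include hg hM hgG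

/-- Fundamental theorem of calculus for the heat flow started from `g s` at time `s`: it is
continuous down to τ = s, and its time derivative is integrable there. -/
lemma gaussAvg_sub_eq_integral {s t : ℝ} (hs : s ∈ Ioo 0 δ) (hst : s < t) (x : E) :
    gaussAvg √(2 * (t - s)) (g s) x = g s x + ∫ τ in Ioo s t, laplacianKernel G x τ s := by
  have hgs : Continuous (g s) := hg.comp (by fun_prop : Continuous fun y : E => (s, y))
  have hcont : Continuous fun τ => gaussAvg √(2 * (τ - s)) (g s) x :=
    (continuous_gaussAvg hgs (hM s)).comp (by fun_prop : Continuous fun τ => (√(2 * (τ - s)), x))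
  have hd : ∀ τ ∈ Ioo s t, HasDerivAt (fun τ => gaussAvg √(2 * (τ - s)) (g s) x)
      (laplacianKernel G x τ s) τ := fun τ hτ =>
    (hasDerivAt_gaussAvg_sqrt hgs (hM s) (hgG s hs) (continuous_slice hG hs) (hL s hs) x
      (sub_pos.2 hτ.1)).comp_sub_const τ s
  have hint : IntervalIntegrable (fun τ => laplacianKernel G x τ s) volume s t := by
    rw [intervalIntegrable_iff_integrableOn_Ioo_of_le hst.le]
    exact integrableOn_laplacianKernel hG hL hs t x
  have h := intervalIntegral.integral_eq_sub_of_hasDerivAt_of_le hst.le hcont.continuousOn hd hint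
  rw [intervalIntegral.integral_of_le hst.le, integral_Ioc_eq_integral_Ioo] at h
  have h0 : gaussAvg √(2 * (s - s)) (g s) x = g s x := by simp [gaussAvg]
  rw [h0] at h
  linarith

/-- Each heat flow in the Duhamel integral is replaced by its datum plus the integral of its
Laplacian, and the order of integration is exchanged. This exhibits a primitive in time, so the
singular kernel never has to be differentiated in `t`. -/
lemma duhamel_eq_integral {t : ℝ} (ht : t ∈ Ioo 0 δ) (x : E) :
    duhamel g t x = (∫ s in (0 : ℝ)..t, g s x) + ∫ τ in (0 : ℝ)..t, endTrace E (duhamelHess G τ x) := by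
  have hgx : Continuous fun s => g s x := hg.comp (by fun_prop : Continuous fun s : ℝ => (s, x))
  have hgi : IntegrableOn (fun s => g s x) (Ioo 0 t) :=
    (hgx.integrableOn_Icc (a := 0) (b := t)).mono_set Ioo_subset_Icc_self
  have hmem : ∀ s ∈ Ioo 0 t, s ∈ Ioo 0 δ := fun s hs => ⟨hs.1, hs.2.trans ht.2⟩
  rw [duhamel_eq_setIntegral g ht.1.le, intervalIntegral.integral_of_le ht.1.le,
    intervalIntegral.integral_of_le ht.1.le, integral_Ioc_eq_integral_Ioo,
    integral_Ioc_eq_integral_Ioo]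
  have h1 : ∫ τ in Ioo 0 t, endTrace E (duhamelHess G τ x) =
      ∫ τ in Ioo 0 t, ∫ s in Ioo 0 τ, laplacianKernel G x τ s :=
    setIntegral_congr_fun measurableSet_Ioo fun τ hτ => endTrace_duhamelHess hG hL (hmem τ hτ) x
  have h2 : ∫ s in Ioo 0 t, gaussAvg √(2 * (t - s)) (g s) x - g s x =
      ∫ s in Ioo 0 t, ∫ τ in Ioo s t, laplacianKernel G x τ s :=
    setIntegral_congr_fun measurableSet_Ioo fun s hs => by
      rw [gaussAvg_sub_eq_integral hg hM hG hgG hL (hmem s hs) hs.2 x, add_sub_cancel_left]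
  rw [h1, ← integral_integral_laplacianKernel hG hL ht x, ← h2, integral_sub _ hgi]
  · ring
  · have : Continuous fun s => gaussAvg √(2 * (t - s)) (g s) x :=
      (continuous_gaussAvg_family hg hM).comp
        (by fun_prop : Continuous fun s : ℝ => (√(2 * (t - s)), s, x))
    exact (this.integrableOn_Icc (a := 0) (b := t)).mono_set Ioo_subset_Icc_self

lemma hasDerivAt_duhamel {t : ℝ} (ht : t ∈ Ioo 0 δ) (x : E) :
    HasDerivAt (fun t => duhamel g t x) (g t x + endTrace E (duhamelHess G t x)) t := by
  have hgx : Continuous fun s => g s x := hg.comp (by fun_prop : Continuous fun s : ℝ => (s, x))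
  have hW : ContinuousOn (fun τ => endTrace E (duhamelHess G τ x)) (Ioo 0 δ) :=
    (endTrace E).continuous.comp_continuousOn ((continuousOn_duhamelHess hG hL).comp
      (by fun_prop : ContinuousOn (fun τ : ℝ => (τ, x)) (Ioo 0 δ)) fun τ hτ => ⟨hτ, mem_univ _⟩)
  have hWi : IntervalIntegrable (fun τ => endTrace E (duhamelHess G τ x)) volume 0 t := by
    rw [intervalIntegrable_iff_integrableOn_Ioo_of_le ht.1.le]
    have hsub : Ioo 0 t ⊆ Ioo 0 δ := Ioo_subset_Ioo_right ht.2.le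
    refine (integrable_const (‖endTrace E‖ * (timeKernelMass * (L * gaussianMeanNorm E)))).mono'
      ((hW.mono hsub).aestronglyMeasurable measurableSet_Ioo)
      ((ae_restrict_iff' measurableSet_Ioo).2 (ae_of_all _ fun τ hτ => ?_))
    exact ((endTrace E).le_opNorm _).trans (by
      gcongr; exact norm_duhamelHess_le hG hL (hsub hτ) x)
  have h1 : HasDerivAt (fun t => ∫ s in (0 : ℝ)..t, g s x) (g t x) t :=
    hgx.integral_hasStrictDerivAt 0 t |>.hasDerivAt
  have h2 : HasDerivAt (fun t => ∫ τ in (0 : ℝ)..t, endTrace E (duhamelHess G τ x))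
      (endTrace E (duhamelHess G t x)) t :=
    intervalIntegral.integral_hasDerivAt_right hWi
      (hW.stronglyMeasurableAtFilter isOpen_Ioo t ht) (hW.continuousAt (Ioo_mem_nhds ht.1 ht.2))
  refine (h1.add h2).congr_of_eventuallyEq ?_
  filter_upwards [Ioo_mem_nhds ht.1 ht.2] with s hs
  exact duhamel_eq_integral hg hM hG hgG hL hs x

/-- Duhamel integrals of sources with gradient `O(s^{-1/2})` are classical solutions. -/
lemma hasParabolicDerivs_duhamel :
    HasParabolicDerivs (Ioo 0 δ) (duhamel g) (fun t x => g t x + endTrace E (duhamelHess G t x))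
      (duhamelGrad g) (duhamelHess G) := by
  have hH := continuousOn_duhamelHess hG hL
  refine ⟨fun t ht x => hasDerivAt_duhamel hg hM hG hgG hL ht x,
    fun t ht x => hasFDerivAt_duhamel hg hM ht.1 x,
    fun t ht x => hasFDerivAt_duhamelGrad hg hM hG hgG hL ht x, ?_,
    (continuousOn_duhamelGrad hg hM).mono (prod_mono_left fun t ht => ht.1), hH⟩
  exact hg.continuousOn.add ((endTrace E).continuous.comp_continuousOn hH)

end DuhamelTime

/-! ### Classical solvability at a single time. -/

section SolvesAt

open scoped RealInnerProductSpace

variable {E : Type*} [NormedAddCommGroup E] [InnerProductSpace ℝ E] [FiniteDimensional ℝ E]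
  [MeasurableSpace E] [BorelSpace E]

/-- `u` is regular near the time `t` and satisfies `u_t = Δu + |u|^(p-1) u` at time `t`. -/
structure SolvesAt (p : ℝ) (u : ℝ → E → ℝ) (t : ℝ) : Prop where
  differentiableAt_time : ∀ x, DifferentiableAt ℝ (fun s => u s x) t
  contDiff_space : ContDiff ℝ 2 (u t)
  continuousAt_deriv_time : ∀ x,
    ContinuousAt (fun z : ℝ × E => deriv (fun s => u s z.2) z.1) (t, x)
  continuousAt_fderiv_space : ∀ x, ContinuousAt (fun z : ℝ × E => fderiv ℝ (u z.1) z.2) (t, x)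
  continuousAt_fderiv2_space : ∀ x,
    ContinuousAt (fun z : ℝ × E => iteratedFDeriv ℝ 2 (u z.1) z.2) (t, x)
  equation : ∀ x, deriv (fun s => u s x) t = Laplacian.laplacian (u t) x + |u t x| ^ (p - 1) * u t x

lemma SolvesAt.congr {p t : ℝ} {u v : ℝ → E → ℝ} (h : SolvesAt p u t)
    (huv : ∀ᶠ s in 𝓝 t, v s = u s) : SolvesAt p v t := by
  have ht : v t = u t := huv.self_of_nhds
  have hd : ∀ᶠ s in 𝓝 t, ∀ x, deriv (fun s => v s x) s = deriv (fun s => u s x) s := by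
    filter_upwards [huv.eventually_nhds] with s hs x
    exact EventuallyEq.deriv_eq (hs.mono fun r hr => by simp only [hr])
  have hf : ∀ x, Tendsto (fun z : ℝ × E => z.1) (𝓝 (t, x)) (𝓝 t) := fun x => continuousAt_fst
  refine ⟨fun x => ?_, ht ▸ h.contDiff_space, fun x => ?_, fun x => ?_, fun x => ?_, fun x => ?_⟩
  · exact (h.differentiableAt_time x).congr_of_eventuallyEq (huv.mono fun s hs => by simp only [hs])
  · exact (h.continuousAt_deriv_time x).congr (((hf x).eventually hd).mono fun z hz => (hz z.2).symm)
  · exact (h.continuousAt_fderiv_space x).congr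
      (((hf x).eventually huv).mono fun z hz => by simp only [hz])
  · exact (h.continuousAt_fderiv2_space x).congr
      (((hf x).eventually huv).mono fun z hz => by simp only [hz])
  · rw [hd.self_of_nhds x, ht]
    exact h.equation x

lemma SolvesAt.shift {p t a : ℝ} {u : ℝ → E → ℝ} (h : SolvesAt p u (t + a)) :
    SolvesAt p (fun s => u (s + a)) t := by
  have hc : ∀ x, ContinuousAt (fun z : ℝ × E => (z.1 + a, z.2)) (t, x) := fun x => by fun_prop
  have hd : ∀ s x, deriv (fun r => u (r + a) x) s = deriv (fun r => u r x) (s + a) := fun s x =>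
    deriv_comp_add_const (fun r => u r x) a s
  refine ⟨fun x => ?_, h.contDiff_space, fun x => ?_, fun x => ?_, fun x => ?_, fun x => ?_⟩
  · exact ((h.differentiableAt_time x).hasDerivAt.comp_add_const t a).differentiableAt
  · simp only [hd]
    exact ContinuousAt.comp (f := fun z : ℝ × E => (z.1 + a, z.2))
      (h.continuousAt_deriv_time x) (hc x)
  · exact ContinuousAt.comp (f := fun z : ℝ × E => (z.1 + a, z.2))
      (h.continuousAt_fderiv_space x) (hc x)
  · exact ContinuousAt.comp (f := fun z : ℝ × E => (z.1 + a, z.2))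
      (h.continuousAt_fderiv2_space x) (hc x)
  · rw [hd]
    exact h.equation x

section Hessian

variable {f : E → ℝ} {B : E → E} {C : E → E →L[ℝ] E}
  (hf : ∀ x, HasFDerivAt f (innerSL ℝ (B x)) x) (hB : ∀ x, HasFDerivAt B (C x) x)
include hf hB

lemma contDiff_two_of_gradient (hC : Continuous C) : ContDiff ℝ 2 f := by
  have hB1 : ContDiff ℝ 1 B := contDiff_one_iff_hasFDerivAt.2 ⟨C, hC, hB⟩
  rw [show (2 : WithTop ℕ∞) = 1 + 1 by norm_num]
  refine contDiff_succ_iff_hasFDerivAt.2 ⟨fun x => innerSL ℝ (B x), ?_, hf⟩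
  exact contDiff_clm_apply_iff.2 fun w => hB1.inner ℝ contDiff_const

lemma iteratedFDeriv_two_of_gradient (hC : Continuous C) (x : E) (m : Fin 2 → E) :
    iteratedFDeriv ℝ 2 f x m = ⟪C x (m 0), m 1⟫ := by
  have h2 := contDiff_two_of_gradient hf hB hC
  have hd : DifferentiableAt ℝ (fderiv ℝ f) x :=
    ((h2.fderiv_right (m := 1) (by norm_num)).differentiable (by norm_num)) x
  rw [iteratedFDeriv_two_apply]
  have h3 := hd.hasFDerivAt.clm_apply (hasFDerivAt_const (m 1) x)
  have e : (fun y => fderiv ℝ f y (m 1)) = fun y => ⟪B y, m 1⟫ := by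
    ext y; rw [(hf y).fderiv]; rfl
  rw [e] at h3
  have h4 := h3.unique ((hB x).inner ℝ (hasFDerivAt_const (m 1) x))
  have h5 := DFunLike.congr_fun h4 (m 0)
  simpa using h5

lemma laplacian_of_gradient (hC : Continuous C) (x : E) :
    Laplacian.laplacian f x = endTrace E (C x) := by
  rw [InnerProductSpace.laplacian_eq_iteratedFDeriv_stdOrthonormalBasis, endTrace_apply]
  refine Finset.sum_congr rfl fun i _ => ?_
  rw [iteratedFDeriv_two_of_gradient hf hB hC, real_inner_comm]
  rfl

end Hessian

lemma HasParabolicDerivs.solvesAt {p : ℝ} {I : Set ℝ} {u A : ℝ → E → ℝ} {B : ℝ → E → E}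
    {C : ℝ → E → E →L[ℝ] E} (h : HasParabolicDerivs I u A B C) (hI : IsOpen I)
    (hA : ∀ t ∈ I, ∀ x, A t x = endTrace E (C t x) + |u t x| ^ (p - 1) * u t x) {t : ℝ}
    (ht : t ∈ I) : SolvesAt p u t := by
  have hC : ∀ s ∈ I, Continuous (C s) := fun s hs =>
    continuousOn_univ.1 (h.continuousOn_space_two.comp
      (by fun_prop : ContinuousOn (fun y : E => (s, y)) univ) (fun y _ => ⟨hs, mem_univ _⟩))
  have hnhds : ∀ x : E, I ×ˢ (univ : Set E) ∈ 𝓝 (t, x) := fun x =>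
    (hI.prod isOpen_univ).mem_nhds ⟨ht, mem_univ _⟩
  refine ⟨fun x => (h.time t ht x).differentiableAt,
    contDiff_two_of_gradient (h.space t ht) (h.space_two t ht) (hC t ht), fun x => ?_, fun x => ?_,
    fun x => ?_, fun x => ?_⟩
  · refine (h.continuousOn_time.continuousAt (hnhds x)).congr ?_
    filter_upwards [hnhds x] with z hz
    exact (h.time z.1 hz.1 z.2).deriv.symm
  · refine ((innerSL ℝ).continuous.continuousAt.comp
      (h.continuousOn_space.continuousAt (hnhds x))).congr ?_
    filter_upwards [hnhds x] with z hz
    exact (h.space z.1 hz.1 z.2).fderiv.symm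
  · have hc := h.continuousOn_space_two.continuousAt (hnhds x)
    -- The norm of the difference of the bilinear forms is at most that of the difference of the
    -- operators `C`, whose continuity is known.
    rw [ContinuousAt, tendsto_iff_norm_sub_tendsto_zero] at hc ⊢
    refine squeeze_zero' (Eventually.of_forall fun _ => norm_nonneg _) ?_ hc
    filter_upwards [hnhds x] with z hz
    refine ContinuousMultilinearMap.opNorm_le_bound (norm_nonneg _) fun m => ?_
    rw [sub_apply,
      iteratedFDeriv_two_of_gradient (h.space _ hz.1) (h.space_two _ hz.1) (hC _ hz.1),
      iteratedFDeriv_two_of_gradient (h.space _ ht) (h.space_two _ ht) (hC _ ht),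
      ← inner_sub_left, ← sub_apply, Fin.prod_univ_two, ← mul_assoc]
    refine (norm_inner_le_norm _ _).trans ?_
    gcongr
    exact ContinuousLinearMap.le_opNorm _ _
  · rw [(h.time t ht x).deriv, hA t ht,
      laplacian_of_gradient (h.space t ht) (h.space_two t ht) (hC t ht)]

end SolvesAt

/-! ### The power nonlinearity. -/

section Nonlinearity

variable {p : ℝ}

lemma hasDerivAt_abs_rpow_mul (hp : 1 < p) (s : ℝ) :
    HasDerivAt (fun s : ℝ => |s| ^ (p - 1) * s) (p * |s| ^ (p - 1)) s := by
  have hp1 : 0 < p - 1 := sub_pos.2 hp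
  have hpos : ∀ r : ℝ, 0 < r → |r| ^ (p - 1) * r = r ^ p := fun r hr => by
    rw [abs_of_pos hr, ← Real.rpow_add_one hr.ne', sub_add_cancel]
  rcases lt_trichotomy s 0 with h | rfl | h
  · have h1 : HasDerivAt (fun r : ℝ => -(-r) ^ p) (p * |s| ^ (p - 1)) s := by
      have := ((hasDerivAt_id s).neg.rpow_const (p := p) (Or.inr hp.le)).neg
      refine this.congr_deriv ?_
      rw [abs_of_neg h]
      simp
    refine h1.congr_of_eventuallyEq ?_
    filter_upwards [gt_mem_nhds h] with r hr
    rw [← hpos (-r) (neg_pos.2 hr), abs_neg]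
    ring
  -- At the origin the difference quotient is `|t| ^ (p - 1)`, which tends to `0` because `p > 1`.
  · rw [hasDerivAt_iff_tendsto_slope_zero]
    have hc : Tendsto (fun t : ℝ => |t| ^ (p - 1)) (𝓝[≠] 0) (𝓝 (p * |0| ^ (p - 1))) := by
      have : Continuous fun t : ℝ => |t| ^ (p - 1) :=
        continuous_abs.rpow_const fun _ => Or.inr hp1.le
      have h0 := (this.tendsto 0).mono_left (nhdsWithin_le_nhds (s := {0}ᶜ))
      simpa [Real.zero_rpow hp1.ne'] using h0
    refine hc.congr' ?_
    filter_upwards [self_mem_nhdsWithin] with t ht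
    have : t ≠ 0 := ht
    simp only [zero_add, mul_zero, sub_zero, smul_eq_mul]
    field_simp
  · have h1 : HasDerivAt (fun r : ℝ => r ^ p) (p * |s| ^ (p - 1)) s := by
      rw [abs_of_pos h]
      exact Real.hasDerivAt_rpow_const (Or.inr hp.le)
    refine h1.congr_of_eventuallyEq ?_
    filter_upwards [lt_mem_nhds h] with r hr
    exact hpos r hr

lemma abs_nonlinearity_sub_le (hp : 1 < p) {R a b : ℝ} (ha : |a| ≤ R) (hb : |b| ≤ R) :
    |(|a| ^ (p - 1) * a) - |b| ^ (p - 1) * b| ≤ p * R ^ (p - 1) * |a - b| := by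
  have hp1 : 0 < p - 1 := sub_pos.2 hp
  have h := (convex_Icc (-R) R).norm_image_sub_le_of_norm_hasDerivWithin_le
    (f := fun s : ℝ => |s| ^ (p - 1) * s) (f' := fun s => p * |s| ^ (p - 1)) (C := p * R ^ (p - 1))
    (fun s _ => (hasDerivAt_abs_rpow_mul hp s).hasDerivWithinAt)
    (fun s hs => ?_) (abs_le.1 hb) (abs_le.1 ha)
  · exact h
  · rw [Real.norm_of_nonneg (by positivity)]
    have : |s| ≤ R := abs_le.2 hs
    gcongr

lemma abs_nonlinearity_le (hp : 1 < p) {R a : ℝ} (ha : |a| ≤ R) :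
    |(|a| ^ (p - 1) * a)| ≤ R ^ (p - 1) * R := by
  have hp1 : 0 < p - 1 := sub_pos.2 hp
  have : 0 ≤ R := (abs_nonneg a).trans ha
  rw [abs_mul, abs_of_nonneg (by positivity : 0 ≤ |a| ^ (p - 1))]
  gcongr

lemma continuous_nonlinearity (hp : 1 < p) : Continuous fun s : ℝ => |s| ^ (p - 1) * s :=
  continuous_iff_continuousAt.2 fun s => (hasDerivAt_abs_rpow_mul hp s).continuousAt

end Nonlinearity

/-! ### Local existence: mild solutions and their regularity. -/

section LocalExistence

open ProbabilityTheory
open scoped RealInnerProductSpace NNReal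

variable {E : Type*} [NormedAddCommGroup E] [InnerProductSpace ℝ E] [FiniteDimensional ℝ E]
  [MeasurableSpace E] [BorelSpace E]

/-- The nearest point of `[a, b]`. -/
noncomputable def clampTo (a b s : ℝ) : ℝ := max a (min b s)

lemma clampTo_mem {a b : ℝ} (h : a ≤ b) (s : ℝ) : clampTo a b s ∈ Icc a b :=
  ⟨le_max_left _ _, max_le h (min_le_left _ _)⟩

lemma clampTo_eq {a b s : ℝ} (h : s ∈ Icc a b) : clampTo a b s = s := by
  rw [clampTo, min_eq_right h.2, max_eq_right h.1]

lemma continuous_clampTo (a b : ℝ) : Continuous (clampTo a b) := by unfold clampTo; fun_prop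

lemma abs_clampTo_sub_le (a b s t : ℝ) : |clampTo a b s - clampTo a b t| ≤ |s - t| := by
  refine (abs_max_sub_max_le_max _ _ _ _).trans ?_
  rw [sub_self, abs_zero]
  refine max_le (abs_nonneg _) ((abs_min_sub_min_le_max _ _ _ _).trans ?_)
  rw [sub_self, abs_zero]
  exact max_le (abs_nonneg _) le_rfl

/-- Existence of a bounded mild solution of a semilinear heat equation with bounded Lipschitz
nonlinearity, on a short time interval. -/
lemma exists_mild_solution_of_lipschitz {F : ℝ → ℝ} {K N : ℝ}
    (hFK : ∀ a b, |F a - F b| ≤ K * |a - b|) (hFN : ∀ a, |F a| ≤ N) {φ : E → ℝ} {M : ℝ}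
    (hφ : Continuous φ) (hM : ∀ x, ‖φ x‖ ≤ M) {δ : ℝ} (hδ : 0 ≤ δ) (hδK : δ * K ≤ 1 / 2) :
    ∃ v : ℝ × E → ℝ, Continuous v ∧ (∀ q, |v q| ≤ M + δ * N) ∧ ∀ t ∈ Icc 0 δ, ∀ x,
      v (t, x) = gaussAvg √(2 * t) φ x + duhamel (fun s y => F (v (s, y))) t x := by
  have hK : 0 ≤ K := by
    have := (abs_nonneg _).trans (hFK 1 0); simpa using this
  have hF : Continuous F := (LipschitzWith.of_dist_le_mul (K := ⟨K, hK⟩) fun a b => hFK a b).continuous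
  -- Clamping time to [0, δ] lets the fixed-point map act on the complete space of bounded
  -- continuous functions on all of `ℝ × E`.
  set τ : ℝ → ℝ := clampTo 0 δ with hτ
  have hτm : ∀ t, τ t ∈ Icc 0 δ := clampTo_mem hδ
  have hτc : Continuous τ := continuous_clampTo 0 δ
  have hsrc : ∀ v : BoundedContinuousFunction (ℝ × E) ℝ,
      Continuous fun q : ℝ × E => F (v (q.1, q.2)) := fun v => hF.comp v.continuous
  set rhs : (ℝ × E → ℝ) → ℝ × E → ℝ := fun v q =>
    gaussAvg √(2 * τ q.1) φ q.2 + duhamel (fun s y => F (v (s, y))) (τ q.1) q.2 with hrhs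
  have hrhs_cont : ∀ v : BoundedContinuousFunction (ℝ × E) ℝ, Continuous (rhs v) := fun v =>
    ((continuous_gaussAvg hφ hM).comp
      (by fun_prop : Continuous fun q : ℝ × E => (√(2 * τ q.1), q.2))).add
    ((continuous_duhamel (g := fun s y => F (v (s, y))) (hsrc v) (fun s x => hFN _)).comp
      (by fun_prop : Continuous fun q : ℝ × E => (τ q.1, q.2)))
  have hrhs_bound : ∀ (v : BoundedContinuousFunction (ℝ × E) ℝ) q, ‖rhs v q‖ ≤ M + δ * N := by
    intro v q
    have hN : 0 ≤ N := (abs_nonneg _).trans (hFN 0)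
    refine (norm_add_le _ _).trans (add_le_add (norm_gaussAvg_le _ hM _)
      ((norm_duhamel_le (fun s x => hFN _) (hτm q.1).1 _).trans ?_))
    gcongr
    exact (hτm q.1).2
  set Φ : BoundedContinuousFunction (ℝ × E) ℝ → BoundedContinuousFunction (ℝ × E) ℝ := fun v =>
    BoundedContinuousFunction.ofNormedAddCommGroup (rhs v) (hrhs_cont v) (M + δ * N) (hrhs_bound v)
    with hΦ
  have hcontr : ContractingWith (1 / 2 : ℝ≥0) Φ := by
    refine ⟨by rw [← NNReal.coe_lt_coe]; norm_num, LipschitzWith.of_dist_le_mul fun v w => ?_⟩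
    rw [BoundedContinuousFunction.dist_le (by positivity)]
    intro q
    have h1 : ∀ s y, ‖F (v (s, y)) - F (w (s, y))‖ ≤ K * dist v w := fun s y =>
      (hFK _ _).trans (mul_le_mul_of_nonneg_left
        (BoundedContinuousFunction.dist_coe_le_dist (f := v) (g := w) (s, y)) hK)
    have h2 := norm_duhamel_sub_le (hsrc v) (fun s x => hFN _) (hsrc w) (fun s x => hFN _) h1
      (hτm q.1).1 q.2
    have e : dist (Φ v q) (Φ w q) = ‖duhamel (fun s y => F (v (s, y))) (τ q.1) q.2 -
        duhamel (fun s y => F (w (s, y))) (τ q.1) q.2‖ := by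
      rw [Real.dist_eq]
      change |rhs v q - rhs w q| = _
      simp only [hrhs, add_sub_add_left_eq_sub]
      rfl
    rw [e]
    refine h2.trans ?_
    have h3 : τ q.1 * (K * dist v w) ≤ δ * (K * dist v w) := by
      gcongr; exact (hτm q.1).2
    have h4 : δ * K * dist v w ≤ 1 / 2 * dist v w := by gcongr
    push_cast
    linarith
  have hfix := hcontr.fixedPoint_isFixedPt
  set v := hcontr.fixedPoint Φ
  have hv : ∀ q, v q = rhs v q := fun q => by
    conv_lhs => rw [← hfix.eq]
    rfl
  refine ⟨v, v.continuous, fun q => ?_, fun t ht x => ?_⟩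
  · rw [hv]; exact hrhs_bound v q
  · rw [hv, hrhs]
    simp only [hτ, clampTo_eq ht]

/-- The nonlinearity is truncated at height `M + 1`, where it becomes bounded and Lipschitz. The
smallness of `δ` keeps the fixed point below that height, so the truncation is never active. -/
lemma exists_mild_solution {p : ℝ} (hp : 1 < p) {φ : E → ℝ} {M : ℝ} (hM0 : 0 ≤ M)
    (hφ : Continuous φ) (hM : ∀ x, ‖φ x‖ ≤ M) {δ : ℝ} (hδ : 0 ≤ δ)
    (hδ1 : δ * ((M + 1) ^ (p - 1) * (M + 1)) ≤ 1) (hδ2 : δ * (p * (M + 1) ^ (p - 1)) ≤ 1 / 2) :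
    ∃ v : ℝ × E → ℝ, Continuous v ∧ (∀ q, |v q| ≤ M + 1) ∧ ∀ t ∈ Icc 0 δ, ∀ x,
      v (t, x) = gaussAvg √(2 * t) φ x +
        duhamel (fun s y => |v (s, y)| ^ (p - 1) * v (s, y)) t x := by
  have hR : -(M + 1) ≤ M + 1 := by linarith
  have habs : ∀ a, |clampTo (-(M + 1)) (M + 1) a| ≤ M + 1 := fun a => abs_le.2 (clampTo_mem hR a)
  obtain ⟨v, hv, hvb, hve⟩ := exists_mild_solution_of_lipschitz
    (F := fun a => |clampTo (-(M + 1)) (M + 1) a| ^ (p - 1) * clampTo (-(M + 1)) (M + 1) a)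
    (fun a b => (abs_nonlinearity_sub_le hp (habs a) (habs b)).trans
      (mul_le_mul_of_nonneg_left (abs_clampTo_sub_le _ _ a b) (by positivity)))
    (fun a => abs_nonlinearity_le hp (habs a)) hφ hM hδ hδ2
  have hvR : ∀ q, |v q| ≤ M + 1 := fun q => (hvb q).trans (by linarith)
  refine ⟨v, hv, hvR, fun t ht x => ?_⟩
  rw [hve t ht x]
  congr 2
  ext s y
  rw [clampTo_eq (abs_le.1 (hvR (s, y)))]

/-- Interior regularity of bounded mild solutions. -/
lemma solvesAt_of_mild {p : ℝ} (hp : 1 < p) {φ : E → ℝ} {M R : ℝ}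
    (hφ : Continuous φ) (hM : ∀ x, ‖φ x‖ ≤ M) {δ : ℝ} {v : ℝ × E → ℝ} (hv : Continuous v)
    (hvR : ∀ q, |v q| ≤ R) (hmild : ∀ t ∈ Icc 0 δ, ∀ x, v (t, x) = gaussAvg √(2 * t) φ x +
        duhamel (fun s y => |v (s, y)| ^ (p - 1) * v (s, y)) t x) {t : ℝ} (ht : t ∈ Ioo 0 δ) :
    SolvesAt p (fun s y => v (s, y)) t := by
  have hp1 : 0 < p - 1 := sub_pos.2 hp
  set g : ℝ → E → ℝ := fun s y => |v (s, y)| ^ (p - 1) * v (s, y) with hgdef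
  have hg : Continuous fun q : ℝ × E => g q.1 q.2 := (continuous_nonlinearity hp).comp hv
  have hgN : ∀ s x, ‖g s x‖ ≤ R ^ (p - 1) * R := fun s x => abs_nonlinearity_le hp (hvR _)
  have hR : 0 ≤ R := (abs_nonneg _).trans (hvR (0, 0))
  have hM0 : 0 ≤ M := (norm_nonneg _).trans (hM 0)
  set m := gaussianMeanNorm E with hm
  have hm0 : 0 ≤ m := gaussianMeanNorm_nonneg
  have hK0 := timeKernelMass_nonneg
  set N := R ^ (p - 1) * R with hN
  have hN0 : 0 ≤ N := by positivity
  -- `B` is the spatial gradient of `v`, read off from the mild formula. It is O(s^(-1/2)), hence so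
  -- is the gradient `G` of the source; this is exactly the regularity under which Duhamel integrals
  -- are classical.
  set B : ℝ → E → E := fun s y => (√(2 * s))⁻¹ • gaussMoment √(2 * s) φ y + duhamelGrad g s y with hB
  have hδ0 : 0 < δ := ht.1.trans ht.2
  have hvB : ∀ s ∈ Ioo 0 δ, ∀ x, HasFDerivAt (fun y => v (s, y)) (innerSL ℝ (B s x)) x := by
    intro s hs x
    have h1 : HasFDerivAt (gaussAvg √(2 * s) φ) _ x :=
      hasFDerivAt_gaussAvg (by have := hs.1; positivity) hφ hM x
    have h2 := h1.add (hasFDerivAt_duhamel hg hgN hs.1 x)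
    rw [← map_add] at h2
    refine h2.congr_of_eventuallyEq (Eventually.of_forall fun y => ?_)
    exact hmild s ⟨hs.1.le, hs.2.le⟩ y
  have hBc : ContinuousOn (fun q : ℝ × E => B q.1 q.2) (Ioo 0 δ ×ˢ univ) := by
    refine ContinuousOn.add (ContinuousOn.smul (ContinuousOn.inv₀ (by fun_prop) fun q hq => ?_) ?_)
      ((continuousOn_duhamelGrad hg hgN).mono (prod_mono_left fun t ht => ht.1))
    · have : 0 < q.1 := hq.1.1
      positivity
    · exact ((continuous_gaussMoment hφ hM).comp
        (by fun_prop : Continuous fun q : ℝ × E => (√(2 * q.1), q.2))).continuousOn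
  have hBb : ∀ s ∈ Ioo 0 δ, ∀ x, ‖B s x‖ ≤ (M * m + δ * timeKernelMass * (N * m)) * (√s)⁻¹ := by
    intro s hs x
    have hs0 : 0 < √s := Real.sqrt_pos.2 hs.1
    have h1 : (√(2 * s))⁻¹ ≤ (√s)⁻¹ := inv_anti₀ hs0 (Real.sqrt_le_sqrt (by linarith [hs.1]))
    have h2 : ‖(√(2 * s))⁻¹ • gaussMoment √(2 * s) φ x‖ ≤ (√s)⁻¹ * (M * m) := by
      rw [norm_smul, norm_inv, Real.norm_of_nonneg (Real.sqrt_nonneg _)]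
      gcongr
      exact norm_gaussMoment_le hM _ _
    have h3 := norm_duhamelGrad_le hg hgN hs.1 x
    have h4 : √s ≤ δ * (√s)⁻¹ := by
      rw [← div_eq_mul_inv, le_div_iff₀ hs0, Real.mul_self_sqrt hs.1.le]
      exact hs.2.le
    have h5 : √s * timeKernelMass * (N * m) ≤ δ * (√s)⁻¹ * timeKernelMass * (N * m) := by gcongr
    refine (norm_add_le _ _).trans ?_
    calc _ ≤ (√s)⁻¹ * (M * m) + δ * (√s)⁻¹ * timeKernelMass * (N * m) :=
          add_le_add h2 (h3.trans h5)
      _ = _ := by ring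
  set G : ℝ → E → E := fun s y => (p * |v (s, y)| ^ (p - 1)) • B s y with hG
  have hGc : ContinuousOn (fun q : ℝ × E => G q.1 q.2) (Ioo 0 δ ×ˢ univ) := by
    have : Continuous fun q : ℝ × E => p * |v (q.1, q.2)| ^ (p - 1) :=
      continuous_const.mul ((continuous_abs.comp hv).rpow_const fun _ => Or.inr hp1.le)
    exact this.continuousOn.smul hBc
  have hgG : ∀ s ∈ Ioo 0 δ, ∀ x, HasFDerivAt (g s) (innerSL ℝ (G s x)) x := by
    intro s hs x
    have := (hasDerivAt_abs_rpow_mul hp (v (s, x))).comp_hasFDerivAt x (hvB s hs x)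
    refine this.congr_fderiv ?_
    exact (map_smul (innerSL ℝ (E := E)) _ _).symm
  have hGb : ∀ s ∈ Ioo 0 δ, ∀ x, ‖G s x‖ ≤
      p * R ^ (p - 1) * (M * m + δ * timeKernelMass * (N * m)) * (√s)⁻¹ := by
    intro s hs x
    have h1 : p * |v (s, x)| ^ (p - 1) ≤ p * R ^ (p - 1) := by
      gcongr; exact hvR _
    rw [norm_smul, Real.norm_of_nonneg (by positivity),
      mul_assoc (p * R ^ (p - 1)) (M * m + δ * timeKernelMass * (N * m))]
    exact mul_le_mul h1 (hBb s hs x) (norm_nonneg _) (by positivity)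
  have hduh := hasParabolicDerivs_duhamel hg hgN hGc hgG hGb
  -- The datum is only continuous, so its heat flow is known to be regular only away from time 0;
  -- the equation is verified on `(t / 2, δ)`.
  obtain ⟨B₁, C₁, hheat⟩ := exists_hasParabolicDerivs_gaussAvg hφ hM (half_pos ht.1)
  have hsub1 : Ioo (t / 2) δ ⊆ Ioi (t / 2) := fun s hs => hs.1
  have hsub2 : Ioo (t / 2) δ ⊆ Ioo 0 δ := Ioo_subset_Ioo_left (half_pos ht.1).le
  have hsum := (hheat.mono hsub1).add (hduh.mono hsub2)
  have hfin := hsum.congr (u' := fun s y => v (s, y)) isOpen_Ioo fun s hs y =>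
    hmild s ⟨(hsub2 hs).1.le, hs.2.le⟩ y
  refine hfin.solvesAt isOpen_Ioo (fun s hs y => ?_) ⟨half_lt_self ht.1, ht.2⟩
  rw [map_add]
  simp only [hgdef]
  ring

/-- The local existence time depends only on a bound for the initial datum. -/
lemma exists_local_solution {p : ℝ} (hp : 1 < p) (M : ℝ) (hM0 : 0 ≤ M) :
    ∃ δ > 0, ∀ φ : E → ℝ, Continuous φ → (∀ x, |φ x| ≤ M) → ∃ u : ℝ → E → ℝ,
      (Continuous fun q : ℝ × E => u q.1 q.2) ∧ (∀ t x, |u t x| ≤ M + 1) ∧ u 0 = φ ∧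
      ∀ t ∈ Ioo 0 δ, SolvesAt p u t := by
  set a := (M + 1) ^ (p - 1) * (M + 1) with ha
  set b := p * (M + 1) ^ (p - 1) with hb
  have ha0 : 0 < a := by positivity
  have hb0 : 0 < b := by positivity
  -- `a` bounds the nonlinearity and `b` its Lipschitz constant on `[-(M + 1), M + 1]`; the two
  -- terms secure the bound `M + 1` and the contraction ratio 1/2.
  refine ⟨min a⁻¹ (1 / 2 * b⁻¹), by positivity, fun φ hφ hM => ?_⟩
  set δ := min a⁻¹ (1 / 2 * b⁻¹)
  have hδ0 : 0 ≤ δ := by positivity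
  have h1 : δ * a ≤ 1 := (mul_le_mul_of_nonneg_right (min_le_left _ _) ha0.le).trans
    (inv_mul_cancel₀ ha0.ne').le
  have h2 : δ * b ≤ 1 / 2 := (mul_le_mul_of_nonneg_right (min_le_right _ _) hb0.le).trans
    (by rw [mul_assoc, inv_mul_cancel₀ hb0.ne', mul_one])
  obtain ⟨v, hv, hvR, hmild⟩ := exists_mild_solution hp hM0 hφ hM hδ0 h1 h2
  refine ⟨fun t x => v (t, x), hv, fun t x => hvR _, ?_, fun t ht =>
    solvesAt_of_mild hp hφ hM hv hvR hmild ht⟩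
  ext x
  change v (0, x) = φ x
  rw [hmild 0 ⟨le_rfl, hδ0⟩]
  simp [gaussAvg, duhamel]

end LocalExistence

/-! ### Maximum principle and comparison. -/

section Comparison

open scoped RealInnerProductSpace

variable {E : Type*} [NormedAddCommGroup E] [InnerProductSpace ℝ E] [FiniteDimensional ℝ E]
  [MeasurableSpace E] [BorelSpace E]

/-- A positive second derivative would make `a` a local minimum too, so `f` would be constant near
`a` and its second derivative zero. -/
lemma deriv_deriv_nonpos_of_isLocalMax {f : ℝ → ℝ} {a : ℝ} (hf : IsLocalMax f a)
    (hc : ContinuousAt f a) : deriv (deriv f) a ≤ 0 := by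
  by_contra! h
  have hmin := isLocalMin_of_deriv_deriv_pos h hf.deriv_eq_zero hc
  have hconst : f =ᶠ[𝓝 a] fun _ => f a := by
    filter_upwards [hf, hmin] with x h1 h2
    exact le_antisymm h1 h2
  have h2 : deriv (deriv f) a = 0 := by
    rw [hconst.deriv.deriv_eq]
    simp
  exact h.ne' h2

lemma laplacian_nonpos_of_isMax {f : E → ℝ} (hf : ContDiff ℝ 2 f) {x : E} (hx : ∀ y, f y ≤ f x) :
    Laplacian.laplacian f x ≤ 0 := by
  rw [InnerProductSpace.laplacian_eq_iteratedFDeriv_stdOrthonormalBasis]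
  refine Finset.sum_nonpos fun i _ => ?_
  rw [iteratedFDeriv_two_apply]
  set v := stdOrthonormalBasis ℝ E i
  have hd : Differentiable ℝ f := hf.differentiable (by norm_num)
  have hd2 : Differentiable ℝ (fderiv ℝ f) :=
    (hf.fderiv_right (m := 1) (by norm_num)).differentiable (by norm_num)
  have hline : ∀ s : ℝ, HasDerivAt (fun s : ℝ => x + s • v) v s := fun s => by
    simpa using ((hasDerivAt_id s).smul_const v).const_add x
  have h1 : ∀ s : ℝ, HasDerivAt (fun s : ℝ => f (x + s • v)) (fderiv ℝ f (x + s • v) v) s :=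
    fun s => (hd _).hasFDerivAt.comp_hasDerivAt s (hline s)
  have h2 : HasDerivAt (fun s : ℝ => fderiv ℝ f (x + s • v) v) (fderiv ℝ (fderiv ℝ f) x v v) 0 := by
    have h3 : HasDerivAt (fun s : ℝ => fderiv ℝ f (x + s • v))
        (fderiv ℝ (fderiv ℝ f) (x + (0 : ℝ) • v) v) 0 :=
      (hd2 _).hasFDerivAt.comp_hasDerivAt 0 (hline 0)
    have h4 := h3.clm_apply (hasDerivAt_const 0 v)
    simpa using h4
  have h5 : deriv (fun s : ℝ => f (x + s • v)) = fun s => fderiv ℝ f (x + s • v) v :=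
    funext fun s => (h1 s).deriv
  have h6 := deriv_deriv_nonpos_of_isLocalMax (f := fun s : ℝ => f (x + s • v)) (a := 0)
    (Eventually.of_forall fun s => by simpa using hx (x + s • v)) (h1 0).continuousAt
  rw [h5, h2.deriv] at h6
  exact h6

lemma contDiff_one_add_norm_sq : ContDiff ℝ 2 fun x : E => 1 + ‖x‖ ^ 2 :=
  contDiff_const.add (contDiff_norm_sq ℝ)

lemma laplacian_one_add_norm_sq (x : E) :
    Laplacian.laplacian (fun x : E => (1 + ‖x‖ ^ 2 : ℝ)) x = (2 * (Module.finrank ℝ E : ℝ) : ℝ) := by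
  rw [laplacian_of_gradient (B := fun x : E => (2 : ℝ) • x)
    (C := fun _ => (2 : ℝ) • ContinuousLinearMap.id ℝ E) (fun y => ?_)
    (fun y => (hasFDerivAt_id y).fun_const_smul 2) continuous_const, endTrace_apply]
  · simp [inner_smul_right, mul_comm]
  · have h : HasFDerivAt (fun x : E => 1 + ‖x‖ ^ 2) _ y := ((hasFDerivAt_id y).norm_sq).const_add 1
    refine h.congr_fderiv ?_
    ext z
    simp

lemma deriv_nonneg_of_left_max {f : ℝ → ℝ} {f' a : ℝ} (hf : HasDerivAt f f' a)
    (h : ∀ᶠ s in 𝓝[<] a, f s ≤ f a) : 0 ≤ f' := by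
  have h1 := (hasDerivAt_iff_tendsto_slope.1 hf).mono_left
    (nhdsWithin_mono a (s := Iio a) (fun s hs => ne_of_lt hs))
  refine ge_of_tendsto h1 ?_
  filter_upwards [h, self_mem_nhdsWithin] with s hs hsa
  rw [slope_def_field]
  exact div_nonneg_of_nonpos (sub_nonpos.2 hs) (sub_nonpos.2 (le_of_lt hsa))

/-- Comparison principle for bounded functions on `[0, T) × E`.  At the points where `w > 0`, the
function `w` only needs to be touched from below by a `C²` function of `x`. -/
lemma nonpos_of_parabolic_inequality {T K b : ℝ} {w : ℝ → E → ℝ}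
    (hcont : ContinuousOn (fun z : ℝ × E => w z.1 z.2) (Ico 0 T ×ˢ univ))
    (hb : ∀ t ∈ Ico 0 T, ∀ x, w t x ≤ b) (h0 : ∀ x, w 0 x ≤ 0)
    (hw : ∀ t ∈ Ioo 0 T, ∀ x, 0 < w t x → ∃ (w' : ℝ) (k : E → ℝ),
      HasDerivAt (fun s => w s x) w' t ∧ ContDiff ℝ 2 k ∧ (∀ y, k y ≤ w t y) ∧ k x = w t x ∧
      w' ≤ Laplacian.laplacian k x + K * w t x) :
    ∀ t ∈ Ico 0 T, ∀ x, w t x ≤ 0 := by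
  intro t₁ ht₁ x₁
  set n : ℝ := (Module.finrank ℝ E : ℝ) with hn
  have hn0 : 0 ≤ n := Nat.cast_nonneg _
  -- The rate makes the barrier ψ = exp(lt)(1 + ‖x‖²) a strict supersolution: Δψ = 2n exp(lt) ≤ 2nψ,
  -- so ψ_t = lψ > Δψ + |K|ψ. Its growth in `x` controls infinity.
  set l : ℝ := |K| + 2 * n + 1 with hl
  have hl0 : 0 ≤ l := by positivity
  set ψ : ℝ → E → ℝ := fun t x => Real.exp (l * t) * (1 + ‖x‖ ^ 2) with hψ
  have hψpos : ∀ t x, 0 < ψ t x := fun t x => by simp only [hψ]; positivity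
  have hψc : Continuous fun z : ℝ × E => ψ z.1 z.2 := by simp only [hψ]; fun_prop
  suffices hε : ∀ ε > 0, w t₁ x₁ ≤ ε * ψ t₁ x₁ by
    by_contra! hpos
    have h := hε (w t₁ x₁ / (2 * ψ t₁ x₁)) (div_pos hpos (by have := hψpos t₁ x₁; positivity))
    have : w t₁ x₁ / (2 * ψ t₁ x₁) * ψ t₁ x₁ = w t₁ x₁ / 2 := by
      have := (hψpos t₁ x₁).ne'
      field_simp
    linarith
  intro ε hε
  by_contra! hcon
  set z : ℝ → E → ℝ := fun t x => w t x - ε * ψ t x with hz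
  have hzc : ContinuousOn (fun q : ℝ × E => z q.1 q.2) (Ico 0 T ×ˢ univ) :=
    hcont.sub (hψc.const_smul ε).continuousOn
  -- For ‖x‖ > ρ ≥ 1 one has εψ ≥ ερ = |b| + ε > w, so `z` can be nonnegative only in a fixed ball.
  set ρ : ℝ := |b| / ε + 1 with hρ
  have hρ1 : 1 ≤ ρ := by rw [hρ]; have : 0 ≤ |b| / ε := by positivity
                         linarith
  have hfar : ∀ t ∈ Ico 0 T, ∀ x, ρ < ‖x‖ → z t x < 0 := by
    intro t ht x hx
    have h1 : w t x ≤ |b| := (hb t ht x).trans (le_abs_self b)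
    have h2 : ε * ρ = |b| + ε := by rw [hρ]; field_simp
    have h3 : ρ ≤ ‖x‖ ^ 2 := by nlinarith
    have h4 : 1 ≤ Real.exp (l * t) := Real.one_le_exp (mul_nonneg hl0 ht.1)
    have h5 : 1 + ‖x‖ ^ 2 ≤ ψ t x := le_mul_of_one_le_left (by positivity) h4
    have h6 : ε * ρ ≤ ε * ψ t x := by gcongr; linarith
    simp only [hz]
    linarith
  set D : Set (ℝ × E) := Icc 0 t₁ ×ˢ Metric.closedBall 0 ρ with hD
  have hDT : D ⊆ Ico 0 T ×ˢ univ := fun q hq =>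
    ⟨⟨hq.1.1, hq.1.2.trans_lt ht₁.2⟩, mem_univ _⟩
  have hDc : IsCompact D := isCompact_Icc.prod (isCompact_closedBall 0 ρ)
  have hSc : IsCompact (D ∩ (fun q : ℝ × E => z q.1 q.2) ⁻¹' Ici 0) :=
    hDc.of_isClosed_subset
      ((hzc.mono hDT).preimage_isClosed_of_isClosed hDc.isClosed isClosed_Ici) inter_subset_left
  have hmemS : ∀ t ∈ Icc 0 t₁, ∀ x, 0 ≤ z t x →
      (t, x) ∈ D ∩ (fun q : ℝ × E => z q.1 q.2) ⁻¹' Ici 0 := by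
    intro t ht x hx
    refine ⟨⟨ht, ?_⟩, hx⟩
    rw [mem_closedBall_zero_iff]
    by_contra! hx2
    exact absurd hx (not_le.2 (hfar t ⟨ht.1, ht.2.trans_lt ht₁.2⟩ x hx2))
  -- Minimising `t` over a compact set gives the first time at which `z` is nonnegative somewhere.
  obtain ⟨⟨t₀, x₀⟩, hm, hmin⟩ := hSc.exists_isMinOn
    ⟨(t₁, x₁), hmemS t₁ ⟨ht₁.1, le_rfl⟩ x₁ (by simp only [hz]; linarith)⟩
    (continuous_fst.continuousOn)
  have ht₀ : t₀ ∈ Icc 0 t₁ := hm.1.1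
  have hz₀ : 0 ≤ z t₀ x₀ := hm.2
  have hneg : ∀ t ∈ Ico 0 t₀, ∀ x, z t x < 0 := by
    intro t ht x
    by_contra! hx
    have := hmin (hmemS t ⟨ht.1, ht.2.le.trans ht₀.2⟩ x hx)
    exact absurd ht.2 (not_lt.2 this)
  have ht₀pos : 0 < t₀ := by
    refine lt_of_le_of_ne ht₀.1 fun h => ?_
    have h1 := h0 x₀
    have h2 := mul_pos hε (hψpos 0 x₀)
    rw [← h] at hz₀
    simp only [hz] at hz₀
    linarith
  have ht₀T : t₀ ∈ Ioo 0 T := ⟨ht₀pos, ht₀.2.trans_lt ht₁.2⟩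
  have hleft : Ico 0 t₀ ∈ 𝓝[<] t₀ := Ico_mem_nhdsLT ht₀pos
  have hle : ∀ x, z t₀ x ≤ 0 := by
    intro x
    have hc : ContinuousAt (fun q : ℝ × E => z q.1 q.2) (t₀, x) :=
      (hzc.mono (prod_mono_left Ioo_subset_Ico_self)).continuousAt
        ((isOpen_Ioo.prod isOpen_univ).mem_nhds ⟨ht₀T, mem_univ _⟩)
    have hc2 : ContinuousAt (fun s => z s x) t₀ :=
      ContinuousAt.comp (f := fun s : ℝ => (s, x)) hc (by fun_prop)
    refine le_of_tendsto (hc2.tendsto.mono_left (nhdsWithin_le_nhds (s := Iio t₀))) ?_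
    filter_upwards [hleft] with s hs
    exact (hneg s hs x).le
  have hz0 : z t₀ x₀ = 0 := le_antisymm (hle x₀) hz₀
  have hwψ : w t₀ x₀ = ε * ψ t₀ x₀ := sub_eq_zero.1 hz0
  obtain ⟨w', k, hw', hk, hkw, hkx, hineq⟩ := hw t₀ ht₀T x₀ (by
    rw [hwψ]; exact mul_pos hε (hψpos _ _))
  have hψ' : HasDerivAt (fun s => ψ s x₀) (l * ψ t₀ x₀) t₀ := by
    have := (((hasDerivAt_id t₀).const_mul l).exp).mul_const (1 + ‖x₀‖ ^ 2)
    refine this.congr_deriv ?_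
    simp only [hψ, id]
    ring
  have htime : 0 ≤ w' - ε * (l * ψ t₀ x₀) := by
    refine deriv_nonneg_of_left_max (hw'.sub (hψ'.const_mul ε)) ?_
    filter_upwards [hleft] with s hs
    exact (hneg s hs x₀).le.trans hz₀
  -- Since k - εψ ≤ z ≤ 0 at time `t₀`, with equality at `x₀`, this smooth difference has a maximum
  -- there.
  have hlap : Laplacian.laplacian k x₀ ≤ ε * Real.exp (l * t₀) * (2 * n) := by
    have hq := contDiff_one_add_norm_sq (E := E)
    have h1 := laplacian_nonpos_of_isMax (x := x₀)
      (hk.sub (hq.const_smul (ε * Real.exp (l * t₀)))) (fun y => by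
        have e1 := hle y
        have e2 := hkw y
        simp only [hz, hψ] at e1 hwψ
        simp only [smul_eq_mul]
        rw [hkx, hwψ]
        linarith)
    change Laplacian.laplacian
      (k - (ε * Real.exp (l * t₀)) • fun x : E => (1 + ‖x‖ ^ 2 : ℝ)) x₀ ≤ 0 at h1
    have hq2 : ContDiff ℝ 2 ((ε * Real.exp (l * t₀)) • fun x : E => (1 + ‖x‖ ^ 2 : ℝ)) :=
      hq.const_smul (ε * Real.exp (l * t₀))
    rw [ContDiffAt.laplacian_sub hk.contDiffAt hq2.contDiffAt,
      InnerProductSpace.laplacian_smul _ hq.contDiffAt, laplacian_one_add_norm_sq] at h1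
    simp only [smul_eq_mul] at h1
    linarith
  have hK : K * w t₀ x₀ ≤ |K| * (ε * ψ t₀ x₀) := by
    rw [hwψ]
    have := hψpos t₀ x₀
    exact mul_le_mul_of_nonneg_right (le_abs_self K) (by positivity)
  have he : 0 < ε * Real.exp (l * t₀) := by positivity
  have e1 : ε * ψ t₀ x₀ = ε * Real.exp (l * t₀) * (1 + ‖x₀‖ ^ 2) := by simp only [hψ]; ring
  have e2 : ε * (l * ψ t₀ x₀) = l * (ε * ψ t₀ x₀) := by ring
  rw [e2, e1] at htime
  rw [e1] at hK
  have : 0 ≤ ‖x₀‖ ^ 2 := by positivity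
  -- The term |K| in `l` absorbs `K * w`; what is left, (2n + 1)(1 + ‖x₀‖²) ≤ 2n, is absurd.
  have h7 : ε * Real.exp (l * t₀) * ((2 * n + 1) * (1 + ‖x₀‖ ^ 2)) ≤
      ε * Real.exp (l * t₀) * (2 * n) := by
    rw [hl] at htime
    linarith
  have h8 := le_of_mul_le_mul_left h7 he
  nlinarith [mul_nonneg hn0 this]

/-- Comparison of bounded solutions of `u_t = Δu + |u|^(p-1) u`. -/
lemma SolvesAt.le_of_initial_le {p T R : ℝ} (hp : 1 < p) {u v : ℝ → E → ℝ}
    (hu : ContinuousOn (fun z : ℝ × E => u z.1 z.2) (Ico 0 T ×ˢ univ))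
    (hv : ContinuousOn (fun z : ℝ × E => v z.1 z.2) (Ico 0 T ×ˢ univ))
    (huR : ∀ t ∈ Ico 0 T, ∀ x, |u t x| ≤ R) (hvR : ∀ t ∈ Ico 0 T, ∀ x, |v t x| ≤ R)
    (hus : ∀ t ∈ Ioo 0 T, SolvesAt p u t) (hvs : ∀ t ∈ Ioo 0 T, SolvesAt p v t)
    (h0 : ∀ x, u 0 x ≤ v 0 x) {t : ℝ} (ht : t ∈ Ico 0 T) (x : E) : u t x ≤ v t x := by
  have key := nonpos_of_parabolic_inequality (w := fun t x => u t x - v t x) (K := p * R ^ (p - 1))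
    (b := R + R) (hu.sub hv)
    (fun t ht x => by
      have h1 := abs_le.1 (huR t ht x); have h2 := abs_le.1 (hvR t ht x); linarith)
    (fun x => sub_nonpos.2 (h0 x)) (fun t ht x hpos => ?_) t ht x
  · linarith
  · have htI : t ∈ Ico 0 T := ⟨ht.1.le, ht.2⟩
    refine ⟨_, fun y => u t y - v t y,
      ((hus t ht).differentiableAt_time x).hasDerivAt.sub
        ((hvs t ht).differentiableAt_time x).hasDerivAt,
      (hus t ht).contDiff_space.sub (hvs t ht).contDiff_space, fun y => le_rfl, rfl, ?_⟩
    have hl : Laplacian.laplacian (fun y => u t y - v t y) x =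
        Laplacian.laplacian (u t) x - Laplacian.laplacian (v t) x :=
      ContDiffAt.laplacian_sub (hus t ht).contDiff_space.contDiffAt
        (hvs t ht).contDiff_space.contDiffAt
    have hf := (le_abs_self _).trans (abs_nonlinearity_sub_le hp (huR t htI x) (hvR t htI x))
    rw [abs_of_pos hpos] at hf
    rw [hl, (hus t ht).equation, (hvs t ht).equation]
    linarith

end Comparison

/-! ### Backward flow of the ODE `y' = y ^ p`. -/

section OdeTransform

/-- The value at time `0` of the solution of `y' = y ^ p` which equals `s` at time `t`. -/
noncomputable def odeInverse (p t s : ℝ) : ℝ := s * (1 + (p - 1) * t * s ^ (p - 1)) ^ (-(p - 1)⁻¹)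

/-- The derivative of `odeInverse p t` in `s`. -/
noncomputable def odeInverseDeriv (p t s : ℝ) : ℝ := (1 + (p - 1) * t * s ^ (p - 1)) ^ (-(p - 1)⁻¹ - 1)

variable {p t s : ℝ} (hp : 1 < p)
include hp

lemma one_le_odeFactor (ht : 0 ≤ t) (hs : 0 ≤ s) : 1 ≤ 1 + (p - 1) * t * s ^ (p - 1) := by
  have : 0 < p - 1 := sub_pos.2 hp
  have : 0 ≤ (p - 1) * t * s ^ (p - 1) := by positivity
  linarith

lemma odeInverse_nonneg (ht : 0 ≤ t) (hs : 0 ≤ s) : 0 ≤ odeInverse p t s := by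
  have := one_le_odeFactor hp ht hs
  unfold odeInverse
  positivity

/-- Dropping the summand `1` leaves a bound free of `s`: it is the initial value whose ODE solution
blows up exactly at time `t`. -/
lemma odeInverse_le (ht : 0 < t) (hs : 0 ≤ s) :
    odeInverse p t s ≤ ((p - 1) * t) ^ (-(p - 1)⁻¹) := by
  have hp1 : 0 < p - 1 := sub_pos.2 hp
  rcases hs.eq_or_lt with rfl | hs
  · rw [odeInverse, zero_mul]; positivity
  have h1 : (1 + (p - 1) * t * s ^ (p - 1)) ^ (-(p - 1)⁻¹) ≤
      ((p - 1) * t * s ^ (p - 1)) ^ (-(p - 1)⁻¹) := by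
    refine Real.rpow_le_rpow_of_nonpos (by positivity) (by linarith) ?_
    have : 0 < (p - 1)⁻¹ := by positivity
    linarith
  have h2 : ((p - 1) * t * s ^ (p - 1)) ^ (-(p - 1)⁻¹) = ((p - 1) * t) ^ (-(p - 1)⁻¹) * s⁻¹ := by
    rw [Real.mul_rpow (by positivity) (by positivity), ← Real.rpow_mul hs.le, mul_neg,
      mul_inv_cancel₀ hp1.ne', Real.rpow_neg_one]
  rw [h2] at h1
  calc odeInverse p t s ≤ s * (((p - 1) * t) ^ (-(p - 1)⁻¹) * s⁻¹) :=
        mul_le_mul_of_nonneg_left h1 hs.le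
    _ = _ := by field_simp

lemma odeInverse_zero_left (s : ℝ) : odeInverse p 0 s = s := by simp [odeInverse]

lemma odeFactor_rpow (ht : 0 ≤ t) (hs : 0 ≤ s) :
    (1 + (p - 1) * t * s ^ (p - 1)) ^ (-(p - 1)⁻¹) =
      odeInverseDeriv p t s * (1 + (p - 1) * t * s ^ (p - 1)) := by
  have h := one_le_odeFactor hp ht hs
  rw [odeInverseDeriv, ← Real.rpow_add_one (by linarith)]
  congr 1
  ring

/-- Chain rule for `odeInverse` along a positive differentiable path. -/
lemma hasDerivAt_odeInverse {y τ : ℝ → ℝ} {y' τ' a : ℝ} (hy : HasDerivAt y y' a)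
    (hτ : HasDerivAt τ τ' a) (hτ0 : 0 ≤ τ a) (hya : 0 < y a) :
    HasDerivAt (fun r => odeInverse p (τ r) (y r))
      (odeInverseDeriv p (τ a) (y a) * (y' - τ' * (y a ^ (p - 1) * y a))) a := by
  have hp1 : 0 < p - 1 := sub_pos.2 hp
  have hq := one_le_odeFactor hp hτ0 hya.le
  have h1 := ((hτ.const_mul (p - 1)).mul (hy.rpow_const (p := p - 1) (Or.inl hya.ne'))).const_add 1
  have h2 := h1.rpow_const (p := -(p - 1)⁻¹) (Or.inl (by simp only [Pi.mul_apply]; linarith))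
  have h3 := hy.mul h2
  -- Constancy along ODE trajectories makes the partial derivative in time equal to -s^p times the
  -- partial derivative in `s`.
  refine h3.congr_deriv ?_
  have e1 : y a ^ (p - 1 - 1) * y a = y a ^ (p - 1) := by
    rw [← Real.rpow_add_one hya.ne', sub_add_cancel]
  have e2 := odeFactor_rpow hp hτ0 hya.le
  simp only [Pi.mul_apply]
  rw [e2, show (1 + (p - 1) * τ a * y a ^ (p - 1)) ^ (-(p - 1)⁻¹ - 1) =
    odeInverseDeriv p (τ a) (y a) from rfl, ← e1]
  field_simp
  ring

/-- The graph of `odeInverse p t` lies below its tangent lines. -/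
lemma odeInverse_le_tangent (ht : 0 ≤ t) {s₀ : ℝ} (hs₀ : 0 < s₀) (hs : 0 ≤ s) :
    odeInverse p t s ≤ odeInverse p t s₀ + odeInverseDeriv p t s₀ * (s - s₀) := by
  have hp1 : 0 < p - 1 := sub_pos.2 hp
  have hq₀ := one_le_odeFactor hp ht hs₀.le
  have hdpos : 0 < odeInverseDeriv p t s₀ := by unfold odeInverseDeriv; positivity
  rcases hs.eq_or_lt with rfl | hs
  · have h1 : odeInverse p t s₀ = s₀ * (odeInverseDeriv p t s₀ * (1 + (p - 1) * t * s₀ ^ (p - 1))) := by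
      rw [← odeFactor_rpow hp ht hs₀.le]; rfl
    rw [h1]
    have h2 : 0 ≤ odeInverseDeriv p t s₀ * s₀ * ((p - 1) * t * s₀ ^ (p - 1)) := by positivity
    have h3 : odeInverse p t 0 = 0 := by simp [odeInverse]
    rw [h3]
    nlinarith
  have hd : ∀ r, 0 < r → HasDerivAt (fun r => odeInverse p t r - odeInverseDeriv p t s₀ * r)
      (odeInverseDeriv p t r - odeInverseDeriv p t s₀) r := fun r hr => by
    have h1 := (hasDerivAt_odeInverse hp (hasDerivAt_id r) (hasDerivAt_const r t) ht hr).sub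
      ((hasDerivAt_id r).const_mul (odeInverseDeriv p t s₀))
    refine h1.congr_deriv ?_
    simp
  have hanti : ∀ r r', 0 < r → r ≤ r' → odeInverseDeriv p t r' ≤ odeInverseDeriv p t r := by
    intro r r' hr hrr'
    refine Real.rpow_le_rpow_of_nonpos (by have := one_le_odeFactor hp ht hr.le; linarith) ?_ ?_
    · gcongr
    · have : 0 < (p - 1)⁻¹ := by positivity
      linarith
  -- `odeInverseDeriv` decreases in `s`, so `odeInverse` minus the linear function with its slope at
  -- `s₀` increases up to `s₀` and decreases afterwards.
  have hmax := isMaxOn_Ioi_of_deriv (a := 0) (hd s₀ hs₀).continuousAt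
    (fun r hr => (hd r hr.1).differentiableAt.differentiableWithinAt)
    (fun r hr => (hd r (hs₀.trans hr)).differentiableAt.differentiableWithinAt)
    (fun r hr => by
      rw [(hd r hr.1).deriv]
      exact sub_nonneg.2 (hanti r s₀ hr.1 hr.2.le))
    (fun r hr => by
      rw [(hd r (hs₀.trans hr)).deriv]
      exact sub_nonpos.2 (hanti s₀ r hs₀ (le_of_lt hr)))
  have := hmax (mem_Ioi.2 hs)
  simp only [mem_ofPred_eq] at this
  linarith

end OdeTransform

/-! ### Bounding the heat flow by the solution. -/

section LowerBound

open ProbabilityTheory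
open scoped RealInnerProductSpace

variable {E : Type*} [NormedAddCommGroup E] [InnerProductSpace ℝ E] [FiniteDimensional ℝ E]
  [MeasurableSpace E] [BorelSpace E]

lemma heat_equation_gaussAvg {φ : E → ℝ} {M : ℝ} (hφ : Continuous φ) (hM : ∀ x, ‖φ x‖ ≤ M) {t : ℝ}
    (ht : 0 < t) : ContDiff ℝ 2 (gaussAvg √(2 * t) φ) ∧ ∀ x, HasDerivAt
      (fun t => gaussAvg √(2 * t) φ x) (Laplacian.laplacian (gaussAvg √(2 * t) φ) x) t := by
  obtain ⟨B, C, h⟩ := exists_hasParabolicDerivs_gaussAvg hφ hM (half_pos ht)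
  have htI : t ∈ Ioi (t / 2) := half_lt_self ht
  have hC : Continuous (C t) :=
    continuousOn_univ.1 (h.continuousOn_space_two.comp
      (by fun_prop : ContinuousOn (fun y : E => (t, y)) univ) (fun y _ => ⟨htI, mem_univ _⟩))
  refine ⟨contDiff_two_of_gradient (h.space t htI) (h.space_two t htI) hC, fun x => ?_⟩
  rw [laplacian_of_gradient (h.space t htI) (h.space_two t htI) hC]
  exact h.time t htI x

variable {p T R : ℝ} (hp : 1 < p) {u : ℝ → E → ℝ}
  (hu : ContinuousOn (fun z : ℝ × E => u z.1 z.2) (Ico 0 T ×ˢ univ))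
  (huR : ∀ t ∈ Ico 0 T, ∀ x, |u t x| ≤ R)
  (hus : ∀ t ∈ Ioo 0 T, SolvesAt p u t)

lemma solvesAt_zero (t : ℝ) : SolvesAt p (fun (_ : ℝ) (_ : E) => (0 : ℝ)) t := by
  refine ⟨fun x => by fun_prop, contDiff_const, fun x => ?_, fun x => ?_, fun x => ?_, fun x => ?_⟩
  · simp only [deriv_const]; exact continuousAt_const
  · simp only [fderiv_const_apply]; exact continuousAt_const
  · have : ∀ y : E, iteratedFDeriv ℝ 2 (fun _ : E => (0 : ℝ)) y = 0 := fun y => by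
      have := iteratedFDeriv_fun_zero (𝕜 := ℝ) (E := E) (F := ℝ) (n := 2)
      exact congrFun this y
    simp only [this]
    exact continuousAt_const
  · simp [InnerProductSpace.laplacian_const]

include hp hu huR hus

lemma solution_nonneg (h0 : ∀ x, 0 ≤ u 0 x) {t : ℝ} (ht : t ∈ Ico 0 T) (x : E) : 0 ≤ u t x :=
  SolvesAt.le_of_initial_le (u := fun _ _ => 0) (R := R) hp continuousOn_const hu
    (fun t ht x => by rw [abs_zero]; exact (abs_nonneg _).trans (huR t ht x)) huR
    (fun t _ => solvesAt_zero t) hus h0 ht x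

/-- A nonnegative solution is a supersolution of the heat equation. The bound serves to make `u`
positive wherever the heat flow exceeds `odeInverse p t (u t x)`. -/
lemma gaussAvg_le_solution {φ : E → ℝ} {M : ℝ} (hφ : Continuous φ) (hφ0 : ∀ x, 0 ≤ φ x)
    (hM : ∀ x, ‖φ x‖ ≤ M) (h0 : ∀ x, u 0 x = φ x) {t : ℝ} (ht : t ∈ Ico 0 T) (x : E) :
    gaussAvg √(2 * t) φ x ≤ u t x := by
  have hnn := fun t ht => solution_nonneg hp hu huR hus (fun x => (hφ0 x).trans_eq (h0 x).symm)
    (t := t) ht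
  have hc : Continuous fun z : ℝ × E => gaussAvg √(2 * z.1) φ z.2 :=
    (continuous_gaussAvg hφ hM).comp (by fun_prop : Continuous fun z : ℝ × E => (√(2 * z.1), z.2))
  have key := nonpos_of_parabolic_inequality (w := fun t x => gaussAvg √(2 * t) φ x - u t x)
    (K := 0) (b := M) (hc.continuousOn.sub hu)
    (fun t ht x => by
      have h1 := (le_abs_self _).trans (norm_gaussAvg_le √(2 * t) hM x)
      have h2 := hnn t ht x
      linarith)
    (fun x => by rw [h0]; simp [gaussAvg]) (fun t ht x hpos => ?_) t ht x
  · linarith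
  · obtain ⟨hd, hheat⟩ := heat_equation_gaussAvg hφ hM ht.1
    refine ⟨_, fun y => gaussAvg √(2 * t) φ y - u t y,
      (hheat x).sub ((hus t ht).differentiableAt_time x).hasDerivAt,
      hd.sub (hus t ht).contDiff_space, fun y => le_rfl, rfl, ?_⟩
    have hl : Laplacian.laplacian (fun y => gaussAvg √(2 * t) φ y - u t y) x =
        Laplacian.laplacian (gaussAvg √(2 * t) φ) x - Laplacian.laplacian (u t) x :=
      ContDiffAt.laplacian_sub hd.contDiffAt (hus t ht).contDiff_space.contDiffAt
    rw [hl, (hus t ht).equation]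
    have : 0 ≤ |u t x| ^ (p - 1) * u t x :=
      mul_nonneg (by positivity) (hnn t ⟨ht.1.le, ht.2⟩ x)
    linarith

/-- The heat flow of the initial datum is bounded as long as the solution exists. -/
lemma gaussAvg_le_of_solution {φ : E → ℝ} {M : ℝ} (hφ : Continuous φ) (hφ0 : ∀ x, 0 ≤ φ x)
    (hM : ∀ x, ‖φ x‖ ≤ M) (h0 : ∀ x, u 0 x = φ x) {t : ℝ} (ht : t ∈ Ioo 0 T) (x : E) :
    gaussAvg √(2 * t) φ x ≤ ((p - 1) * t) ^ (-(p - 1)⁻¹) := by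
  have hp1 : 0 < p - 1 := sub_pos.2 hp
  have hnn := fun t ht => solution_nonneg hp hu huR hus (fun x => (hφ0 x).trans_eq (h0 x).symm)
    (t := t) ht
  have hle := fun t ht => gaussAvg_le_solution hp hu huR hus hφ hφ0 hM h0 (t := t) ht
  have hc : Continuous fun z : ℝ × E => gaussAvg √(2 * z.1) φ z.2 :=
    (continuous_gaussAvg hφ hM).comp (by fun_prop : Continuous fun z : ℝ × E => (√(2 * z.1), z.2))
  have hGc : ContinuousOn (fun z : ℝ × E => odeInverse p z.1 (u z.1 z.2)) (Ico 0 T ×ˢ univ) := by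
    have h1 : ContinuousOn (fun z : ℝ × E => 1 + (p - 1) * z.1 * u z.1 z.2 ^ (p - 1))
        (Ico 0 T ×ˢ univ) :=
      continuousOn_const.add ((by fun_prop : ContinuousOn (fun z : ℝ × E => (p - 1) * z.1) _).mul
        (hu.rpow_const fun z _ => Or.inr hp1.le))
    refine hu.mul (h1.rpow_const fun z hz => Or.inl ?_)
    have := one_le_odeFactor hp hz.1.1 (hnn z.1 hz.1 z.2)
    linarith
  have key := nonpos_of_parabolic_inequality
    (w := fun t x => gaussAvg √(2 * t) φ x - odeInverse p t (u t x))
    (K := 0) (b := M) (hc.continuousOn.sub hGc)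
    (fun t ht x => by
      have h1 := (le_abs_self _).trans (norm_gaussAvg_le √(2 * t) hM x)
      have h2 := odeInverse_nonneg hp ht.1 (hnn t ht x)
      linarith)
    (fun x => by rw [odeInverse_zero_left hp, h0]; simp [gaussAvg])
    (fun t ht x hpos => ?_) t ⟨ht.1.le, ht.2⟩ x
  · have := odeInverse_le hp ht.1 (hnn t ⟨ht.1.le, ht.2⟩ x)
    linarith
  · have htI : t ∈ Ico 0 T := ⟨ht.1.le, ht.2⟩
    obtain ⟨hd, hheat⟩ := heat_equation_gaussAvg hφ hM ht.1
    have hux : 0 < u t x := by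
      have h1 := odeInverse_nonneg hp ht.1.le (hnn t htI x)
      have h2 := hle t htI x
      linarith
    set c := odeInverseDeriv p t (u t x) with hcdef
    have hG' := hasDerivAt_odeInverse hp ((hus t ht).differentiableAt_time x).hasDerivAt
      (hasDerivAt_id t) ht.1.le hux
    have hcd : ContDiff ℝ 2 (c • u t) := (hus t ht).contDiff_space.const_smul c
    -- The composite of `odeInverse` with `u` need not be C² where `u` vanishes. By concavity,
    -- replacing it with its tangent at `u t x` yields a C² function touching from below.
    refine ⟨_, (gaussAvg √(2 * t) φ - c • u t) - fun _ => odeInverse p t (u t x) - c * u t x,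
      (hheat x).sub hG', (hd.sub hcd).sub contDiff_const, fun y => ?_, ?_, ?_⟩
    · have := odeInverse_le_tangent hp ht.1.le hux (hnn t htI y)
      simp only [Pi.sub_apply, Pi.smul_apply, smul_eq_mul]
      linarith
    · simp only [Pi.sub_apply, Pi.smul_apply, smul_eq_mul]
      ring
    -- The chain rule turns u_t into u_t - u^p = Δu, so the time derivative equals the Laplacian of
    -- the touching function exactly.
    · have hl : Laplacian.laplacian (((gaussAvg √(2 * t) φ - c • u t) -
          fun _ => odeInverse p t (u t x) - c * u t x : E → ℝ)) x = Laplacian.laplacian (gaussAvg √(2 * t) φ) x - c * Laplacian.laplacian (u t) x := by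
        have hsub : ContDiff ℝ 2 (gaussAvg √(2 * t) φ - c • u t) := hd.sub hcd
        rw [ContDiffAt.laplacian_sub hsub.contDiffAt contDiff_const.contDiffAt,
          ContDiffAt.laplacian_sub hd.contDiffAt hcd.contDiffAt,
          InnerProductSpace.laplacian_smul _ (hus t ht).contDiff_space.contDiffAt,
          InnerProductSpace.laplacian_const]
        simp
      rw [hl, (hus t ht).equation]
      simp only [id, ← hcdef, abs_of_pos hux]
      linarith

end LowerBound

/-! ### From heat flow bounds to densities. -/

section Averaging

open ProbabilityTheory

variable {E : Type*} [NormedAddCommGroup E] [InnerProductSpace ℝ E] [FiniteDimensional ℝ E]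
  [MeasurableSpace E] [BorelSpace E]

lemma lintegral_ofReal_gaussAvg {φ : E → ℝ} {M : ℝ} (hφ : Continuous φ) (hφ0 : ∀ x, 0 ≤ φ x)
    (hM : ∀ x, ‖φ x‖ ≤ M) (a : ℝ) (x : E) :
    ∫⁻ z, ENNReal.ofReal (φ (x + a • z)) ∂(stdGaussian E) = ENNReal.ofReal (gaussAvg a φ x) :=
  (ofReal_integral_eq_lintegral_ofReal (integrable_comp_affine hφ hM x a)
    (ae_of_all _ fun _ => hφ0 _)).symm

/-- Integrate the heat flow over `B(0, r + aR)` and exchange integrals. For each `z` in `B(0, R)`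
the translate of `{φ ≥ α} ∩ B(0, r)` by `-a • z` stays in the larger ball, keeps its volume, and
carries values of the integrand at least `α`. -/
lemma stdGaussian_ball_mul_le {φ : E → ℝ} {M S a : ℝ} (hφ : Continuous φ) (hφ0 : ∀ x, 0 ≤ φ x)
    (hM : ∀ x, ‖φ x‖ ≤ M) (ha : 0 < a) (hS : ∀ x, gaussAvg a φ x ≤ S) (α R r : ℝ) :
    stdGaussian E (Metric.ball 0 R) *
        (ENNReal.ofReal α * volume ({x | α ≤ φ x} ∩ Metric.ball 0 r)) ≤
      ENNReal.ofReal S * volume (Metric.ball (0 : E) (r + a * R)) := by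
  have hmeas : Measurable fun q : E × E => ENNReal.ofReal (φ (q.1 + a • q.2)) :=
    (hφ.comp (by fun_prop)).measurable.ennreal_ofReal
  have hA : MeasurableSet ({x | α ≤ φ x} ∩ Metric.ball 0 r) :=
    (measurableSet_le measurable_const hφ.measurable).inter measurableSet_ball
  calc _ = ∫⁻ _ in Metric.ball 0 R,
        ENNReal.ofReal α * volume ({x | α ≤ φ x} ∩ Metric.ball 0 r) ∂(stdGaussian E) := by
        rw [setLIntegral_const, mul_comm]
    _ ≤ ∫⁻ z in Metric.ball 0 R, (∫⁻ x in Metric.ball 0 (r + a * R),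
        ENNReal.ofReal (φ (x + a • z))) ∂(stdGaussian E) := by
        refine setLIntegral_mono' measurableSet_ball fun z hz => ?_
        rw [← measure_preimage_add_right volume (a • z), ← setLIntegral_const]
        have hsub : (fun x => x + a • z) ⁻¹' ({x | α ≤ φ x} ∩ Metric.ball 0 r) ⊆
            Metric.ball 0 (r + a * R) := fun x hx => by
          have h1 : ‖x + a • z‖ < r := by simpa using hx.2
          have h2 : ‖a • z‖ < a * R := by
            rw [norm_smul, Real.norm_of_nonneg ha.le]
            exact mul_lt_mul_of_pos_left (by simpa using hz) ha
          have h3 := norm_sub_le (x + a • z) (a • z)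
          rw [add_sub_cancel_right] at h3
          simpa using by linarith
        refine le_trans ?_ (lintegral_mono_set hsub)
        exact setLIntegral_mono' (hA.preimage (measurable_add_const _)) fun x hx =>
          ENNReal.ofReal_le_ofReal hx.1
    _ ≤ ∫⁻ z, (∫⁻ x in Metric.ball 0 (r + a * R),
        ENNReal.ofReal (φ (x + a • z))) ∂(stdGaussian E) := setLIntegral_le_lintegral _ _
    _ = ∫⁻ x in Metric.ball 0 (r + a * R), ∫⁻ z,
        ENNReal.ofReal (φ (x + a • z)) ∂(stdGaussian E) := by
        exact lintegral_lintegral_swap (f := fun z x => ENNReal.ofReal (φ (x + a • z)))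
          (hmeas.comp measurable_swap).aemeasurable
    _ ≤ ∫⁻ _ in Metric.ball (0 : E) (r + a * R), ENNReal.ofReal S := by
        refine lintegral_mono fun x => ?_
        rw [lintegral_ofReal_gaussAvg hφ hφ0 hM]
        exact ENNReal.ofReal_le_ofReal (hS x)
    _ = _ := setLIntegral_const _ _

lemma tendsto_stdGaussian_ball :
    Tendsto (fun R : ℝ => stdGaussian E (Metric.ball 0 R)) atTop (𝓝 1) := by
  have h := tendsto_measure_iUnion_atTop (μ := stdGaussian E)
    (s := fun R : ℝ => Metric.ball (0 : E) R) fun _ _ h => Metric.ball_subset_ball h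
  have hU : ⋃ R : ℝ, Metric.ball (0 : E) R = univ :=
    eq_univ_of_forall fun x => mem_iUnion.2 ⟨‖x‖ + 1, by simp⟩
  rwa [hU, measure_univ] at h

lemma volume_ball_add_div (c : ℝ) {r : ℝ} (hr : 0 < r) (hrc : 0 < r + c) :
    volume (Metric.ball (0 : E) (r + c)) / volume (Metric.ball (0 : E) r) =
      ENNReal.ofReal ((1 + c / r) ^ Module.finrank ℝ E) := by
  have h : r + c = (1 + c / r) * r := by field_simp
  have h0 : 0 < 1 + c / r := by
    rw [h] at hrc
    exact pos_of_mul_pos_left hrc hr.le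
  rw [h, Measure.addHaar_ball_mul_of_pos _ _ h0, mul_div_assoc, ENNReal.div_self, mul_one]
  · exact (Metric.measure_ball_pos _ _ hr).ne'
  · exact measure_ball_lt_top.ne

/-- A uniform bound for the heat flow of `φ` controls the upper densities of its superlevel
sets. -/
lemma ofReal_mul_upperDensity_le {n : ℕ} {φ : EuclideanSpace ℝ (Fin n) → ℝ} {M S a : ℝ}
    (hφ : Continuous φ) (hφ0 : ∀ x, 0 ≤ φ x) (hM : ∀ x, ‖φ x‖ ≤ M) (ha : 0 < a)
    (hS : ∀ x, gaussAvg a φ x ≤ S) (α : ℝ) :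
    ENNReal.ofReal α * upperDensity φ α ≤ ENNReal.ofReal S := by
  have hR : ∀ R : ℝ, 0 < R → stdGaussian (EuclideanSpace ℝ (Fin n)) (Metric.ball 0 R) *
      (ENNReal.ofReal α * upperDensity φ α) ≤ ENNReal.ofReal S := by
    intro R hR0
    rw [upperDensity, ← mul_assoc, ← ENNReal.limsup_const_mul_of_ne_top
      (ENNReal.mul_ne_top (measure_ne_top _ _) ENNReal.ofReal_ne_top)]
    -- With `R` fixed, enlarging the radius from `r` to `r + a * R` does not change the volume to
    -- leading order as r → ∞.
    have hlim : Tendsto (fun r : ℝ => ENNReal.ofReal S * ENNReal.ofReal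
        ((1 + a * R / r) ^ Module.finrank ℝ (EuclideanSpace ℝ (Fin n)))) atTop
        (𝓝 (ENNReal.ofReal S)) := by
      have h1 : Tendsto (fun r : ℝ => (1 + a * R / r) ^
          Module.finrank ℝ (EuclideanSpace ℝ (Fin n))) atTop (𝓝 1) := by
        simpa using ((tendsto_const_nhds (x := (1 : ℝ))).add
          (tendsto_const_nhds (x := a * R) |>.div_atTop tendsto_id)).pow
          (Module.finrank ℝ (EuclideanSpace ℝ (Fin n)))
      have h2 := ENNReal.Tendsto.const_mul (a := ENNReal.ofReal S)
        (ENNReal.tendsto_ofReal h1) (Or.inr ENNReal.ofReal_ne_top)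
      simpa using h2
    rw [← hlim.limsup_eq]
    refine limsup_le_limsup ?_
    filter_upwards [eventually_gt_atTop 0] with r hr
    rw [← volume_ball_add_div (a * R) hr (by positivity), ballDensity, ← mul_div_assoc,
      ← mul_div_assoc, mul_assoc]
    refine ENNReal.div_le_div_right ?_ _
    exact stdGaussian_ball_mul_le hφ hφ0 hM ha hS α R r
  -- Only after r → ∞ is `R` sent to infinity, which restores full Gaussian mass.
  have hlim := ENNReal.Tendsto.mul_const
    (tendsto_stdGaussian_ball (E := EuclideanSpace ℝ (Fin n)))
    (b := ENNReal.ofReal α * upperDensity φ α) (Or.inl one_ne_zero)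
  rw [one_mul] at hlim
  refine le_of_tendsto hlim ?_
  filter_upwards [eventually_gt_atTop 0] with R h using hR R h

end Averaging

/-! ### Turning density bounds into time bounds. -/

section LifeSpanBound

lemma upperDensity_le_one {n : ℕ} (φ : EuclideanSpace ℝ (Fin n) → ℝ) (α : ℝ) :
    upperDensity φ α ≤ 1 := by
  refine limsup_le_of_le (by isBoundedDefault) (Eventually.of_forall fun r => ?_)
  exact ENNReal.div_le_of_le_mul (by rw [one_mul]; exact measure_mono inter_subset_right)

lemma exists_upperDensity_ne_zero {n : ℕ} {φ : EuclideanSpace ℝ (Fin n) → ℝ}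
    (h : ¬ IsRarefactionFunAtInfty φ) : ∃ α : ℝ, 0 < α ∧ upperDensity φ α ≠ 0 := by
  contrapose! h
  intro α hα
  -- For nonnegative densities, a vanishing limsup is already a limit.
  exact tendsto_of_le_liminf_of_limsup_le bot_le (h α hα).le

/-- The pointwise bound `m ≤ ((p - 1) τ)^(-1/(p-1))` read as a bound for `τ`. -/
lemma ofReal_le_of_le_rpow {p τ : ℝ} (hp : 1 < p) (hτ : 0 < τ) {m : ℝ≥0∞}
    (h : m ≤ ENNReal.ofReal (((p - 1) * τ) ^ (-(p - 1)⁻¹))) :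
    ENNReal.ofReal τ ≤ ENNReal.ofReal (1 / (p - 1)) * m ^ (1 - p) := by
  have hp1 : 0 < p - 1 := sub_pos.2 hp
  have h1 : ENNReal.ofReal ((p - 1) * τ) ≤ m ^ (1 - p) := by
    have h2 := ENNReal.inv_le_inv.2 (ENNReal.rpow_le_rpow h hp1.le)
    rwa [← ENNReal.rpow_neg, ← ENNReal.rpow_neg, neg_sub, ENNReal.ofReal_rpow_of_pos (by positivity), ← Real.rpow_mul (by positivity),
      show -(p - 1)⁻¹ * (1 - p) = 1 by field_simp; ring, Real.rpow_one] at h2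
  calc ENNReal.ofReal τ = ENNReal.ofReal (1 / (p - 1)) * ENNReal.ofReal ((p - 1) * τ) := by
        rw [← ENNReal.ofReal_mul (by positivity)]
        congr 1
        field_simp
    _ ≤ _ := by gcongr

end LifeSpanBound

/-! ### Uniqueness, continuation, maximal solution and blow-up. -/

section Maximal

variable {n : ℕ} {p T S : ℝ} {φ : EuclideanSpace ℝ (Fin n) → ℝ}
  {u v : ℝ → EuclideanSpace ℝ (Fin n) → ℝ}

lemma IsClassicalSolution.solvesAt (h : IsClassicalSolution p φ T u) {t : ℝ} (ht : t ∈ Ioo 0 T) :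
    SolvesAt p u t := by
  have hn : ∀ x : EuclideanSpace ℝ (Fin n), Ioo 0 T ×ˢ univ ∈ 𝓝 (t, x) := fun x =>
    prod_mem_nhds (Ioo_mem_nhds ht.1 ht.2) univ_mem
  exact ⟨h.differentiableAt_time t ht, h.contDiff_space t ht,
    fun x => h.continuousOn_deriv_time.continuousAt (hn x),
    fun x => h.continuousOn_fderiv_space.continuousAt (hn x),
    fun x => h.continuousOn_fderiv2_space.continuousAt (hn x), h.equation t ht⟩

lemma isClassicalSolution_of_solvesAt (hT : 0 < T)
    (hu : ContinuousOn (fun z : ℝ × EuclideanSpace ℝ (Fin n) => u z.1 z.2) (Ico 0 T ×ˢ univ))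
    (hus : ∀ t ∈ Ioo 0 T, SolvesAt p u t) (h0 : ∀ x, u 0 x = φ x)
    (hb : ∀ S ∈ Ico 0 T, ∃ M : ℝ, ∀ t ∈ Icc 0 S, ∀ x, |u t x| ≤ M) :
    IsClassicalSolution p φ T u where
  pos := hT
  continuousOn := hu
  differentiableAt_time t ht := (hus t ht).differentiableAt_time
  contDiff_space t ht := (hus t ht).contDiff_space
  continuousOn_deriv_time z hz := ((hus z.1 hz.1).continuousAt_deriv_time z.2).continuousWithinAt
  continuousOn_fderiv_space z hz :=
    ((hus z.1 hz.1).continuousAt_fderiv_space z.2).continuousWithinAt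
  continuousOn_fderiv2_space z hz :=
    ((hus z.1 hz.1).continuousAt_fderiv2_space z.2).continuousWithinAt
  equation t ht := (hus t ht).equation
  initial := h0
  bounded := hb

lemma IsClassicalSolution.mono (h : IsClassicalSolution p φ T u) (hS : 0 < S) (hST : S ≤ T) :
    IsClassicalSolution p φ S u :=
  isClassicalSolution_of_solvesAt hS
    (h.continuousOn.mono (prod_mono (Ico_subset_Ico_right hST) Subset.rfl))
    (fun _ ht => h.solvesAt ⟨ht.1, ht.2.trans_le hST⟩) h.initial
    fun r hr => h.bounded r ⟨hr.1, hr.2.trans_le hST⟩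

/-- Solutions are bounded only strictly before their end times, so both are restricted to an
intermediate interval, where a common bound allows comparison in both directions. -/
lemma IsClassicalSolution.eq_of_lt (hp : 1 < p) (hu : IsClassicalSolution p φ T u)
    (hv : IsClassicalSolution p φ S v) {t : ℝ} (h0 : 0 ≤ t) (htT : t < T) (htS : t < S) :
    u t = v t := by
  obtain ⟨r, htr, hr⟩ := exists_between (lt_min htT htS)
  have hrT := hr.trans_le (min_le_left _ _)
  have hrS := hr.trans_le (min_le_right _ _)
  have hr0 := h0.trans_lt htr
  obtain ⟨A, hA⟩ := hu.bounded r ⟨hr0.le, hrT⟩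
  obtain ⟨B, hB⟩ := hv.bounded r ⟨hr0.le, hrS⟩
  have hA' : ∀ s ∈ Ico 0 r, ∀ x, |u s x| ≤ max A B := fun s hs x =>
    (hA s ⟨hs.1, hs.2.le⟩ x).trans (le_max_left _ _)
  have hB' : ∀ s ∈ Ico 0 r, ∀ x, |v s x| ≤ max A B := fun s hs x =>
    (hB s ⟨hs.1, hs.2.le⟩ x).trans (le_max_right _ _)
  have hu' := hu.mono hr0 hrT.le
  have hv' := hv.mono hr0 hrS.le
  ext x
  exact le_antisymm
    (SolvesAt.le_of_initial_le hp hu'.continuousOn hv'.continuousOn hA' hB'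
      (fun _ => hu'.solvesAt) (fun _ => hv'.solvesAt)
      (fun x => (hu.initial x).trans_le (hv.initial x).ge) ⟨h0, htr⟩ x)
    (SolvesAt.le_of_initial_le hp hv'.continuousOn hu'.continuousOn hB' hA'
      (fun _ => hv'.solvesAt) (fun _ => hu'.solvesAt)
      (fun x => (hv.initial x).trans_le (hu.initial x).ge) ⟨h0, htr⟩ x)

lemma IsClassicalSolution.continuous_slice (hu : IsClassicalSolution p φ T u) {t : ℝ}
    (ht : t ∈ Ico 0 T) : Continuous (u t) :=
  continuousOn_univ.1 (hu.continuousOn.comp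
    (by fun_prop : ContinuousOn (fun y : EuclideanSpace ℝ (Fin n) => (t, y)) univ)
    (fun _ _ => ⟨ht, mem_univ _⟩))

lemma IsClassicalSolution.shift (hu : IsClassicalSolution p φ T u) {a : ℝ} (ha : a ∈ Ico 0 T) :
    IsClassicalSolution p (u a) (T - a) fun t => u (t + a) := by
  refine isClassicalSolution_of_solvesAt (sub_pos.2 ha.2)
    (hu.continuousOn.comp (f := fun z : ℝ × EuclideanSpace ℝ (Fin n) => (z.1 + a, z.2))
      (by fun_prop) fun z hz => ⟨⟨add_nonneg hz.1.1 ha.1, lt_sub_iff_add_lt.1 hz.1.2⟩, mem_univ _⟩)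
    (fun t ht => SolvesAt.shift (hu.solvesAt
      ⟨add_pos_of_pos_of_nonneg ht.1 ha.1, lt_sub_iff_add_lt.1 ht.2⟩))
    (fun x => by simp) fun r hr => ?_
  obtain ⟨M, hM⟩ := hu.bounded (r + a) ⟨add_nonneg hr.1 ha.1, lt_sub_iff_add_lt.1 hr.2⟩
  exact ⟨M, fun t ht x => hM _ ⟨add_nonneg ht.1 ha.1, by linarith [ht.2]⟩ x⟩

/-- Local existence, with a life span depending only on a bound for the initial datum. -/
lemma exists_isClassicalSolution (hp : 1 < p) {M : ℝ} (hM : 0 ≤ M) :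
    ∃ δ : ℝ, 0 < δ ∧ ∀ φ : EuclideanSpace ℝ (Fin n) → ℝ, Continuous φ → (∀ x, |φ x| ≤ M) →
      ∃ u : ℝ → EuclideanSpace ℝ (Fin n) → ℝ, IsClassicalSolution p φ δ u ∧
        (Continuous fun z : ℝ × EuclideanSpace ℝ (Fin n) => u z.1 z.2) ∧
        ∀ t x, |u t x| ≤ M + 1 := by
  obtain ⟨δ, hδ, h⟩ := exists_local_solution (E := EuclideanSpace ℝ (Fin n)) hp M hM
  refine ⟨δ, hδ, fun φ hφ hφM => ?_⟩
  obtain ⟨u, hu, hub, h0, hus⟩ := h φ hφ hφM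
  exact ⟨u, isClassicalSolution_of_solvesAt hδ hu.continuousOn hus (fun x => by rw [h0])
    fun _ _ => ⟨M + 1, fun t _ => hub t⟩, hu, hub⟩

/-- A solution which is bounded by `M` at some time extends by a definite amount. -/
lemma exists_extension (hp : 1 < p) {M : ℝ} (hM : 0 ≤ M) :
    ∃ δ : ℝ, 0 < δ ∧ ∀ (φ : EuclideanSpace ℝ (Fin n) → ℝ) (T : ℝ)
      (u : ℝ → EuclideanSpace ℝ (Fin n) → ℝ), IsClassicalSolution p φ T u →
      ∀ a ∈ Ico 0 T, (∀ x, |u a x| ≤ M) → ∃ v, IsClassicalSolution p φ (a + δ) v := by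
  obtain ⟨δ, hδ, hloc⟩ := exists_isClassicalSolution (n := n) hp hM
  refine ⟨δ, hδ, fun φ T u hu a ha hua => ?_⟩
  obtain ⟨w, hw, hwc, hwb⟩ := hloc (u a) (hu.continuous_slice ha) hua
  have hw0 : ∀ x, w 0 x = u a x := hw.initial
  -- Gluing without a case split: for t ≤ a the last two terms cancel, for t ≥ a the first and the
  -- last. Continuity across `a` is then immediate.
  set v : ℝ → EuclideanSpace ℝ (Fin n) → ℝ := fun t x =>
    u (min t a) x + w (max (t + -a) 0) x - u a x with hv
  have hvle : ∀ t ≤ a, v t = u t := fun t ht => by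
    ext x
    simp only [hv, min_eq_left ht, max_eq_right (show t + -a ≤ 0 by linarith), hw0]
    ring
  have hvge : ∀ t, a ≤ t → v t = w (t + -a) := fun t ht => by
    ext x
    simp only [hv, min_eq_right ht, max_eq_left (show 0 ≤ t + -a by linarith)]
    ring
  -- By uniqueness the glued function agrees with `u` slightly beyond `a`, so the equation holds at
  -- the junction too.
  have hvu : ∀ t, t < T → t < a + δ → v t = u t := fun t htT htδ => by
    rcases le_total t a with h | h
    · exact hvle t h
    · rw [hvge t h, hw.eq_of_lt hp (hu.shift ha) (by linarith) (by linarith) (by linarith)]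
      simp
  refine ⟨v, isClassicalSolution_of_solvesAt (by linarith [ha.1]) ?_ ?_ ?_ ?_⟩
  · refine ContinuousOn.sub (ContinuousOn.add ?_ ?_) ?_
    · exact hu.continuousOn.comp (f := fun z : ℝ × EuclideanSpace ℝ (Fin n) => (min z.1 a, z.2))
        (by fun_prop) fun z hz => ⟨⟨le_min hz.1.1 ha.1, (min_le_right _ _).trans_lt ha.2⟩,
          mem_univ _⟩
    · exact (hwc.comp (by fun_prop : Continuous fun z : ℝ × EuclideanSpace ℝ (Fin n) =>
        (max (z.1 + -a) 0, z.2))).continuousOn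
    · exact ((hu.continuous_slice ha).comp continuous_snd).continuousOn
  · intro t ht
    rcases le_or_gt t a with h | h
    · refine (hu.solvesAt ⟨ht.1, h.trans_lt ha.2⟩).congr ?_
      filter_upwards [Iio_mem_nhds (h.trans_lt ha.2), Iio_mem_nhds ht.2] with s hs hs'
      exact hvu s hs hs'
    · have hws : SolvesAt p w (t + -a) := hw.solvesAt ⟨by linarith, by linarith [ht.2]⟩
      refine hws.shift.congr ?_
      filter_upwards [Ioi_mem_nhds h] with s hs using hvge s (le_of_lt hs)
  · intro x
    rw [hvle 0 ha.1, hu.initial]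
  · obtain ⟨A, hA⟩ := hu.bounded a ha
    refine fun r _ => ⟨max A (M + 1), fun t ht x => ?_⟩
    rcases le_total t a with h | h
    · rw [hvle t h]
      exact (hA t ⟨ht.1, h⟩ x).trans (le_max_left _ _)
    · rw [hvge t h]
      exact (hwb _ x).trans (le_max_right _ _)

open Classical in
/-- The union of all classical solutions with initial datum `φ`. -/
noncomputable def solutionUnion (p : ℝ) (φ : EuclideanSpace ℝ (Fin n) → ℝ) (t : ℝ) :
    EuclideanSpace ℝ (Fin n) → ℝ :=
  if h : ∃ (S : ℝ) (v : ℝ → EuclideanSpace ℝ (Fin n) → ℝ), IsClassicalSolution p φ S v ∧ t < S then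
    h.choose_spec.choose t else 0

/-- Uniqueness makes the choice in `solutionUnion` immaterial. -/
lemma IsClassicalSolution.eq_solutionUnion (hp : 1 < p) (hv : IsClassicalSolution p φ S v) {t : ℝ}
    (ht : t ∈ Ico 0 S) : v t = solutionUnion p φ t := by
  have h : ∃ (S : ℝ) (v : ℝ → EuclideanSpace ℝ (Fin n) → ℝ), IsClassicalSolution p φ S v ∧ t < S :=
    ⟨S, v, hv, ht.2⟩
  rw [solutionUnion, dif_pos h]
  exact hv.eq_of_lt hp h.choose_spec.choose_spec.1 ht.1 ht.2 h.choose_spec.choose_spec.2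

/-- If the existence times of classical solutions are bounded, there is a maximal solution. -/
lemma exists_isMaximalSolution (hp : 1 < p) (hφ : Continuous φ) {M : ℝ} (hM : ∀ x, |φ x| ≤ M)
    {B : ℝ} (hB : ∀ S v, IsClassicalSolution p φ S v → S ≤ B) :
    ∃ T, IsMaximalSolution p φ T (solutionUnion p φ) := by
  obtain ⟨δ, hδ, h⟩ := exists_isClassicalSolution (n := n) hp ((abs_nonneg _).trans (hM 0))
  obtain ⟨w, hw, -⟩ := h φ hφ hM
  set A : Set ℝ := {S | ∃ v, IsClassicalSolution p φ S v} with hA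
  have hne : A.Nonempty := ⟨δ, w, hw⟩
  have hbdd : BddAbove A := ⟨B, fun S ⟨v, hv⟩ => hB S v hv⟩
  have hle : ∀ S v, IsClassicalSolution p φ S v → S ≤ sSup A := fun S v hv => le_csSup hbdd ⟨v, hv⟩
  have hlt : ∀ t, t < sSup A → ∃ S v, IsClassicalSolution p φ S v ∧ t < S := fun t ht => by
    obtain ⟨S, ⟨v, hv⟩, h⟩ := exists_lt_of_lt_csSup hne ht
    exact ⟨S, v, hv, h⟩
  refine ⟨sSup A, isClassicalSolution_of_solvesAt (hδ.trans_le (hle δ w hw)) ?_ ?_ ?_ ?_,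
    fun S v hv => ⟨hle S v hv, fun t ht x => congrFun (hv.eq_solutionUnion hp ht) x⟩⟩
  · refine continuousOn_of_locally_continuousOn fun z hz => ?_
    obtain ⟨S, v, hv, hS⟩ := hlt z.1 hz.1.2
    refine ⟨Iio S ×ˢ univ, isOpen_Iio.prod isOpen_univ, ⟨hS, mem_univ _⟩, ?_⟩
    refine (hv.continuousOn.mono fun y hy => ⟨⟨hy.1.1.1, hy.2.1⟩, mem_univ _⟩).congr
      fun y hy => ?_
    exact congrFun (hv.eq_solutionUnion hp ⟨hy.1.1.1, hy.2.1⟩).symm y.2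
  · intro t ht
    obtain ⟨S, v, hv, hS⟩ := hlt t ht.2
    refine (hv.solvesAt ⟨ht.1, hS⟩).congr ?_
    filter_upwards [Ioo_mem_nhds ht.1 hS] with s hs
    exact (hv.eq_solutionUnion hp ⟨hs.1.le, hs.2⟩).symm
  · intro x
    rw [← hw.eq_solutionUnion hp ⟨le_rfl, hδ⟩, hw.initial]
  · intro r hr
    obtain ⟨S, v, hv, hS⟩ := hlt r hr.2
    obtain ⟨K, hK⟩ := hv.bounded r ⟨hr.1, hS⟩
    refine ⟨K, fun t ht x => ?_⟩
    rw [← hv.eq_solutionUnion hp ⟨ht.1, ht.2.trans_lt hS⟩]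
    exact hK t ht x

/-- The set where the bound fails is open, and nonempty open sets have positive measure. -/
lemma abs_le_of_eLpNorm_top_le {f : EuclideanSpace ℝ (Fin n) → ℝ} (hf : Continuous f)
    {m : NNReal} (h : eLpNorm f ∞ volume ≤ m) (x : EuclideanSpace ℝ (Fin n)) : |f x| ≤ m := by
  have hae : ∀ᵐ y, |f y| ≤ m := by
    rw [eLpNorm_exponent_top] at h
    filter_upwards [ae_le_eLpNormEssSup (f := f) (μ := volume)] with y hy
    have h1 : ‖f y‖₊ ≤ m := by exact_mod_cast (hy.trans h)
    exact_mod_cast h1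
  have hopen : IsOpen {y | ¬ |f y| ≤ m} := by
    simp only [not_le]
    exact isOpen_lt continuous_const hf.abs
  by_contra hx
  exact (hopen.measure_pos volume ⟨x, hx⟩).ne' hae

/-- A maximal solution blows up at the end of its interval of existence. -/
lemma IsMaximalSolution.blowsUpAt (hp : 1 < p) (h : IsMaximalSolution p φ T u) :
    BlowsUpAt u T := by
  refine ENNReal.tendsto_nhds_top_iff_nnreal.2 fun m => ?_
  by_contra hfreq
  obtain ⟨δ, hδ, hext⟩ := exists_extension (n := n) hp m.2
  have hT := h.isClassicalSolution.pos
  -- If the norm is at most `m` at times arbitrarily close to `T`, one such time exceeds `T - δ`. As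
  -- `δ` depends only on `m`, the extension from there passes `T`. This gives a limit and not merely
  -- an unbounded norm.
  have hmem : Ioo (max 0 (T - δ)) T ∈ 𝓝[<] T := Ioo_mem_nhdsLT (by simp [hT, hδ])
  obtain ⟨a, ham, ha⟩ := ((not_eventually.1 hfreq).and_eventually hmem).exists
  have ha0 : a ∈ Ico 0 T := ⟨(le_max_left _ _).trans ha.1.le, ha.2⟩
  obtain ⟨v, hv⟩ := hext φ T u h.isClassicalSolution a ha0
    (abs_le_of_eLpNorm_top_le (h.isClassicalSolution.continuous_slice ha0) (not_lt.1 ham))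
  have h1 := (h.maximal _ v hv).1
  have h2 := (le_max_right _ _).trans_lt ha.1
  linarith

/-- The life span bound in terms of a single superlevel set. -/
lemma IsClassicalSolution.ofReal_le (hp : 1 < p) (hφ : Continuous φ) (hφ0 : ∀ x, 0 ≤ φ x) {M : ℝ}
    (hM : ∀ x, |φ x| ≤ M) (hu : IsClassicalSolution p φ T u) (α : ℝ) :
    ENNReal.ofReal T ≤ ENNReal.ofReal (1 / (p - 1)) *
      (ENNReal.ofReal α * upperDensity φ α) ^ (1 - p) := by
  have hlim : Tendsto ENNReal.ofReal (𝓝[<] T) (𝓝 (ENNReal.ofReal T)) :=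
    ENNReal.continuous_ofReal.continuousWithinAt
  refine le_of_tendsto hlim ?_
  -- The heat flow bound needs a bounded solution slightly past `τ`; the estimate is proved for τ <
  -- T and passes to the limit.
  filter_upwards [Ioo_mem_nhdsLT hu.pos] with τ hτ
  obtain ⟨r, hτr, hrT⟩ := exists_between hτ.2
  have hr0 := hτ.1.trans hτr
  obtain ⟨R, hR⟩ := hu.bounded r ⟨hr0.le, hrT⟩
  have hu' := hu.mono hr0 hrT.le
  refine ofReal_le_of_le_rpow hp hτ.1 (ofReal_mul_upperDensity_le hφ hφ0 hM
    (a := √(2 * τ)) (Real.sqrt_pos.2 (by linarith [hτ.1])) (fun x => ?_) α)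
  exact gaussAvg_le_of_solution hp hu'.continuousOn (fun t ht => hR t ⟨ht.1, ht.2.le⟩)
    (fun _ => hu'.solvesAt) hφ hφ0 hM hu.initial ⟨hτ.1, hτr⟩ x

end Maximal

end NonRarefied

/-! ### Blow-up and the life span estimate. -/

theorem theorem1 (n : ℕ) (hn : 1 ≤ n) (p : ℝ) (hp : 1 < p)
    (φ : EuclideanSpace ℝ (Fin n) → ℝ) (hφ_cont : Continuous φ) (hφ_nonneg : ∀ x, 0 ≤ φ x)
    (hφ_bdd : ∃ M : ℝ, ∀ x, φ x ≤ M)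
    (hφ : ¬ NonRarefied.IsRarefactionFunAtInfty φ) :
    ∃ (T : ℝ) (u : ℝ → EuclideanSpace ℝ (Fin n) → ℝ),
      NonRarefied.IsMaximalSolution p φ T u ∧
      NonRarefied.BlowsUpAt u T ∧
      ENNReal.ofReal T ≤ ENNReal.ofReal (1 / (p - 1)) *
        ⨅ (α : ℝ) (_ : 0 < α),
          (ENNReal.ofReal α * NonRarefied.upperDensity φ α) ^ (1 - p) := by
  obtain ⟨M, hM⟩ := hφ_bdd
  have hM' : ∀ x, |φ x| ≤ M := fun x => by rw [abs_of_nonneg (hφ_nonneg x)]; exact hM x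
  have hp1 : 0 < 1 / (p - 1) := one_div_pos.2 (sub_pos.2 hp)
  -- A single level of positive upper density makes the bound finite, hence the existence times
  -- bounded. Levels of zero density give `0 ^ (1 - p) = ∞` and no restriction.
  obtain ⟨α, hα, hD⟩ := NonRarefied.exists_upperDensity_ne_zero hφ
  have hfin : ENNReal.ofReal (1 / (p - 1)) *
      (ENNReal.ofReal α * NonRarefied.upperDensity φ α) ^ (1 - p) ≠ ∞ := by
    refine ENNReal.mul_ne_top ENNReal.ofReal_ne_top
      (ENNReal.rpow_ne_top_of_ne_zero (mul_ne_zero (ENNReal.ofReal_pos.2 hα).ne' hD)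
        (ENNReal.mul_ne_top ENNReal.ofReal_ne_top ?_))
    exact ((NonRarefied.upperDensity_le_one φ α).trans_lt ENNReal.one_lt_top).ne
  obtain ⟨T, hT⟩ := NonRarefied.exists_isMaximalSolution hp hφ_cont hM' fun S v hv =>
    (ENNReal.ofReal_le_iff_le_toReal hfin).1 (hv.ofReal_le hp hφ_cont hφ_nonneg hM' α)
  refine ⟨T, _, hT, hT.blowsUpAt hp, ?_⟩
  rw [ENNReal.mul_iInf_of_ne (ENNReal.ofReal_pos.2 hp1).ne' ENNReal.ofReal_ne_top]
  refine le_iInf fun β => ?_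
  rw [ENNReal.mul_iInf_of_ne (ENNReal.ofReal_pos.2 hp1).ne' ENNReal.ofReal_ne_top]
  exact le_iInf fun _ => hT.isClassicalSolution.ofReal_le hp hφ_cont hφ_nonneg hM' β
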